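/- **Setting and notation.** Let $d\ge 1$ and let $\mathcal S_d$ be the set of $\phi:\mathbb Z^d\to\mathbb C$ with $\sum_{x}|x^\beta\phi(x)|<\infty$ for every multi-index $\beta\in\mathbb N^d$. Put $\phi^{(1)}=\phi$, $\phi^{(n+1)}(x)=\sum_{y\in\mathbb Z^d}\phi^{(n)}(x-y)\phi(y)$, $\widehat\phi(\xi)=\sum_{x}\phi(x)e^{ix\cdot\xi}$ for $\xi\in\mathbb R^d$, and $\Omega(\phi)=\{\xi\in(-\pi,\pi]^d:|\widehat\phi(\xi)|=1\}$. For $E\in\mathrm{End}(\mathbb R^d)$ and $t>0$ let $t^E=\exp((\log t)E)$; $\{t^E\}$ is *contracting* if $\|t^E\|\to0$ as $t\to0^+$. For $P:\mathbb R^d\to\mathbb R$ let $\mathrm{Exp}(P)$ be the set of $E$ with $P(t^E\xi)=tP(\xi)$ for all $t>0$, $\xi\in\mathbb R^d$ ("$P$ is homogeneous with respect to $E$"). $P$ is *positive homogeneous* if it is continuous, $P\ge0$, $P(\xi)=0$ only for $\xi=0$, $\mathrm{Exp}(P)\ne\emptyset$ and $\{P=1\}$ is compact; its *homogeneous order* is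 $\mu_P=\operatorname{tr}E$ for any $E\in\mathrm{Exp}(P)$ (this does not depend on $E$). Let $\{t^E\}$ be contracting. A function $f$ that is continuous near $0$ is *subhomogeneous* with respect to $E$ if for all $\epsilon>0$ and compact $K$ there is $\tau>0$ with $|f(t^E\xi)|\le\epsilon t$ for $0<t<\tau$, $\xi\in K$. It is *strongly subhomogeneous of order $l$* if it is $C^l$ near $0$ and for all $\epsilon>0$ and compact $K$ there is $\tau>0$ with $|t^j\partial_t^j f(t^E\xi)|\le\epsilon t$ for all $0\le j\le l$, $0<t<\tau$, $\xi\in K$. For $\xi_0\in\Omega(\phi)$ write, near $0$ and with the principal logarithm, $$\log\frac{\widehat\phi(\xi+\xi_0)}{\widehat\phi(\xi_0)}=i\alpha_{\xi_0}\cdot\xi-i\big(Q_{\xi_0}(\xi)+\widetilde Q_{\xi_0}(\xi)\big)-\big(R_{\xi_0}(\xi)+\widetilde R_{\xi_0}(\xi)\big),$$ where $\alpha_{\xi_0}\in\mathbb R^d$ (the *drift*), $Q_{\xi_0},R_{\xi_0}$ are real polynomials without constant and linear terms, and $\widetilde Q_{\xi_0},\widetilde R_{\xi_0}$ are the real-valued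 remainders. The point $\xi_0$ is of * *positive homogeneous type* if $R_{\xi_0}$ is positive homogeneous and there is $E\in\mathrm{Exp}(R_{\xi_0})\cap\mathrm{Exp}(Q_{\xi_0})$ with respect to which $\widetilde R_{\xi_0}$ and $\widetilde Q_{\xi_0}$ are subhomogeneous; then $\mu_{\xi_0}=\mu_{R_{\xi_0}}$ and $P_{\xi_0}=R_{\xi_0}+iQ_{\xi_0}$; * *imaginary homogeneous type* if $|Q_{\xi_0}|$ and $R_{\xi_0}$ are positive homogeneous and there are $E\in\mathrm{Exp}(|Q_{\xi_0}|)$ and a real $k>1$ with $E/k\in\mathrm{Exp}(R_{\xi_0})$ such that $\widetilde Q_{\xi_0}$ is strongly subhomogeneous with respect to $E$ of order $2$ and $\widetilde R_{\xi_0}$ is strongly subhomogeneous with respect to $E/k$ of order $1$; then $\mu_{\xi_0}=\mu_{|Q_{\xi_0}|}$. For $t>0$ and $x\in\mathbb R^d$ the *attractors* are $$H_P^t(x)=\frac1{(2\pi)^d}\int_{\mathbb R^d}e^{-tP(\xi)}e^{-ix\cdot\xi}\,d\xi,\qquad H_{iQ}^t(x)=\frac1{(2\pi)^d}\lim_{\tau\to\infty}\int_{\{|Q|<\tau\}}e^{-itQ(\xi)-ix\cdot\xi}\,d\xi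 .$$ **Theorem.** Let $\phi\in\mathcal S_d$ with $\sup_\xi|\widehat\phi(\xi)|=1$. Suppose that every $\xi\in\Omega(\phi)$ is of positive or of imaginary homogeneous type for $\widehat\phi$, and fix at every $\xi\in\Omega(\phi)$ an expansion $(\alpha_\xi,Q_\xi,R_\xi)$ as above that shows this. Let $\Omega_p(\phi)$ and $\Omega_i(\phi)$ be the sets of points of positive and of imaginary homogeneous type, and $\mu_\phi=\min_{\xi\in\Omega(\phi)}\mu_\xi$. If $\Omega_i(\phi)\neq\emptyset$, assume also that 1. $\mu_\xi<1$ for every $\xi\in\Omega_i(\phi)$, 2. $\mu_\xi=\mu_\phi$ for some $\xi\in\Omega_i(\phi)$, 3. there is $\alpha\in\mathbb R^d$ with $\alpha_\xi=\alpha$ for all $\xi\in\Omega_i(\phi)$. Then $\Omega(\phi)$ is finite, the integrals defining $H_{P_\xi}^t(x)$ for $\xi\in\Omega_p(\phi)$ converge absolutely, the limits defining $H_{iQ_\xi}^t(x)$ for $\xi\in\Omega_i(\phi)$ exist (for all $t>0$, $x\in\mathbb R^d$), and the following holds as $n\to\infty$. *Case 1.* If $\Omega(\phi)=\Omega_p(\phi)$,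 then, uniformly for $x\in\mathbb Z^d$, $$\phi^{(n)}(x)=\sum_{\xi\in\Omega(\phi),\ \mu_\xi=\mu_\phi}\widehat\phi(\xi)^ne^{-ix\cdot\xi}H_{P_\xi}^n(x-n\alpha_\xi)+o(n^{-\mu_\phi}).$$ *Case 2.* Suppose $\Omega_i(\phi)\ne\emptyset$. (a) If $\Omega(\phi)=\Omega_i(\phi)$ or $\mu_\xi>\mu_\phi$ for all $\xi\in\Omega_p(\phi)$, then every $\xi\in\Omega(\phi)$ with $\mu_\xi=\mu_\phi$ is in $\Omega_i(\phi)$, and for each compact $K\subseteq\mathbb R^d$ there is a nested increasing sequence of compact sets $K_n$, all containing $K$ and with union $\mathbb R^d$, such that, uniformly for $x\in(n\alpha+K_n)\cap\mathbb Z^d$, $$\phi^{(n)}(x)=\sum_{\xi\in\Omega(\phi),\ \mu_\xi=\mu_\phi}\widehat\phi(\xi)^ne^{-ix\cdot\xi}H_{iQ_\xi}^n(x-n\alpha)+o(n^{-\mu_\phi}).$$ (b) If $\Omega_i(\phi)$ and $\Omega_p(\phi)$ both contain points of order $\mu_\phi$, then for each compact $K\subseteq\mathbb R^d$ there is a nested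 increasing sequence of compact sets $K_n$, all containing $K$ and with union $\mathbb R^d$, such that, uniformly for $x\in(n\alpha+K_n)\cap\mathbb Z^d$, $$\phi^{(n)}(x)=\sum_{\xi\in\Omega_i(\phi),\ \mu_\xi=\mu_\phi}\widehat\phi(\xi)^ne^{-ix\cdot\xi}H_{iQ_\xi}^n(x-n\alpha)+\sum_{\zeta\in\Omega_p(\phi),\ \mu_\zeta=\mu_\phi}\widehat\phi(\zeta)^ne^{-ix\cdot\zeta}H_{P_\zeta}^n(x-n\alpha_\zeta)+o(n^{-\mu_\phi}).$$ -/

import Mathlib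

open Filter Topology MeasureTheory

namespace LLT

noncomputable section

/-- Euclidean space `ℝ^d`. -/
abbrev Space (d : ℕ) := EuclideanSpace ℝ (Fin d)

/-- The integer lattice `ℤ^d`. -/
abbrev Lattice (d : ℕ) := Fin d → ℤ

/-- The inclusion `ℤ^d ⊆ ℝ^d`. -/
def toSpace {d : ℕ} (x : Lattice d) : Space d := WithLp.toLp 2 (fun i => (x i : ℝ))

/-! ### Convolution powers and Fourier transform -/

/-- The space `S_d` of all `φ : ℤ^d → ℂ` with `‖x^β φ‖₁ < ∞` for every multi-index `β`. -/
def RapidlyDecreasing (d : ℕ) : Set (Lattice d → ℂ) :=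
  {φ | ∀ β : Fin d → ℕ, Summable fun x : Lattice d => ‖(∏ i, (x i : ℂ) ^ β i) * φ x‖}

/-- Convolution powers: `φ^{(n+1)}(x) = ∑_y φ^{(n)}(x - y) φ(y)`, starting from the unit mass at
`0` for `n = 0`, so that `φ^{(1)} = φ` (see `convPow_one`). -/
def convPow {d : ℕ} (φ : Lattice d → ℂ) : ℕ → Lattice d → ℂ
  | 0 => Pi.single 0 1
  | n + 1 => fun x => ∑' y, convPow φ n (x - y) * φ y

theorem convPow_one {d : ℕ} (φ : Lattice d → ℂ) : convPow φ 1 = φ := by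
  funext x
  simp only [convPow]
  rw [tsum_eq_single x]
  · simp
  · intro y hy
    have h : x - y ≠ 0 := sub_ne_zero.mpr (Ne.symm hy)
    simp [Pi.single_eq_of_ne h]

/-- The Fourier transform `φ̂(ξ) = ∑_x φ(x) e^{i x·ξ}`. -/
def fourier {d : ℕ} (φ : Lattice d → ℂ) (ξ : Space d) : ℂ :=
  ∑' x : Lattice d, φ x * Complex.exp (Complex.I * ((inner ℝ (toSpace x) ξ : ℝ) : ℂ))

/-- `Ω(φ)`: the points of `(-π, π]^d` at which `|φ̂| = 1`. -/
def Omega {d : ℕ} (φ : Lattice d → ℂ) : Set (Space d) :=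
  {ξ | (∀ i, ξ i ∈ Set.Ioc (-Real.pi) Real.pi) ∧ ‖fourier φ ξ‖ = 1}

/-- `Γ_{ξ₀}(ξ) = log (φ̂(ξ + ξ₀) / φ̂(ξ₀))`, principal branch. Only its values for `ξ` near `0`
matter. -/
def Gamma {d : ℕ} (φ : Lattice d → ℂ) (ξ₀ ξ : Space d) : ℂ :=
  Complex.log (fourier φ (ξ + ξ₀) / fourier φ ξ₀)

/-! ### Homogeneity -/

/-- `t^E = exp ((log t) E)`, used for `t > 0`. -/
def tpow {d : ℕ} (t : ℝ) (E : Space d →L[ℝ] Space d) : Space d →L[ℝ] Space d :=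
  NormedSpace.exp (Real.log t • E)

/-- `{t^E}` is contracting: `‖t^E‖ → 0` as `t → 0+`. -/
def IsContracting {d : ℕ} (E : Space d →L[ℝ] Space d) : Prop :=
  Tendsto (fun t : ℝ => ‖tpow t E‖) (𝓝[>] 0) (𝓝 0)

/-- The exponent set of `P`: all `E` with `P(t^E ξ) = t P(ξ)` for all `t > 0` and `ξ`, i.e. those
`E` with respect to which `P` is homogeneous. -/
def exponentSet {d : ℕ} (P : Space d → ℝ) : Set (Space d →L[ℝ] Space d) :=
  {E | ∀ t : ℝ, 0 < t → ∀ ξ, P (tpow t E ξ) = t * P ξ}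

/-- Positive homogeneous functions. -/
structure IsPositiveHomogeneous {d : ℕ} (P : Space d → ℝ) : Prop where
  continuous : Continuous P
  nonneg : ∀ ξ, 0 ≤ P ξ
  eq_zero : ∀ ξ, P ξ = 0 → ξ = 0
  exponentSet_nonempty : (exponentSet P).Nonempty
  isCompact_level : IsCompact {η | P η = 1}

open Classical in
/-- The homogeneous order of a positive homogeneous `P`: the trace of any `E ∈ Exp(P)` (this does
not depend on `E`). -/
def homOrder {d : ℕ} (P : Space d → ℝ) : ℝ :=
  if h : (exponentSet P).Nonempty then LinearMap.trace ℝ (Space d) h.some.toLinearMap else 0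

/-- `f`, continuous near `0`, is subhomogeneous with respect to `E`. -/
def IsSubhomogeneous {d : ℕ} (f : Space d → ℝ) (E : Space d →L[ℝ] Space d) : Prop :=
  IsContracting E ∧
  (∃ U : Set (Space d), IsOpen U ∧ 0 ∈ U ∧ ContinuousOn f U) ∧
  ∀ ε : ℝ, 0 < ε → ∀ K : Set (Space d), IsCompact K → ∃ τ : ℝ, 0 < τ ∧
    ∀ t : ℝ, 0 < t → t < τ → ∀ ξ ∈ K, |f (tpow t E ξ)| ≤ ε * t

/-- `f`, of class `C^l` near `0`, is strongly subhomogeneous with respect to `E` of order `l`. -/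
def IsStronglySubhomogeneous {d : ℕ} (f : Space d → ℝ) (E : Space d →L[ℝ] Space d) (l : ℕ) :
    Prop :=
  IsContracting E ∧
  (∃ U : Set (Space d), IsOpen U ∧ 0 ∈ U ∧ ContDiffOn ℝ l f U) ∧
  ∀ ε : ℝ, 0 < ε → ∀ K : Set (Space d), IsCompact K → ∃ τ : ℝ, 0 < τ ∧
    ∀ k : ℕ, k ≤ l → ∀ t : ℝ, 0 < t → t < τ → ∀ ξ ∈ K,
      |t ^ k * iteratedDeriv k (fun s : ℝ => f (tpow s E ξ)) t| ≤ ε * t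

/-! ### Local expansions and the two types of points -/

/-- A choice of drift `α` and of real polynomials `Q`, `R` without constant and linear terms, to
be used in the expansion
`Γ_{ξ₀}(ξ) = i α·ξ - i (Q(ξ) + Q̃(ξ)) - (R(ξ) + R̃(ξ))` (see `Gamma_eq`). -/
structure Expansion (d : ℕ) where
  drift : Space d
  polyQ : MvPolynomial (Fin d) ℝ
  polyR : MvPolynomial (Fin d) ℝ
  polyQ_coeff : ∀ m : Fin d →₀ ℕ, m.degree ≤ 1 → polyQ.coeff m = 0
  polyR_coeff : ∀ m : Fin d →₀ ℕ, m.degree ≤ 1 → polyR.coeff m = 0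

namespace Expansion

variable {d : ℕ}

/-- The polynomial function `Q`. -/
def Q (D : Expansion d) (ξ : Space d) : ℝ := MvPolynomial.eval (fun i => ξ i) D.polyQ

/-- The polynomial function `R`. -/
def R (D : Expansion d) (ξ : Space d) : ℝ := MvPolynomial.eval (fun i => ξ i) D.polyR

/-- The remainder `Q̃`, determined by the expansion. -/
def remQ (D : Expansion d) (φ : Lattice d → ℂ) (ξ₀ ξ : Space d) : ℝ :=
  inner ℝ D.drift ξ - (Gamma φ ξ₀ ξ).im - D.Q ξ

/-- The remainder `R̃`, determined by the expansion. -/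
def remR (D : Expansion d) (φ : Lattice d → ℂ) (ξ₀ ξ : Space d) : ℝ :=
  -(Gamma φ ξ₀ ξ).re - D.R ξ

theorem Gamma_eq (D : Expansion d) (φ : Lattice d → ℂ) (ξ₀ ξ : Space d) :
    Gamma φ ξ₀ ξ = Complex.I * ((inner ℝ D.drift ξ : ℝ) : ℂ)
      - Complex.I * ((D.Q ξ : ℂ) + (D.remQ φ ξ₀ ξ : ℂ))
      - ((D.R ξ : ℂ) + (D.remR φ ξ₀ ξ : ℂ)) := by
  apply Complex.ext <;> simp [remQ, remR]

/-- `ξ₀` is of positive homogeneous type for `φ̂`, as witnessed by the expansion `D`. -/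
def IsPositiveType (D : Expansion d) (φ : Lattice d → ℂ) (ξ₀ : Space d) : Prop :=
  IsPositiveHomogeneous D.R ∧
  ∃ E ∈ exponentSet D.R, E ∈ exponentSet D.Q ∧
    IsSubhomogeneous (D.remR φ ξ₀) E ∧ IsSubhomogeneous (D.remQ φ ξ₀) E

/-- `ξ₀` is of imaginary homogeneous type for `φ̂`, as witnessed by the expansion `D`. -/
def IsImaginaryType (D : Expansion d) (φ : Lattice d → ℂ) (ξ₀ : Space d) : Prop :=
  IsPositiveHomogeneous (fun ξ => |D.Q ξ|) ∧ IsPositiveHomogeneous D.R ∧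
  ∃ E ∈ exponentSet (fun ξ => |D.Q ξ|), ∃ k : ℝ, 1 < k ∧ k⁻¹ • E ∈ exponentSet D.R ∧
    IsStronglySubhomogeneous (D.remQ φ ξ₀) E 2 ∧
    IsStronglySubhomogeneous (D.remR φ ξ₀) (k⁻¹ • E) 1

open Classical in
/-- The homogeneous order `μ_{ξ₀}`: it is `μ_R` at points of positive homogeneous type and
`μ_{|Q|}` at points of imaginary homogeneous type. -/
def order (D : Expansion d) (φ : Lattice d → ℂ) (ξ₀ : Space d) : ℝ :=
  if D.IsPositiveType φ ξ₀ then homOrder D.R else homOrder (fun ξ => |D.Q ξ|)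

end Expansion

/-! ### Objects attached to a choice of an expansion at every point -/

section

variable {d : ℕ}

/-- `Ω_p(φ)`. -/
def OmegaP (φ : Lattice d → ℂ) (D : Space d → Expansion d) : Set (Space d) :=
  {ξ ∈ Omega φ | (D ξ).IsPositiveType φ ξ}

/-- `Ω_i(φ)`. -/
def OmegaI (φ : Lattice d → ℂ) (D : Space d → Expansion d) : Set (Space d) :=
  {ξ ∈ Omega φ | (D ξ).IsImaginaryType φ ξ}

/-- The homogeneous order `μ_φ`, the minimum of `μ_ξ` over `ξ ∈ Ω(φ)`. -/
def orderPhi (φ : Lattice d → ℂ) (D : Space d → Expansion d) : ℝ :=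
  sInf ((fun ξ => (D ξ).order φ ξ) '' Omega φ)

/-- The elements of `s` whose homogeneous order equals `μ_φ`. -/
def minimalPoints (φ : Lattice d → ℂ) (D : Space d → Expansion d) (s : Set (Space d)) :
    Set (Space d) :=
  {ξ ∈ s | (D ξ).order φ ξ = orderPhi φ D}

end

/-! ### Attractors -/

section

variable {d : ℕ}

/-- The integrand `e^{-t (R(ξ) + i Q(ξ))} e^{-i x·ξ}`. -/
def integrandP (R Q : Space d → ℝ) (t : ℝ) (x ξ : Space d) : ℂ :=
  Complex.exp (-(t : ℂ) * ((R ξ : ℂ) + Complex.I * (Q ξ : ℂ)))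
    * Complex.exp (-Complex.I * ((inner ℝ x ξ : ℝ) : ℂ))

/-- The attractor `H_P^t(x) = (2π)^{-d} ∫ e^{-t P(ξ)} e^{-i x·ξ} dξ` with `P = R + i Q`. -/
def attractorP (R Q : Space d → ℝ) (t : ℝ) (x : Space d) : ℂ :=
  (1 / (2 * (Real.pi : ℂ)) ^ d) * ∫ ξ, integrandP R Q t x ξ

/-- The truncated integral `∫_{|Q| < τ} e^{-i t Q(ξ) - i x·ξ} dξ`. -/
def truncatedIntegral (Q : Space d → ℝ) (t : ℝ) (x : Space d) (τ : ℝ) : ℂ :=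
  ∫ ξ in {ξ | |Q ξ| < τ},
    Complex.exp (-Complex.I * (t : ℂ) * (Q ξ : ℂ) - Complex.I * ((inner ℝ x ξ : ℝ) : ℂ))

/-- Convergence of the renormalized integral of `e^{-i t Q(ξ) - i x·ξ}` associated to the
approximating family `{|Q| < τ}`, `τ > 0`. -/
def RenormConverges (Q : Space d → ℝ) (t : ℝ) (x : Space d) : Prop :=
  ∃ l : ℂ, Tendsto (truncatedIntegral Q t x) atTop (𝓝 l)

/-- The attractor `H_{iQ}^t(x)`: `(2π)^{-d}` times the renormalized integral. -/
def attractorI (Q : Space d → ℝ) (t : ℝ) (x : Space d) : ℂ :=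
  (1 / (2 * (Real.pi : ℂ)) ^ d) * limUnder atTop (truncatedIntegral Q t x)

end

/-! ### Terms of the local limit theorem -/

section

variable {d : ℕ}

/-- `φ̂(ξ)^n e^{-i x·ξ}`. -/
def phase (φ : Lattice d → ℂ) (n : ℕ) (x : Lattice d) (ξ : Space d) : ℂ :=
  fourier φ ξ ^ n * Complex.exp (-Complex.I * ((inner ℝ (toSpace x) ξ : ℝ) : ℂ))

/-- `∑ φ̂(ξ)^n e^{-i x·ξ} H_{P_ξ}^n(x - n α_ξ)` over the points `ξ` of the finite set `s`. -/
def sumP (φ : Lattice d → ℂ) (D : Space d → Expansion d) (s : Set (Space d)) (n : ℕ)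
    (x : Lattice d) : ℂ :=
  ∑ᶠ ξ ∈ s, phase φ n x ξ *
    attractorP (D ξ).R (D ξ).Q n (toSpace x - (n : ℝ) • (D ξ).drift)

/-- `∑ φ̂(ξ)^n e^{-i x·ξ} H_{i Q_ξ}^n(x - n α)` over the points `ξ` of the finite set `s`. -/
def sumI (φ : Lattice d → ℂ) (D : Space d → Expansion d) (α : Space d) (s : Set (Space d))
    (n : ℕ) (x : Lattice d) : ℂ :=
  ∑ᶠ ξ ∈ s, phase φ n x ξ * attractorI (D ξ).Q n (toSpace x - (n : ℝ) • α)

/-- `f_n(x) = g_n(x) + o(n^{-μ})` as `n → ∞`, uniformly for `x ∈ X_n`. -/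
def EqUpToLittleO (f g : ℕ → Lattice d → ℂ) (μ : ℝ) (X : ℕ → Set (Lattice d)) : Prop :=
  ∀ ε : ℝ, 0 < ε → ∃ N : ℕ, ∀ n : ℕ, 1 ≤ n → N ≤ n → ∀ x ∈ X n,
    ‖f n x - g n x‖ ≤ ε * (n : ℝ) ^ (-μ)

/-- For every compact `K` there is an increasing sequence of compact sets `K_n ⊇ K` with union
`ℝ^d` such that `f_n(x) = g_n(x) + o(n^{-μ})` uniformly for `x ∈ (n α + K_n) ∩ ℤ^d`. -/
def EqOnGrowingCompacts (f g : ℕ → Lattice d → ℂ) (μ : ℝ) (α : Space d) : Prop :=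
  ∀ K : Set (Space d), IsCompact K → ∃ Ks : ℕ → Set (Space d),
    Monotone Ks ∧ (∀ n, IsCompact (Ks n)) ∧ (∀ n, K ⊆ Ks n) ∧ (⋃ n, Ks n) = Set.univ ∧
    EqUpToLittleO f g μ (fun n => {x | toSpace x ∈ (fun y => (n : ℝ) • α + y) '' Ks n})

end

end

end LLT

open LLT

/-! By Fourier inversion, `φ^{(n)}(x)` is `(2π)^{-d}` times the integral of `φ̂(ξ)^n e^{-i x·ξ}`
over a period cube. Both types of points are isolated in `{|φ̂| = 1}`, because `|φ̂| = e^{-(R +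
R̃)}` with `R̃ = o(R)` near them. Hence `Ω(φ)` is finite, and away from it `|φ̂| ≤ ρ < 1` makes the
integral geometrically small. What remains are integrals over small neighbourhoods of the points
`ξ₀`. There the drift is absorbed by replacing `x` with `x - n α`, and the `n`-th power becomes
`exp(-n (R + R̃) - i n (Q + Q̃))`.

At a point of positive type, substitute `ξ = n^{-E} η`. The Jacobian is `n^{-tr E}`, the main part
`n P(n^{-E} η) = P(η)` does not change, the remainders tend to `0`, and `e^{-R/2} + e^{-R}` is an
integrable majorant. Since `x` enters only through a factor of modulus one, dominated convergence is
uniform in all `x` (`local_limit_positive`).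

At a point of imaginary type this majorant is missing: `n R(n^{-E} η) = n^{1-k} R(η) → 0`, so on the
relevant scale the integrand has modulus close to one and cancellation has to do the work. Split
`{|Q| < δ}` at `|Q| = A / n`. On the inner part, of volume of order `(A / n)^μ`, the integrand is
uniformly close to `e^{-i n Q - i x·ξ}` (`head_estimate`). On the outer part, integrate along the
orbits `s ↦ s^E η` (`log_two_mul_integral_annulus`). Since `Q(s^E η) = s Q(η)`, the phase is linear
in `s` up to small terms, with derivative at least `n / 2`. The weight `s^{μ-1} e^{-n (R + R̃)}`
decreases, because `μ < 1` and `R + R̃` is nondecreasing along orbits. A van der Corput estimate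
(`norm_integral_exp_mul_le`) then gives a bound of order `(A / n)^{μ-1} / n = A^{μ-1} n^{-μ}`, which
is small compared with `n^{-μ}` once `A` is large (`tail_estimate`). Without remainders and damping,
the same estimate shows that the limit defining `H_{iQ}` exists (`renormConverges`).

The phase `x·ξ` is harmless only for bounded `x - n α`: for `μ < 1` the norm of `s^E` grows
sublinearly, so `n s` dominates `x·s^E η` when `x` stays in a ball. This gives uniformity on every
fixed ball around `n α`, and a diagonal choice of radii turns it into growing compact sets
(`eqOnGrowingCompacts_of_forall_radius`). Points with `μ_ξ > μ_φ` contribute `O(n^{-μ_ξ})`, which is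
absorbed in the error (`eqUpToLittleO_of_localApprox`). -/

namespace LLT
noncomputable section
variable {d : ℕ}

/-! ### The one-parameter group `t^E` and its determinant -/

theorem tpow_mul {s t : ℝ} (hs : 0 < s) (ht : 0 < t) (E : Space d →L[ℝ] Space d) :
    tpow (s * t) E = tpow s E * tpow t E := by
  unfold tpow
  rw [Real.log_mul hs.ne' ht.ne']
  refine (congrArg NormedSpace.exp (add_smul (Real.log s) (Real.log t) E)).trans ?_
  let : NormedAlgebra ℚ (Space d →L[ℝ] Space d) := NormedAlgebra.restrictScalars ℚ ℝ _
  exact NormedSpace.exp_add_of_commute (ContinuousLinearMap.ext fun ξ => by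
    change Real.log s • E (Real.log t • E ξ) = Real.log t • E (Real.log s • E ξ)
    rw [map_smul, map_smul, smul_comm])

@[simp] theorem tpow_one (E : Space d →L[ℝ] Space d) : tpow 1 E = 1 := by
  unfold tpow
  rw [Real.log_one]
  exact (congrArg NormedSpace.exp (zero_smul ℝ E)).trans NormedSpace.exp_zero

theorem tpow_mul_apply {s t : ℝ} (hs : 0 < s) (ht : 0 < t) (E : Space d →L[ℝ] Space d)
    (ξ : Space d) : tpow (s * t) E ξ = tpow s E (tpow t E ξ) := by
  rw [tpow_mul hs ht]; rfl

theorem tpow_inv_tpow {s : ℝ} (hs : 0 < s) (E : Space d →L[ℝ] Space d) (ξ : Space d) :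
    tpow s⁻¹ E (tpow s E ξ) = ξ := by
  rw [← tpow_mul_apply (inv_pos.2 hs) hs, inv_mul_cancel₀ hs.ne']; simp

theorem tpow_tpow_inv {s : ℝ} (hs : 0 < s) (E : Space d →L[ℝ] Space d) (ξ : Space d) :
    tpow s E (tpow s⁻¹ E ξ) = ξ := by
  rw [← tpow_mul_apply hs (inv_pos.2 hs), mul_inv_cancel₀ hs.ne']; simp

/-- This lets `R`, homogeneous for `E / k`, be followed along the orbits of `E`: they are the same
curves with time `u = s^k`. -/
theorem tpow_rpow {s k : ℝ} (hs : 0 < s) (hk : k ≠ 0) (E : Space d →L[ℝ] Space d) :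
    tpow (s ^ k) (k⁻¹ • E) = tpow s E := by
  unfold tpow
  rw [Real.log_rpow hs]
  refine congrArg NormedSpace.exp ((smul_smul _ _ E).trans ?_)
  rw [mul_right_comm, mul_inv_cancel₀ hk, one_mul]

theorem hasDerivAt_tpow {s : ℝ} (hs : 0 < s) (E : Space d →L[ℝ] Space d) :
    HasDerivAt (fun s => tpow s E) (s⁻¹ • (E * tpow s E)) s := by
  have h1 := (hasDerivAt_exp_smul_const' (𝕂 := ℝ) E (Real.log s))
  exact h1.scomp s (Real.hasDerivAt_log hs.ne')

theorem hasDerivAt_tpow_apply {s : ℝ} (hs : 0 < s) (E : Space d →L[ℝ] Space d) (ξ : Space d) :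
    HasDerivAt (fun s => tpow s E ξ) (s⁻¹ • (E (tpow s E ξ))) s := by
  have := (hasDerivAt_tpow hs E).clm_apply (hasDerivAt_const s ξ)
  simpa using this

theorem contDiffAt_tpow_apply {s : ℝ} (hs : 0 < s) (E : Space d →L[ℝ] Space d) (ξ : Space d)
    {n : ℕ∞} : ContDiffAt ℝ n (fun s => tpow s E ξ) s := by
  unfold tpow
  have h1 : ContDiffAt ℝ n (fun s : ℝ => Real.log s • E) s :=
    (Real.contDiffAt_log.2 hs.ne').smul contDiffAt_const
  have h2 : ContDiff ℝ n (NormedSpace.exp : (Space d →L[ℝ] Space d) → _) := by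
    exact contDiff_iff_contDiffAt.2 fun x => (NormedSpace.exp_analytic (𝕂 := ℝ) x).contDiffAt
  exact (h2.contDiffAt.comp s h1).clm_apply contDiffAt_const

theorem continuous_exp_smul (E : Space d →L[ℝ] Space d) :
    Continuous fun u : ℝ => NormedSpace.exp (u • E) := by
  let : NormedAlgebra ℚ (Space d →L[ℝ] Space d) := NormedAlgebra.restrictScalars ℚ ℝ _
  exact NormedSpace.exp_continuous.comp (continuous_id.smul continuous_const)

theorem measurable_tpow_apply (E : Space d →L[ℝ] Space d) :
    Measurable fun p : ℝ × Space d => tpow p.1 E p.2 := by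
  unfold tpow
  have : Continuous fun p : ℝ × Space d => NormedSpace.exp (p.1 • E) p.2 :=
    ((continuous_exp_smul E).comp continuous_fst).clm_apply continuous_snd
  exact this.measurable.comp ((Real.measurable_log.comp measurable_fst).prodMk measurable_snd)

theorem continuousAt_tpow {s : ℝ} (hs : 0 < s) (E : Space d →L[ℝ] Space d) :
    ContinuousAt (fun s => tpow s E) s := (hasDerivAt_tpow hs E).continuousAt

/-- The determinant of an endomorphism of `ℝ^d`, as a polynomial in its entries. -/
theorem det_eq_sum (A : Space d →L[ℝ] Space d) :
    A.det = ∑ σ : Equiv.Perm (Fin d), (Equiv.Perm.sign σ : ℤ) *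
      ∏ i, (A (EuclideanSpace.single i 1) (σ i) : ℝ) := by
  rw [ContinuousLinearMap.det, ← LinearMap.det_toMatrix (EuclideanSpace.basisFun (Fin d) ℝ).toBasis,
    Matrix.det_apply']
  simp [LinearMap.toMatrix_apply]

theorem differentiable_det : Differentiable ℝ fun A : Space d →L[ℝ] Space d => A.det := by
  simp_rw [det_eq_sum]
  refine Differentiable.fun_sum fun σ _ => (Differentiable.const_mul ?_ _)
  refine ContDiff.differentiable (n := 1) (contDiff_prod fun i _ => ?_) one_ne_zero
  have : ContDiff ℝ 1 fun A : Space d →L[ℝ] Space d => A (EuclideanSpace.single i 1) :=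
    contDiff_id.clm_apply contDiff_const
  exact (EuclideanSpace.proj (𝕜 := ℝ) (σ i)).contDiff.comp this

theorem hasDerivAt_det_one_add (A : Space d →L[ℝ] Space d) :
    HasDerivAt (fun h : ℝ => (1 + h • A : Space d →L[ℝ] Space d).det)
      (LinearMap.trace ℝ (Space d) A.toLinearMap) 0 := by
  set b := (EuclideanSpace.basisFun (Fin d) ℝ).toBasis
  have h1 : ∀ h : ℝ, (1 + h • A : Space d →L[ℝ] Space d).det =
      (1 + h • LinearMap.toMatrix b b A.toLinearMap).det := by
    intro h
    rw [ContinuousLinearMap.det, ← LinearMap.det_toMatrix b]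
    congr 1
    have : ((1 + h • A : Space d →L[ℝ] Space d) : Space d →ₗ[ℝ] Space d)
      = LinearMap.id + h • A.toLinearMap := rfl
    rw [this, map_add, map_smul, LinearMap.toMatrix_id]
  rw [LinearMap.trace_eq_matrix_trace ℝ b]
  set M := LinearMap.toMatrix b b A.toLinearMap
  -- `det (1 + h M)` is `1 + h tr M` plus `h^2` times a polynomial in `h`; `p` is that polynomial.
  set p := (1 + (Polynomial.X : Polynomial ℝ) • M.map ⇑Polynomial.C).det.divX.divX
  rw [show (fun h : ℝ => (1 + h • A : Space d →L[ℝ] Space d).det) =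
    fun h => 1 + M.trace * h + p.eval h * h ^ 2 from
      funext fun h => (h1 h).trans (Matrix.det_one_add_smul h M)]
  have h3 := ((hasDerivAt_id (0 : ℝ)).const_mul M.trace).const_add 1
  have h4 := (p.hasDerivAt (0 : ℝ)).mul ((hasDerivAt_id (0 : ℝ)).pow 2)
  exact HasDerivAt.congr_deriv (h3.add h4) (by simp)

/-- The curves `exp (u A)` and `1 + u A` have the same value and velocity at `u = 0`, so the
differentiable function `det` has the same derivative along both. -/
theorem hasDerivAt_det_exp_zero (A : Space d →L[ℝ] Space d) :
    HasDerivAt (fun u : ℝ => (NormedSpace.exp (u • A) : Space d →L[ℝ] Space d).det)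
      (LinearMap.trace ℝ (Space d) A.toLinearMap) 0 := by
  have h3 : ∀ B : Space d →L[ℝ] Space d, B = 1 →
      HasFDerivAt (fun A : Space d →L[ℝ] Space d => A.det)
        (fderiv ℝ (fun A : Space d →L[ℝ] Space d => A.det) 1) B := by
    rintro _ rfl
    exact (differentiable_det (d := d) 1).hasFDerivAt
  have h1 : HasDerivAt (fun h : ℝ => (1 + h • A : Space d →L[ℝ] Space d)) A 0 := by
    have := ((hasDerivAt_id (0 : ℝ)).smul_const A).const_add 1
    rwa [show (1 : ℝ) • A = A from one_smul ℝ A] at this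
  have e1 : (1 + (0 : ℝ) • A : Space d →L[ℝ] Space d) = 1 := by
    rw [show (0 : ℝ) • A = 0 from zero_smul ℝ A, add_zero]
  have e2 : NormedSpace.exp ((0 : ℝ) • A) = 1 :=
    (congrArg NormedSpace.exp (zero_smul ℝ A)).trans NormedSpace.exp_zero
  have h2 : HasDerivAt (fun u : ℝ => (NormedSpace.exp (u • A) : Space d →L[ℝ] Space d)) A 0 := by
    have := hasDerivAt_exp_smul_const (𝕂 := ℝ) A (0 : ℝ)
    rwa [e2, one_mul] at this
  have k1 := HasFDerivAt.comp_hasDerivAt (0 : ℝ) (h3 _ e1) h1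
  have k2 := HasFDerivAt.comp_hasDerivAt (0 : ℝ) (h3 _ e2) h2
  have := k1.unique (hasDerivAt_det_one_add A)
  exact this ▸ k2

/-- The function `g u = det (exp (u E))` is multiplicative with `g' 0 = tr E`, so it solves `g' =
(tr E) g` and `g u * e^{-u tr E}` is constant. -/
theorem det_tpow {s : ℝ} (hs : 0 < s) (E : Space d →L[ℝ] Space d) :
    (tpow s E).det = s ^ (LinearMap.trace ℝ (Space d) E.toLinearMap) := by
  set τ := LinearMap.trace ℝ (Space d) E.toLinearMap
  let g : ℝ → ℝ := fun u => (NormedSpace.exp (u • E) : Space d →L[ℝ] Space d).det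
  have hmul : ∀ u v, g (u + v) = g u * g v := by
    intro u v
    have h := tpow_mul (Real.exp_pos u) (Real.exp_pos v) E
    unfold tpow at h
    rw [← Real.exp_add, Real.log_exp, Real.log_exp, Real.log_exp] at h
    simp only [g, h]
    simp only [ContinuousLinearMap.det]
    exact LinearMap.det_comp _ _
  have hd0 : HasDerivAt g τ 0 := hasDerivAt_det_exp_zero E
  have hd : ∀ u, HasDerivAt g (g u * τ) u := by
    intro u
    have h1 : HasDerivAt (fun v => g u * g (v - u)) (g u * τ) u := by
      have : HasDerivAt g τ (u - u) := by simpa using hd0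
      simpa using (HasDerivAt.comp_sub_const u u this).const_mul (g u)
    refine h1.congr_of_eventuallyEq (Eventually.of_forall fun v => ?_)
    change g v = g u * g (v - u)
    rw [← hmul, add_sub_cancel]
  have hg0 : g 0 = 1 := by
    have := tpow_one E
    unfold tpow at this
    rw [Real.log_one] at this
    simp only [g, this]
    exact LinearMap.det_id
  have hk : ∀ u, HasDerivAt (fun u => g u * Real.exp (-(u * τ))) 0 u := by
    intro u
    have h1 : HasDerivAt (fun u : ℝ => Real.exp (-(u * τ))) (Real.exp (-(u * τ)) * (-(1 * τ))) u :=
      (((hasDerivAt_id u).mul_const τ).neg).exp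
    have h2 := (hd u).mul h1
    rwa [show g u * τ * Real.exp (-(u * τ)) + g u * (Real.exp (-(u * τ)) * -(1 * τ)) = 0 by ring]
      at h2
  have hconst := is_const_of_deriv_eq_zero (fun u => (hk u).differentiableAt)
    (fun u => (hk u).deriv) (Real.log s) 0
  simp only [zero_mul, neg_zero, Real.exp_zero, mul_one, hg0] at hconst
  rw [Real.rpow_def_of_pos hs]
  change g (Real.log s) = _
  rw [Real.exp_neg] at hconst
  field_simp at hconst
  exact hconst
end
end LLT

/-! ### A van der Corput estimate on the line -/

namespace LLT
noncomputable section

/-- A first-derivative van der Corput estimate with weight `t^(μ-1)`, `μ < 1`. -/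
theorem norm_integral_exp_mul_le {a b μ L κ : ℝ} {θ θ' θ'' w w' : ℝ → ℝ} (ha : 0 < a)
    (hab : a ≤ b) (hμ : μ < 1) (hL : 0 < L) (hκ : 0 ≤ κ)
    (hθ : ∀ t ∈ Set.Icc a b, HasDerivAt θ (θ' t) t)
    (hθ' : ∀ t ∈ Set.Icc a b, HasDerivAt θ' (θ'' t) t)
    (hw : ∀ t ∈ Set.Icc a b, HasDerivAt w (w' t) t)
    (hθL : ∀ t ∈ Set.Icc a b, L ≤ |θ' t|)
    (hθκ : ∀ t ∈ Set.Icc a b, |θ'' t| ≤ κ * L / t)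
    (hw0 : ∀ t ∈ Set.Icc a b, 0 ≤ w t) (hw1 : ∀ t ∈ Set.Icc a b, w t ≤ t ^ (μ - 1))
    (hw' : ∀ t ∈ Set.Icc a b, w' t ≤ 0) :
    ‖∫ t in a..b, Complex.exp (-Complex.I * θ t) * (w t : ℂ)‖
      ≤ (2 + κ / (1 - μ)) * a ^ (μ - 1) / L := by
  have hμ' : 0 < 1 - μ := by linarith
  have hpos : ∀ t ∈ Set.Icc a b, 0 < t := fun t ht => ha.trans_le ht.1
  have hne : ∀ t ∈ Set.Icc a b, θ' t ≠ 0 := fun t ht h0 => by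
    have := hθL t ht; rw [h0, abs_zero] at this; linarith
  have hexp : ∀ x : ℝ, ‖Complex.exp (-Complex.I * x)‖ = 1 := fun x => by
    rw [show -Complex.I * (x : ℂ) = ((-x : ℝ) : ℂ) * Complex.I by push_cast; ring]
    exact Complex.norm_exp_ofReal_mul_I _
  have hcont : ContinuousOn (fun t => Complex.exp (-Complex.I * θ t) * (w t : ℂ)) (Set.Icc a b) := by
    have h1 : ContinuousOn θ (Set.Icc a b) := fun t ht => (hθ t ht).continuousAt.continuousWithinAt
    have h2 : ContinuousOn w (Set.Icc a b) := fun t ht => (hw t ht).continuousAt.continuousWithinAt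
    fun_prop
  set F : ℝ → ℂ := fun t => ∫ s in a..t, Complex.exp (-Complex.I * θ s) * (w s : ℂ)
  set q : ℝ → ℝ := fun t => w t / θ' t
  set q' : ℝ → ℝ := fun t => (w' t * θ' t - w t * θ'' t) / θ' t ^ 2
  have hq : ∀ t ∈ Set.Icc a b, HasDerivAt q (q' t) t := fun t ht => (hw t ht).div (hθ' t ht) (hne t ht)
  have hqle : ∀ t ∈ Set.Icc a b, |q t| ≤ w t / L := fun t ht => by
    simp only [q, abs_div, abs_of_nonneg (hw0 t ht)]
    exact div_le_div_of_nonneg_left (hw0 t ht) hL (hθL t ht)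
  -- The boundary term of the integration by parts: `G'` is the integrand plus an error of modulus
  -- `|(w / θ')'|`.
  set G : ℝ → ℂ := fun t => Complex.exp (-Complex.I * θ t) * (Complex.I * (q t : ℂ))
  have hG : ∀ t ∈ Set.Icc a b, HasDerivAt G (Complex.exp (-Complex.I * θ t) * (w t : ℂ)
      + Complex.exp (-Complex.I * θ t) * (Complex.I * (q' t : ℂ))) t := fun t ht => by
    have h1 : HasDerivAt (fun t => Complex.exp (-Complex.I * θ t))
        (Complex.exp (-Complex.I * θ t) * (-Complex.I * (θ' t : ℂ))) t :=
      ((hθ t ht).ofReal_comp.const_mul (-Complex.I)).cexp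
    have h2 := ((hq t ht).ofReal_comp).const_mul Complex.I
    refine (h1.mul h2).congr_deriv ?_
    have h3 : ((q t : ℝ) : ℂ) * (θ' t : ℂ) = w t := by
      rw [← Complex.ofReal_mul]; simp only [q]; rw [div_mul_cancel₀ _ (hne t ht)]
    rw [← h3]
    linear_combination (-Complex.exp (-Complex.I * θ t) * θ' t * q t) * Complex.I_mul_I
  -- A majorant of `‖F - G‖`: it equals `w a / L` at `a`, and its derivative `-w' / L + κ t^{μ-2} /
  -- L` dominates `|(w / θ')'|`. Comparing derivatives avoids integrating `(w / θ')'`, for which no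
  -- integrability is assumed.
  set B : ℝ → ℝ := fun t => (2 * w a - w t) / L + κ / ((1 - μ) * L) * (a ^ (μ - 1) - t ^ (μ - 1))
  set B' : ℝ → ℝ := fun t => (-w' t) / L + κ / ((1 - μ) * L) * (-((μ - 1) * t ^ (μ - 1 - 1)))
  have hB : ∀ t ∈ Set.Icc a b, HasDerivAt B (B' t) t := fun t ht => by
    have h1 := (((hw t ht).const_sub (2 * w a)).div_const L)
    have h2 := ((Real.hasDerivAt_rpow_const (p := μ - 1) (Or.inl (hpos t ht).ne')).const_sub
      (a ^ (μ - 1))).const_mul (κ / ((1 - μ) * L))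
    exact h1.add h2
  have hmain : ∀ ⦃t⦄, t ∈ Set.Icc a b → ‖F t - G t‖ ≤ B t := by
    refine image_norm_le_of_norm_deriv_right_le_deriv_boundary'
      (f' := fun t => -(Complex.exp (-Complex.I * θ t) * (Complex.I * (q' t : ℂ)))) (B' := B') ?_ ?_ ?_ ?_ ?_ ?_
    · have h1 : ContinuousOn F (Set.Icc a b) :=
        intervalIntegral.continuousOn_primitive_interval'
          (hcont.intervalIntegrable_of_Icc hab) (by simp [hab]) |>.mono (by rw [Set.uIcc_of_le hab])
      exact h1.sub fun t ht => (hG t ht).continuousAt.continuousWithinAt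
    · intro t ht
      have ht' : t ∈ Set.Icc a b := Set.Ico_subset_Icc_self ht
      have hi : IntervalIntegrable (fun t => Complex.exp (-Complex.I * θ t) * (w t : ℂ)) volume a t :=
        (hcont.mono (Set.Icc_subset_Icc_right ht'.2)).intervalIntegrable_of_Icc ht'.1
      have hF : HasDerivWithinAt F (Complex.exp (-Complex.I * θ t) * (w t : ℂ)) (Set.Ici t) t := by
        have hc : ContinuousWithinAt (fun t => Complex.exp (-Complex.I * θ t) * (w t : ℂ)) (Set.Ici t) t := by
          have h1 := (hθ t ht').continuousAt
          have h2 := (hw t ht').continuousAt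
          have : ContinuousAt (fun t => Complex.exp (-Complex.I * θ t) * (w t : ℂ)) t := by fun_prop
          exact this.continuousWithinAt
        refine intervalIntegral.integral_hasDerivWithinAt_right hi ?_ (hc.mono Set.Ioi_subset_Ici_self)
        refine ⟨Set.Icc a b ∩ Set.Ioi t, ?_, ?_⟩
        · have : Set.Ioo t b ⊆ Set.Icc a b ∩ Set.Ioi t := fun s hs =>
            ⟨⟨ht'.1.trans hs.1.le, hs.2.le⟩, hs.1⟩
          exact mem_of_superset (Ioo_mem_nhdsGT ht.2) this
        · exact (hcont.mono Set.inter_subset_left).aestronglyMeasurable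
            (measurableSet_Icc.inter measurableSet_Ioi)
      refine (hF.sub (hG t ht').hasDerivWithinAt).congr_deriv ?_
      ring
    · have h1 : F a = 0 := intervalIntegral.integral_same
      have ha' : a ∈ Set.Icc a b := ⟨le_rfl, hab⟩
      rw [h1, zero_sub, norm_neg]
      simp only [G, B, norm_mul, hexp, Complex.norm_I, one_mul, Complex.norm_real, Real.norm_eq_abs]
      refine (hqle a ha').trans (le_of_eq ?_)
      ring
    · exact fun t ht => (hB t ht).continuousAt.continuousWithinAt
    · exact fun t ht => (hB t (Set.Ico_subset_Icc_self ht)).hasDerivWithinAt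
    · intro t ht
      have ht' : t ∈ Set.Icc a b := Set.Ico_subset_Icc_self ht
      have htp := hpos t ht'
      simp only [norm_neg, norm_mul, hexp, Complex.norm_I, one_mul, Complex.norm_real,
        Real.norm_eq_abs, q', B', abs_div, abs_pow]
      have hθp : 0 < |θ' t| := hL.trans_le (hθL t ht')
      have e1 : |w' t * θ' t - w t * θ'' t| / |θ' t| ^ 2 ≤
          (-w' t) / |θ' t| + w t * |θ'' t| / |θ' t| ^ 2 := by
        calc |w' t * θ' t - w t * θ'' t| / |θ' t| ^ 2
            ≤ (|w' t * θ' t| + |w t * θ'' t|) / |θ' t| ^ 2 := by gcongr; exact abs_sub _ _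
          _ = _ := by
            rw [abs_mul, abs_mul, abs_of_nonpos (hw' t ht'), abs_of_nonneg (hw0 t ht')]
            field_simp
      have e2 : (-w' t) / |θ' t| ≤ (-w' t) / L :=
        div_le_div_of_nonneg_left (by linarith [hw' t ht']) hL (hθL t ht')
      have e3 : w t * |θ'' t| / |θ' t| ^ 2 ≤ t ^ (μ - 1) * (κ * L / t) / L ^ 2 := by
        gcongr
        · exact hw1 t ht'
        · exact hθκ t ht'
        · exact hθL t ht'
      have e4 : t ^ (μ - 1) * (κ * L / t) / L ^ 2
          = κ / ((1 - μ) * L) * (-((μ - 1) * t ^ (μ - 1 - 1))) := by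
        rw [Real.rpow_sub_one htp.ne' (μ - 1)]
        field_simp
        ring
      linarith
  have hb : b ∈ Set.Icc a b := ⟨hab, le_rfl⟩
  have h1 := hmain hb
  have h2 : ‖G b‖ ≤ w b / L := by
    simp only [G, norm_mul, hexp, Complex.norm_I, one_mul, Complex.norm_real, Real.norm_eq_abs]
    exact hqle b hb
  have h3 : ‖F b‖ ≤ B b + w b / L := by
    calc ‖F b‖ = ‖(F b - G b) + G b‖ := by ring_nf
      _ ≤ _ := (norm_add_le _ _).trans (add_le_add h1 h2)
  refine h3.trans ?_
  have h4 : w a ≤ a ^ (μ - 1) := hw1 a ⟨le_rfl, hab⟩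
  have h5 : 0 ≤ κ / ((1 - μ) * L) * b ^ (μ - 1) :=
    mul_nonneg (by positivity) (Real.rpow_nonneg (ha.le.trans hab) _)
  have h6 : B b + w b / L = 2 * w a / L + κ / ((1 - μ) * L) * a ^ (μ - 1)
      - κ / ((1 - μ) * L) * b ^ (μ - 1) := by simp only [B]; ring
  have h7 : (2 + κ / (1 - μ)) * a ^ (μ - 1) / L = 2 * a ^ (μ - 1) / L
    + κ / ((1 - μ) * L) * a ^ (μ - 1) := by field_simp
  rw [h6, h7]
  have h8 : 2 * w a / L ≤ 2 * a ^ (μ - 1) / L := by gcongr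
  linarith
end
end LLT

/-! ### Sublevel sets of homogeneous functions, their volumes, and growth of `t^E` -/

namespace LLT
noncomputable section
variable {d : ℕ}

/-- `tr E`. -/
abbrev tr (E : Space d →L[ℝ] Space d) : ℝ := LinearMap.trace ℝ (Space d) E.toLinearMap

theorem exists_bound_tpow {E : Space d →L[ℝ] Space d} (hc : IsContracting E) (M : ℝ) :
    ∃ C : ℝ, 0 < C ∧ ∀ s, 0 < s → s ≤ M → ‖tpow s E‖ ≤ C := by
  have h1 : ∀ᶠ t in 𝓝[>] (0 : ℝ), ‖tpow t E‖ < 1 := hc.eventually_lt_const one_pos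
  obtain ⟨τ, hτ, h2⟩ := mem_nhdsGT_iff_exists_Ioo_subset.1 h1
  have hτ0 : (0 : ℝ) < τ := hτ
  have h3 : ContinuousOn (fun s => tpow s E) (Set.Icc (τ / 2) M) := fun s hs =>
    (continuousAt_tpow ((half_pos hτ0).trans_le hs.1) E).continuousWithinAt
  obtain ⟨C, hC⟩ := isCompact_Icc.exists_bound_of_continuousOn h3
  refine ⟨max C 1, by positivity, fun s hs hsM => ?_⟩
  rcases lt_or_ge s τ with h | h
  · exact (le_of_lt (h2 ⟨hs, h⟩)).trans (le_max_right _ _)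
  · exact (hC s ⟨by linarith, hsM⟩).trans (le_max_left _ _)

theorem exists_tpow_lt {E : Space d →L[ℝ] Space d} (hc : IsContracting E) {ε : ℝ} (hε : 0 < ε) :
    ∃ τ : ℝ, 0 < τ ∧ ∀ s, 0 < s → s < τ → ‖tpow s E‖ < ε := by
  obtain ⟨τ, hτ, h2⟩ := mem_nhdsGT_iff_exists_Ioo_subset.1 (hc.eventually_lt_const hε)
  exact ⟨τ, hτ, fun s hs hs' => h2 ⟨hs, hs'⟩⟩

/-- The endomorphism with the adjugate matrix. -/
def adjL (B : Space d →L[ℝ] Space d) : Space d →L[ℝ] Space d :=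
  LinearMap.toContinuousLinearMap
    (Matrix.toLin (EuclideanSpace.basisFun (Fin d) ℝ).toBasis
      (EuclideanSpace.basisFun (Fin d) ℝ).toBasis
      (LinearMap.toMatrix (EuclideanSpace.basisFun (Fin d) ℝ).toBasis
        (EuclideanSpace.basisFun (Fin d) ℝ).toBasis B.toLinearMap).adjugate)

theorem continuous_adjL : Continuous (adjL (d := d)) := by
  let b := (EuclideanSpace.basisFun (Fin d) ℝ).toBasis
  have h1 : Continuous fun B : Space d →L[ℝ] Space d => LinearMap.toMatrix b b B.toLinearMap := by
    refine continuous_pi fun i => continuous_pi fun j => ?_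
    have : Continuous fun B : Space d →L[ℝ] Space d => B (EuclideanSpace.single j 1) :=
      continuous_id.clm_apply continuous_const
    exact (EuclideanSpace.proj (𝕜 := ℝ) i).continuous.comp this
  have h2 : Continuous fun N : Matrix (Fin d) (Fin d) ℝ =>
      LinearMap.toContinuousLinearMap (Matrix.toLin b b N) := by
    exact (((Matrix.toLin b b).trans LinearMap.toContinuousLinearMap).toLinearMap).continuous_of_finiteDimensional
  exact h2.comp h1.matrix_adjugate

theorem adjL_apply_apply (B : Space d →L[ℝ] Space d) (ξ : Space d) :
    adjL B (B ξ) = B.det • ξ := by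
  set b := (EuclideanSpace.basisFun (Fin d) ℝ).toBasis
  have h : Matrix.toLin b b (LinearMap.toMatrix b b B.toLinearMap) = B.toLinearMap :=
    Matrix.toLin_toMatrix b b _
  have h2 : B ξ = Matrix.toLin b b (LinearMap.toMatrix b b B.toLinearMap) ξ := by rw [h]; rfl
  change Matrix.toLin b b (LinearMap.toMatrix b b B.toLinearMap).adjugate (B ξ) = _
  rw [h2, ← Matrix.toLin_mul_apply, Matrix.adjugate_mul, map_smul, Matrix.toLin_one,
    ContinuousLinearMap.det, LinearMap.det_toMatrix]
  rfl

/-- By Cramer's rule the inverse of `B = (1/s)^E` is `adj B / det B`. For `s ≥ 1` contraction keeps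
`B`, hence `adj B`, bounded, and `1 / det B = s^{tr E}`. No spectral information on `E` is required.
-/
theorem exists_bound_tpow_ge_one {E : Space d →L[ℝ] Space d} (hc : IsContracting E) :
    ∃ C : ℝ, 0 < C ∧ ∀ s, 1 ≤ s → ‖tpow s E‖ ≤ C * s ^ tr E := by
  obtain ⟨C₀, hC₀, h0⟩ := exists_bound_tpow hc 1
  have hfin : ProperSpace (Space d →L[ℝ] Space d) := FiniteDimensional.proper ℝ _
  obtain ⟨C, hC⟩ := (isCompact_closedBall (0 : Space d →L[ℝ] Space d) C₀).exists_bound_of_continuousOn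
    (continuous_adjL (d := d)).continuousOn
  refine ⟨max C 1, by positivity, fun s hs => ?_⟩
  have hs0 : 0 < s := one_pos.trans_le hs
  have h1 := hC (tpow s⁻¹ E) (by
    rw [mem_closedBall_zero_iff]
    exact h0 _ (inv_pos.2 hs0) (inv_le_one_of_one_le₀ hs))
  refine ContinuousLinearMap.opNorm_le_bound _ (by positivity) fun ξ => ?_
  have h2 := adjL_apply_apply (tpow s⁻¹ E) (tpow s E ξ)
  rw [tpow_inv_tpow hs0, det_tpow (inv_pos.2 hs0), Real.inv_rpow hs0.le] at h2
  have hp : 0 < s ^ tr E := Real.rpow_pos_of_pos hs0 _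
  have h3 : tpow s E ξ = s ^ tr E • adjL (tpow s⁻¹ E) ξ := by
    rw [h2, smul_smul, mul_inv_cancel₀ hp.ne', one_smul]
  rw [h3, norm_smul, Real.norm_of_nonneg hp.le]
  calc s ^ tr E * ‖adjL (tpow s⁻¹ E) ξ‖ ≤ s ^ tr E * (max C 1 * ‖ξ‖) := by
        gcongr
        exact ((adjL (tpow s⁻¹ E)).le_opNorm ξ).trans
          (mul_le_mul_of_nonneg_right (h1.trans (le_max_left _ _)) (norm_nonneg _))
    _ = _ := by ring

/-- `t^E` as a continuous linear equivalence. -/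
def tpowEquiv (E : Space d →L[ℝ] Space d) {s : ℝ} (hs : 0 < s) : Space d ≃L[ℝ] Space d :=
  ContinuousLinearEquiv.equivOfInverse (tpow s E) (tpow s⁻¹ E) (tpow_inv_tpow hs E)
    (tpow_tpow_inv hs E)

theorem map_tpow_volume (E : Space d →L[ℝ] Space d) {s : ℝ} (hs : 0 < s) :
    Measure.map (tpow s E) volume = ENNReal.ofReal (s ^ (-tr E)) • (volume : Measure (Space d)) := by
  have hdet : LinearMap.det (tpow s E).toLinearMap = s ^ tr E := det_tpow hs E
  have hp : 0 < s ^ tr E := Real.rpow_pos_of_pos hs _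
  have := Measure.map_linearMap_addHaar_eq_smul_addHaar (μ := (volume : Measure (Space d)))
    (f := (tpow s E).toLinearMap) (by rw [hdet]; exact hp.ne')
  rw [hdet, abs_of_pos (inv_pos.2 hp), ← Real.rpow_neg hs.le] at this
  exact this

theorem measurableEmbedding_tpow (E : Space d →L[ℝ] Space d) {s : ℝ} (hs : 0 < s) :
    MeasurableEmbedding (tpow s E) :=
  (tpowEquiv E hs).toHomeomorph.measurableEmbedding

theorem integral_comp_tpow {F : Type*} [NormedAddCommGroup F] [NormedSpace ℝ F]
    (E : Space d →L[ℝ] Space d) {s : ℝ} (hs : 0 < s) (f : Space d → F) :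
    ∫ ξ, f (tpow s E ξ) = s ^ (-tr E) • ∫ ξ, f ξ := by
  rw [← (measurableEmbedding_tpow E hs).integral_map, map_tpow_volume E hs, integral_smul_measure,
    ENNReal.toReal_ofReal (Real.rpow_nonneg hs.le _)]

theorem integral_eq_integral_comp_tpow {F : Type*} [NormedAddCommGroup F] [NormedSpace ℝ F]
    (E : Space d →L[ℝ] Space d) {s : ℝ} (hs : 0 < s) (f : Space d → F) :
    ∫ ξ, f ξ = s ^ tr E • ∫ ξ, f (tpow s E ξ) := by
  rw [integral_comp_tpow E hs, smul_smul, ← Real.rpow_add hs, add_neg_cancel, Real.rpow_zero, one_smul]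

section Gauge
variable {P : Space d → ℝ} {E : Space d →L[ℝ] Space d}

theorem exponentSet_apply_zero (hE : E ∈ exponentSet P) : P 0 = 0 := by
  have := hE 2 two_pos 0
  rw [map_zero] at this
  linarith

theorem IsPositiveHomogeneous.pos (hP : IsPositiveHomogeneous P) {ξ : Space d} (h : ξ ≠ 0) :
    0 < P ξ := lt_of_le_of_ne (hP.nonneg ξ) fun h0 => h (hP.eq_zero ξ h0.symm)

theorem IsPositiveHomogeneous.apply_zero (hP : IsPositiveHomogeneous P) : P 0 = 0 :=
  exponentSet_apply_zero hP.exponentSet_nonempty.some_mem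

/-- Polar decomposition: `P` itself is the time parameter along orbits started on the level set `{P
= 1}`. -/
theorem exists_eq_tpow (hE : E ∈ exponentSet P) {ξ : Space d} (h : 0 < P ξ) :
    ∃ η, P η = 1 ∧ ξ = tpow (P ξ) E η :=
  ⟨tpow (P ξ)⁻¹ E ξ, by rw [hE _ (inv_pos.2 h), inv_mul_cancel₀ h.ne'],
    (tpow_tpow_inv h E ξ).symm⟩

theorem IsPositiveHomogeneous.exists_norm_le (hP : IsPositiveHomogeneous P) :
    ∃ C : ℝ, 0 < C ∧ ∀ ξ, P ξ = 1 → ‖ξ‖ ≤ C := by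
  obtain ⟨C, hC⟩ := hP.isCompact_level.isBounded.exists_norm_le
  exact ⟨max C 1, by positivity, fun ξ h => (hC ξ h).trans (le_max_left _ _)⟩

theorem IsPositiveHomogeneous.isCompact_le (hP : IsPositiveHomogeneous P) (hE : E ∈ exponentSet P)
    (hc : IsContracting E) (M : ℝ) : IsCompact {ξ | P ξ ≤ M} := by
  obtain ⟨C, hC, h1⟩ := hP.exists_norm_le
  obtain ⟨C', hC', h2⟩ := exists_bound_tpow hc M
  refine Metric.isCompact_of_isClosed_isBounded (isClosed_le hP.continuous continuous_const) ?_
  refine (Metric.isBounded_closedBall (x := (0 : Space d)) (r := C' * C)).subset fun ξ hξ => ?_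
  rw [mem_closedBall_zero_iff]
  by_cases h0 : ξ = 0
  · rw [h0, norm_zero]; positivity
  obtain ⟨η, hη, e⟩ := exists_eq_tpow hE (hP.pos h0)
  rw [e]
  exact ((tpow (P ξ) E).le_opNorm η).trans (mul_le_mul (h2 _ (hP.pos h0) hξ) (h1 η hη)
    (norm_nonneg _) hC'.le)

/-- With `lt_mem_nhds` this makes the sublevel sets a neighbourhood basis at `0`, so every local
integral can be taken over a sublevel set. -/
theorem IsPositiveHomogeneous.exists_lt_subset (hP : IsPositiveHomogeneous P)
    (hE : E ∈ exponentSet P) (hc : IsContracting E) {U : Set (Space d)} (hU : U ∈ 𝓝 0) :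
    ∃ δ : ℝ, 0 < δ ∧ {ξ | P ξ < δ} ⊆ U := by
  obtain ⟨ε, hε, hU⟩ := Metric.mem_nhds_iff.1 hU
  obtain ⟨C, hC, h1⟩ := hP.exists_norm_le
  obtain ⟨τ, hτ, h2⟩ := exists_tpow_lt hc (div_pos hε hC)
  refine ⟨τ, hτ, fun ξ hξ => hU ?_⟩
  rw [mem_ball_zero_iff]
  by_cases h0 : ξ = 0
  · rw [h0, norm_zero]; exact hε
  obtain ⟨η, hη, e⟩ := exists_eq_tpow hE (hP.pos h0)
  rw [e]
  calc ‖tpow (P ξ) E η‖ ≤ ‖tpow (P ξ) E‖ * ‖η‖ := (tpow (P ξ) E).le_opNorm η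
    _ ≤ ‖tpow (P ξ) E‖ * C := by gcongr; exact h1 η hη
    _ < ε / C * C := by gcongr; exact h2 _ (hP.pos h0) hξ
    _ = ε := div_mul_cancel₀ _ hC.ne'

theorem IsPositiveHomogeneous.isOpen_lt (hP : IsPositiveHomogeneous P) (δ : ℝ) :
    IsOpen {ξ | P ξ < δ} := _root_.isOpen_lt hP.continuous continuous_const

theorem IsPositiveHomogeneous.lt_mem_nhds (hP : IsPositiveHomogeneous P) {δ : ℝ} (hδ : 0 < δ) :
    {ξ | P ξ < δ} ∈ 𝓝 (0 : Space d) :=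
  (hP.isOpen_lt δ).mem_nhds (by rw [Set.mem_ofPred_eq, hP.apply_zero]; exact hδ)

theorem volume_lt_eq (hE : E ∈ exponentSet P) {t : ℝ} (ht : 0 < t) :
    volume {ξ | P ξ < t} = ENNReal.ofReal (t ^ tr E) * volume {ξ | P ξ < 1} := by
  have h := congrArg (fun m : Measure (Space d) => m {ξ | P ξ < 1}) (map_tpow_volume E (inv_pos.2 ht))
  simp only [(measurableEmbedding_tpow E (inv_pos.2 ht)).map_apply, Measure.smul_apply,
    smul_eq_mul] at h
  rw [Real.inv_rpow ht.le, Real.rpow_neg ht.le, inv_inv] at h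
  rw [← h]
  congr 1
  ext ξ
  simp only [Set.mem_ofPred_eq, Set.mem_preimage, hE _ (inv_pos.2 ht)]
  rw [inv_mul_lt_iff₀ ht, mul_one]

theorem IsPositiveHomogeneous.volume_lt_lt_top (hP : IsPositiveHomogeneous P)
    (hE : E ∈ exponentSet P) (hc : IsContracting E) (M : ℝ) :
    volume {ξ | P ξ < M} < ⊤ :=
  (measure_mono (fun ξ (h : P ξ < M) => (le_of_lt h : P ξ ≤ M))).trans_lt (hP.isCompact_le hE hc M).measure_lt_top

theorem IsPositiveHomogeneous.volume_lt_pos (hP : IsPositiveHomogeneous P) {M : ℝ} (hM : 0 < M) :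
    0 < volume {ξ : Space d | P ξ < M} :=
  Measure.measure_pos_of_mem_nhds volume (hP.lt_mem_nhds hM)

theorem IsPositiveHomogeneous.measureReal_lt (hE : E ∈ exponentSet P) {t : ℝ} (ht : 0 < t) :
    volume.real {ξ | P ξ < t} = t ^ tr E * volume.real {ξ | P ξ < 1} := by
  rw [measureReal_def, volume_lt_eq hE ht, ENNReal.toReal_mul,
    ENNReal.toReal_ofReal (Real.rpow_nonneg ht.le _), measureReal_def]

/-- The volume ratio of `{P < 2}` and `{P < 1}` is `2^{tr E}` for every exponent `E`, which
determines the trace. Contraction of one exponent makes the volumes finite. -/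
theorem IsPositiveHomogeneous.homOrder_eq (hP : IsPositiveHomogeneous P)
    (hE : E ∈ exponentSet P) (hc : IsContracting E) : homOrder P = tr E := by
  unfold homOrder
  rw [dif_pos hP.exponentSet_nonempty]
  set E' := hP.exponentSet_nonempty.some
  have hE' : E' ∈ exponentSet P := hP.exponentSet_nonempty.some_mem
  have h1 := IsPositiveHomogeneous.measureReal_lt hE two_pos
  have h2 := IsPositiveHomogeneous.measureReal_lt hE' two_pos
  have hV : 0 < volume.real {ξ | P ξ < 1} :=
    ENNReal.toReal_pos (hP.volume_lt_pos one_pos).ne' (hP.volume_lt_lt_top hE hc 1).ne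
  have h3 := mul_right_cancel₀ hV.ne' (h2.symm.trans h1)
  have h4 := congrArg Real.log h3
  rw [Real.log_rpow two_pos, Real.log_rpow two_pos] at h4
  exact mul_right_cancel₀ (Real.log_pos one_lt_two).ne' h4

/-- On `{n ≤ P < n + 1}` the function is at most `e^{-c n}`, while the volume of `{P < n + 1}` grows
only like a power of `n + 1`. -/
theorem IsPositiveHomogeneous.integrable_exp_neg (hP : IsPositiveHomogeneous P)
    (hE : E ∈ exponentSet P) (hc : IsContracting E) {c : ℝ} (hcp : 0 < c) :
    Integrable fun ξ => Real.exp (-(c * P ξ)) := by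
  have hcont : Continuous fun ξ => Real.exp (-(c * P ξ)) := by
    have := hP.continuous
    fun_prop
  refine ⟨hcont.aestronglyMeasurable, ?_⟩
  have hpt : ∀ ξ, ‖Real.exp (-(c * P ξ))‖ₑ ≤ ∑' n : ℕ, ENNReal.ofReal (Real.exp (-(c * n))) *
      Set.indicator {ξ | P ξ < n + 1} 1 ξ := by
    intro ξ
    refine le_trans ?_ (ENNReal.le_tsum ⌊P ξ⌋₊)
    have hm : ξ ∈ {η : Space d | P η < (⌊P ξ⌋₊ : ℝ) + 1} := Nat.lt_floor_add_one (P ξ)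
    rw [Set.indicator_of_mem hm,
      Pi.one_apply, mul_one, Real.enorm_of_nonneg (Real.exp_pos _).le]
    gcongr
    exact Nat.floor_le (hP.nonneg ξ)
  refine (lintegral_mono hpt).trans_lt ?_
  have hmeas : ∀ n : ℕ, MeasurableSet {ξ | P ξ < n + 1} := fun n => (hP.isOpen_lt _).measurableSet
  rw [lintegral_tsum fun n => (((measurable_one.indicator (hmeas n))).const_mul _).aemeasurable]
  have hterm : ∀ n : ℕ, ∫⁻ ξ, ENNReal.ofReal (Real.exp (-(c * n))) *
      Set.indicator {ξ | P ξ < n + 1} 1 ξ =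
      ENNReal.ofReal (Real.exp (-(c * n)) * ((n : ℝ) + 1) ^ tr E) * volume {ξ | P ξ < 1} := by
    intro n
    rw [lintegral_const_mul _ (measurable_one.indicator (hmeas n)), lintegral_indicator_one (hmeas n),
      volume_lt_eq hE (by positivity), ENNReal.ofReal_mul (Real.exp_pos _).le, mul_assoc]
  simp_rw [hterm]
  rw [ENNReal.tsum_mul_right]
  refine ENNReal.mul_lt_top ?_ (hP.volume_lt_lt_top hE hc 1)
  have hsum : Summable fun n : ℕ => Real.exp (-(c * n)) * ((n : ℝ) + 1) ^ tr E := by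
    obtain ⟨m, hm⟩ := exists_nat_ge (tr E)
    have h1 := ((summable_nat_add_iff 1).2 (Real.summable_pow_mul_exp_neg_nat_mul m hcp)).mul_left
      (Real.exp c)
    refine h1.of_nonneg_of_le (fun n => by positivity) fun n => ?_
    have h2 : ((n : ℝ) + 1) ^ tr E ≤ ((n : ℝ) + 1) ^ m := by
      rw [← Real.rpow_natCast]
      exact Real.rpow_le_rpow_of_exponent_le (by linarith [(Nat.cast_nonneg n : (0 : ℝ) ≤ n)]) hm
    have h3 : Real.exp (-(c * n)) = Real.exp c * Real.exp (-c * ((n + 1 : ℕ) : ℝ)) := by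
      rw [← Real.exp_add]; push_cast; ring_nf
    rw [h3]
    calc _ ≤ Real.exp c * Real.exp (-c * ((n + 1 : ℕ) : ℝ)) * ((n : ℝ) + 1) ^ m := by gcongr
      _ = _ := by push_cast; ring
  rw [← ENNReal.ofReal_tsum_of_nonneg (fun n => by positivity) hsum]
  exact ENNReal.ofReal_lt_top
end Gauge
end
end LLT

/-! ### Generalized polar coordinates -/

namespace LLT
noncomputable section
variable {d : ℕ}

theorem integrable_of_le_indicator {α : Type*} [MeasurableSpace α] {m : Measure α} {f : α → ℂ}
    {T : Set α} {C : ℝ} (hf : Measurable f) (hT : MeasurableSet T) (hm : m T < ⊤)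
    (h : ∀ x ∈ T, ‖f x‖ ≤ C) (h0 : ∀ x, x ∉ T → f x = 0) : Integrable f m := by
  have h1 : Integrable (T.indicator fun _ => C) m :=
    (integrable_indicator_iff hT).2 (integrableOn_const hm.ne)
  refine h1.mono' hf.aestronglyMeasurable (Eventually.of_forall fun x => ?_)
  by_cases hx : x ∈ T
  · rw [Set.indicator_of_mem hx]; exact h x hx
  · rw [h0 x hx, Set.indicator_of_notMem hx, norm_zero]

variable {N : Space d → ℝ} {E : Space d →L[ℝ] Space d}

/-- Integration in generalized polar coordinates over an annulus, with the shell
`{1 ≤ N < 2}` in the role of the unit sphere. -/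
theorem log_two_mul_integral_annulus (hN : IsPositiveHomogeneous N) (hE : E ∈ exponentSet N)
    (hc : IsContracting E) {a b : ℝ} (ha : 0 < a) (hab : a ≤ b) {F : Space d → ℂ}
    (hF : Measurable F) (hF1 : ∀ ξ, a ≤ N ξ → N ξ < b → ‖F ξ‖ ≤ 1) :
    (Real.log 2 : ℂ) * ∫ ξ in {ξ | a ≤ N ξ ∧ N ξ < b}, F ξ
      = ∫ η in {η | 1 ≤ N η ∧ N η < 2},
          ∫ s in (a / N η)..(b / N η), F (tpow s E η) * ((s ^ (tr E - 1) : ℝ) : ℂ) := by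
  set A : Set (Space d) := {ξ | a ≤ N ξ ∧ N ξ < b}
  set S : Set (Space d) := {η | 1 ≤ N η ∧ N η < 2}
  set J : Set ℝ := Set.Icc (a / 2) b
  have hNm : Measurable N := hN.continuous.measurable
  have hA : MeasurableSet A := (measurableSet_le measurable_const hNm).inter
    (measurableSet_lt hNm measurable_const)
  have hS : MeasurableSet S := (measurableSet_le measurable_const hNm).inter
    (measurableSet_lt hNm measurable_const)
  set G : Space d → ℂ := A.indicator F
  have hG : Measurable G := hF.indicator hA
  have hG1 : ∀ ξ, ‖G ξ‖ ≤ 1 := fun ξ => by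
    by_cases h : ξ ∈ A
    · simp only [G, Set.indicator_of_mem h]; exact hF1 ξ h.1 h.2
    · simp [G, Set.indicator_of_notMem h]
  set S1 : Space d → ℝ := S.indicator 1
  have hS1 : Measurable S1 := measurable_one.indicator hS
  have hS1b : ∀ η, ‖S1 η‖ ≤ 1 := fun η => by
    by_cases h : η ∈ S
    · simp [S1, Set.indicator_of_mem h]
    · simp [S1, Set.indicator_of_notMem h]
  -- The measure `ds / s`, cut down to `J = [a / 2, b]`, which contains every time at which an orbit
  -- started in the shell can be in the annulus.
  set J1 : ℝ → ℝ := J.indicator fun s => s⁻¹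
  have hJ1 : Measurable J1 := measurable_inv.indicator measurableSet_Icc
  have hJpos : ∀ s ∈ J, 0 < s := fun s hs => (half_pos ha).trans_le hs.1
  -- Integrating `k1` over `s` returns `log 2` times the integrand; `k2` is `k1` after `ξ = s^E η`,
  -- with the Jacobian `s^{tr E}`. Fubini on both sides of this substitution proves the formula
  -- without a surface measure on a level set.
  let k1 : ℝ → Space d → ℂ := fun s ξ => ((J1 s * S1 (tpow s⁻¹ E ξ) : ℝ) : ℂ) * G ξ
  let k2 : ℝ → Space d → ℂ := fun s η => ((s ^ tr E : ℝ) : ℂ) * k1 s (tpow s E η)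
  have hmt := measurable_tpow_apply E
  have hmt' : Measurable fun p : ℝ × Space d => tpow p.1⁻¹ E p.2 :=
    hmt.comp (measurable_fst.inv.prodMk measurable_snd)
  have hk1m : Measurable (Function.uncurry k1) :=
    (Complex.measurable_ofReal.comp ((hJ1.comp measurable_fst).mul (hS1.comp hmt'))).mul
      (hG.comp measurable_snd)
  have hk2m : Measurable (Function.uncurry k2) :=
    (Complex.measurable_ofReal.comp (measurable_fst.pow_const _)).mul
      (hk1m.comp (measurable_fst.prodMk hmt))
  have hJfin : volume J < ⊤ := measure_Icc_lt_top
  have hk1i : Integrable (Function.uncurry k1) (volume.prod volume) := by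
    refine integrable_of_le_indicator (T := J ×ˢ {ξ | N ξ < b}) (C := 2 / a) hk1m
      (measurableSet_Icc.prod (hN.isOpen_lt b).measurableSet) ?_ ?_ ?_
    · rw [Measure.prod_prod]
      exact ENNReal.mul_lt_top hJfin (hN.volume_lt_lt_top hE hc b)
    · rintro ⟨s, ξ⟩ ⟨hs, -⟩
      have hs0 := hJpos s hs
      simp only [Function.uncurry, k1, norm_mul, Complex.norm_real]
      have : ‖J1 s‖ ≤ 2 / a := by
        simp only [J1, Set.indicator_of_mem hs, norm_inv, Real.norm_of_nonneg hs0.le]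
        rw [← inv_div]
        exact inv_anti₀ (half_pos ha) hs.1
      calc ‖J1 s‖ * ‖S1 (tpow s⁻¹ E ξ)‖ * ‖G ξ‖ ≤ (2 / a) * 1 * 1 := by
            gcongr
            · exact hS1b _
            · exact hG1 _
        _ = _ := by ring
    · rintro ⟨s, ξ⟩ h
      simp only [Function.uncurry, k1]
      by_cases hs : s ∈ J
      · have : ξ ∉ A := fun hA => h ⟨hs, hA.2⟩
        simp [G, Set.indicator_of_notMem this]
      · simp [J1, Set.indicator_of_notMem hs]
  have hk2v : ∀ s ∈ J, ∀ η, k2 s η = (S1 η : ℂ) * (G (tpow s E η) * ((s ^ (tr E - 1) : ℝ) : ℂ)) := by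
    intro s hs η
    have hs0 := hJpos s hs
    simp only [k2, k1, tpow_inv_tpow hs0, J1, Set.indicator_of_mem hs]
    rw [Real.rpow_sub_one hs0.ne']
    push_cast
    field_simp
  have hk2z : ∀ s, s ∉ J → ∀ η, k2 s η = 0 := by
    intro s hs η
    simp [k2, k1, J1, Set.indicator_of_notMem hs]
  have hk2i : Integrable (Function.uncurry k2) (volume.prod volume) := by
    obtain ⟨C, hC⟩ := (isCompact_Icc (a := a / 2) (b := b)).exists_bound_of_continuousOn
      (f := fun s : ℝ => s ^ (tr E - 1))
      (fun s hs => (Real.continuousAt_rpow_const _ _ (Or.inl (hJpos s hs).ne')).continuousWithinAt)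
    refine integrable_of_le_indicator (T := J ×ˢ {ξ | N ξ < 2}) (C := C) hk2m
      (measurableSet_Icc.prod (hN.isOpen_lt 2).measurableSet) ?_ ?_ ?_
    · rw [Measure.prod_prod]
      exact ENNReal.mul_lt_top hJfin (hN.volume_lt_lt_top hE hc 2)
    · rintro ⟨s, η⟩ ⟨hs, -⟩
      simp only [Function.uncurry]
      rw [hk2v s hs, norm_mul, norm_mul, Complex.norm_real, Complex.norm_real]
      calc ‖S1 η‖ * (‖G (tpow s E η)‖ * ‖s ^ (tr E - 1)‖) ≤ 1 * (1 * C) := by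
            gcongr
            · exact hS1b _
            · exact hG1 _
            · exact hC s hs
        _ = _ := by ring
    · rintro ⟨s, η⟩ h
      simp only [Function.uncurry]
      by_cases hs : s ∈ J
      · have : η ∉ S := fun hS => h ⟨hs, hS.2⟩
        rw [hk2v s hs]
        simp [S1, Set.indicator_of_notMem this]
      · exact hk2z s hs η
  -- the weight integrates to `log 2` along every orbit
  have hweight : ∀ ξ, ∫ s, k1 s ξ = (Real.log 2 : ℂ) * G ξ := by
    intro ξ
    simp only [k1]
    rw [integral_mul_const, integral_complex_ofReal]
    by_cases h : ξ ∈ A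
    · have hN0 : 0 < N ξ := ha.trans_le h.1
      congr 2
      -- Since `N(s^{-E} ξ) = N ξ / s`, the shell condition means `N ξ / 2 < s ≤ N ξ`, an interval
      -- of `ds / s`-length `log 2` contained in `J`.
      have : (fun s => J1 s * S1 (tpow s⁻¹ E ξ)) = (Set.Ioc (N ξ / 2) (N ξ)).indicator fun s => s⁻¹ := by
        funext s
        by_cases hs : s ∈ Set.Ioc (N ξ / 2) (N ξ)
        · have hs0 : 0 < s := (half_pos hN0).trans hs.1
          have hsJ : s ∈ J := ⟨by linarith [h.1, hs.1], by linarith [h.2, hs.2]⟩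
          have hsS : tpow s⁻¹ E ξ ∈ S := by
            refine ⟨?_, ?_⟩ <;> rw [hE _ (inv_pos.2 hs0)]
            · rw [le_inv_mul_iff₀ hs0]; linarith [hs.2]
            · rw [inv_mul_lt_iff₀ hs0]; linarith [hs.1]
          simp only [J1, S1]
          rw [Set.indicator_of_mem hsJ, Set.indicator_of_mem hsS, Set.indicator_of_mem hs, Pi.one_apply,
            mul_one]
        · rw [Set.indicator_of_notMem hs]
          by_cases hsJ : s ∈ J
          · have hs0 := hJpos s hsJ
            have hsS : tpow s⁻¹ E ξ ∉ S := by
              rintro ⟨h1, h2⟩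
              rw [hE _ (inv_pos.2 hs0)] at h1 h2
              rw [le_inv_mul_iff₀ hs0] at h1
              rw [inv_mul_lt_iff₀ hs0] at h2
              exact hs ⟨by linarith, by linarith⟩
            simp only [S1]
            rw [Set.indicator_of_notMem hsS, mul_zero]
          · simp only [J1]
            rw [Set.indicator_of_notMem hsJ, zero_mul]
      rw [this, integral_indicator measurableSet_Ioc, ← intervalIntegral.integral_of_le (by linarith),
        integral_inv_of_pos (half_pos hN0) hN0]
      congr 1
      field_simp
    · simp [G, Set.indicator_of_notMem h]
  have hinner : ∀ η, ∫ s, k2 s η = S.indicator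
      (fun η => ∫ s in (a / N η)..(b / N η), F (tpow s E η) * ((s ^ (tr E - 1) : ℝ) : ℂ)) η := by
    intro η
    by_cases h : η ∈ S
    · have hN0 : 0 < N η := one_pos.trans_le h.1
      rw [Set.indicator_of_mem h, intervalIntegral.integral_of_le (by gcongr),
        ← integral_Ico_eq_integral_Ioc, ← integral_indicator measurableSet_Ico]
      congr 1
      funext s
      by_cases hs : s ∈ Set.Ico (a / N η) (b / N η)
      · have h1 := (div_le_iff₀ hN0).1 hs.1
        have h2 := (lt_div_iff₀ hN0).1 hs.2
        have hs0 : 0 < s := (div_pos ha hN0).trans_le hs.1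
        have hsJ : s ∈ J := by
          constructor
          · nlinarith [h.2]
          · nlinarith [h.1]
        have hsA : tpow s E η ∈ A := by
          refine ⟨?_, ?_⟩ <;> rw [hE _ hs0] <;> assumption
        rw [hk2v s hsJ, Set.indicator_of_mem hs]
        simp only [S1, G]
        rw [Set.indicator_of_mem h, Set.indicator_of_mem hsA]
        simp
      · rw [Set.indicator_of_notMem hs]
        by_cases hsJ : s ∈ J
        · have hs0 := hJpos s hsJ
          have hsA : tpow s E η ∉ A := by
            rintro ⟨h1, h2⟩
            rw [hE _ hs0] at h1 h2
            exact hs ⟨(div_le_iff₀ hN0).2 h1, (lt_div_iff₀ hN0).2 h2⟩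
          rw [hk2v s hsJ]
          simp only [G]
          rw [Set.indicator_of_notMem hsA]
          simp
        · exact hk2z s hsJ η
    · rw [Set.indicator_of_notMem h]
      have : ∀ s, k2 s η = 0 := fun s => by
        by_cases hsJ : s ∈ J
        · rw [hk2v s hsJ]
          simp [S1, Set.indicator_of_notMem h]
        · exact hk2z s hsJ η
      simp [this]
  calc (Real.log 2 : ℂ) * ∫ ξ in A, F ξ = ∫ ξ, ∫ s, k1 s ξ := by
        simp_rw [hweight]
        rw [integral_const_mul, integral_indicator hA]
    _ = ∫ s, ∫ ξ, k1 s ξ := (integral_integral_swap hk1i).symm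
    _ = ∫ s, ∫ η, k2 s η := by
        congr 1
        funext s
        by_cases hs : s ∈ J
        · rw [integral_eq_integral_comp_tpow E (hJpos s hs), ← integral_smul]
          rfl
        · have h1 : ∀ ξ, k1 s ξ = 0 := fun ξ => by simp [k1, J1, Set.indicator_of_notMem hs]
          simp [h1, hk2z s hs]
    _ = ∫ η, ∫ s, k2 s η := integral_integral_swap hk2i
    _ = _ := by
        simp_rw [hinner]
        rw [integral_indicator hS]

theorem norm_integral_annulus_le (hN : IsPositiveHomogeneous N) (hE : E ∈ exponentSet N)
    (hc : IsContracting E) {a b M : ℝ} (ha : 0 < a) (hab : a ≤ b) {F : Space d → ℂ}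
    (hF : Measurable F) (hF1 : ∀ ξ, a ≤ N ξ → N ξ < b → ‖F ξ‖ ≤ 1)
    (hM : ∀ η, 1 ≤ N η → N η < 2 →
      ‖∫ s in (a / N η)..(b / N η), F (tpow s E η) * ((s ^ (tr E - 1) : ℝ) : ℂ)‖ ≤ M) :
    ‖∫ ξ in {ξ | a ≤ N ξ ∧ N ξ < b}, F ξ‖ ≤ M * volume.real {ξ | 1 ≤ N ξ ∧ N ξ < 2} / Real.log 2 := by
  have h := log_two_mul_integral_annulus hN hE hc ha hab hF hF1
  have hl : 0 < Real.log 2 := Real.log_pos one_lt_two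
  have h1 : ‖(Real.log 2 : ℂ) * ∫ ξ in {ξ | a ≤ N ξ ∧ N ξ < b}, F ξ‖
      ≤ M * volume.real {ξ | 1 ≤ N ξ ∧ N ξ < 2} := by
    rw [h]
    refine norm_setIntegral_le_of_norm_le_const ?_ fun η hη => hM η hη.1 hη.2
    exact (measure_mono fun η (h : 1 ≤ N η ∧ N η < 2) => h.2).trans_lt (hN.volume_lt_lt_top hE hc 2)
  rw [norm_mul, Complex.norm_real, Real.norm_of_nonneg hl.le] at h1
  rw [le_div_iff₀ hl]
  linarith
end
end LLT

/-! ### Cancellation along orbits -/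

namespace LLT
noncomputable section
variable {d : ℕ} {Q : Space d → ℝ} {E : Space d →L[ℝ] Space d}

/-- Along an orbit the sign of `Q` is constant, so homogeneity of `|Q|` gives that of `Q`. -/
theorem mem_exponentSet_of_abs (hQ : Continuous Q) (hN : IsPositiveHomogeneous fun ξ => |Q ξ|)
    (hE : E ∈ exponentSet fun ξ => |Q ξ|) : E ∈ exponentSet Q := by
  intro t ht ξ
  by_cases h0 : ξ = 0
  · have h1 := hN.apply_zero
    simp only [abs_eq_zero] at h1
    rw [h0, map_zero, h1, mul_zero]
  have hab : ∀ s : ℝ, 0 < s → |Q (tpow s E ξ)| = s * |Q ξ| := fun s hs => hE s hs ξ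
  have hp : 0 < |Q ξ| := hN.pos h0
  have hc : ContinuousOn (fun s => Q (tpow s E ξ)) (Set.Ioi 0) := fun s hs =>
    (hQ.continuousAt.comp (hasDerivAt_tpow_apply hs E ξ).continuousAt).continuousWithinAt
  have hne : ∀ s ∈ Set.Ioi (0 : ℝ), Q (tpow s E ξ) ≠ 0 := fun s hs h => by
    have := hab s hs
    rw [h, abs_zero] at this
    exact (mul_pos hs hp).ne this
  have h1 : Q (tpow 1 E ξ) = Q ξ := by rw [tpow_one]; rfl
  rcases lt_or_gt_of_ne (abs_pos.1 hp) with hneg | hpos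
  · have : Q (tpow t E ξ) < 0 := by
      by_contra hcon
      have hcon' : 0 ≤ Q (tpow t E ξ) := not_lt.1 hcon
      obtain ⟨s, hs, hs0⟩ := isPreconnected_Ioi.intermediate_value
        (Set.mem_Ioi.2 (one_pos (α := ℝ))) (show t ∈ Set.Ioi (0 : ℝ) from ht) hc
        (show (0 : ℝ) ∈ Set.Icc (Q (tpow 1 E ξ)) (Q (tpow t E ξ)) from
          ⟨by rw [h1]; exact hneg.le, hcon'⟩)
      exact hne s hs hs0
    have h2 := hab t ht
    rw [abs_of_neg this, abs_of_neg hneg] at h2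
    linarith
  · have : 0 < Q (tpow t E ξ) := by
      by_contra hcon
      have hcon' : Q (tpow t E ξ) ≤ 0 := not_lt.1 hcon
      obtain ⟨s, hs, hs0⟩ := isPreconnected_Ioi.intermediate_value
        (show t ∈ Set.Ioi (0 : ℝ) from ht) (Set.mem_Ioi.2 (one_pos (α := ℝ))) hc
        (show (0 : ℝ) ∈ Set.Icc (Q (tpow t E ξ)) (Q (tpow 1 E ξ)) from
          ⟨hcon', by rw [h1]; exact hpos.le⟩)
      exact hne s hs hs0
    have h2 := hab t ht
    rwa [abs_of_pos this, abs_of_pos hpos] at h2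

theorem hasDerivAt_inner_tpow (x η : Space d) {s : ℝ} (hs : 0 < s) :
    HasDerivAt (fun s => inner ℝ x (tpow s E η)) (s⁻¹ * inner ℝ x (E (tpow s E η))) s := by
  have h1 := ((innerSL ℝ x).hasFDerivAt (x := tpow s E η)).comp_hasDerivAt s (hasDerivAt_tpow_apply hs E η)
  refine h1.congr_deriv ?_
  rw [map_smul, innerSL_apply_apply, smul_eq_mul]

theorem hasDerivAt_inner_tpow_deriv (x η : Space d) {s : ℝ} (hs : 0 < s) :
    HasDerivAt (fun s => s⁻¹ * inner ℝ x (E (tpow s E η)))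
      (-(s ^ 2)⁻¹ * inner ℝ x (E (tpow s E η)) + s⁻¹ * (s⁻¹ * inner ℝ x (E (E (tpow s E η))))) s := by
  have h1 := E.hasFDerivAt.comp_hasDerivAt s (hasDerivAt_tpow_apply hs E η)
  have h2 := ((innerSL ℝ x).hasFDerivAt (x := E (tpow s E η))).comp_hasDerivAt s h1
  have h3 : HasDerivAt (fun s => inner ℝ x (E (tpow s E η)))
      (s⁻¹ * inner ℝ x (E (E (tpow s E η)))) s := by
    refine h2.congr_deriv ?_
    rw [map_smul, map_smul, innerSL_apply_apply, smul_eq_mul]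
  exact (hasDerivAt_inv hs.ne').mul h3

/-- The derivatives of `s^E` are `s^{-1} E s^E` and `s^{-2} (E^2 - E) s^E`; the factor `‖E‖ + ‖E‖^2`
in the hypothesis handles both at once. -/
theorem abs_inner_tpow_deriv_le {x η : Space d} {s n D : ℝ} (hs : 0 < s) (hη : ‖η‖ ≤ D)
    (h : ‖x‖ * (‖E‖ + ‖E‖ ^ 2) * D * ‖tpow s E‖ ≤ n * s / 4) :
    |s⁻¹ * inner ℝ x (E (tpow s E η))| ≤ n / 4 ∧
    |-(s ^ 2)⁻¹ * inner ℝ x (E (tpow s E η)) + s⁻¹ * (s⁻¹ * inner ℝ x (E (E (tpow s E η))))|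
      ≤ n / 4 / s := by
  have hD : 0 ≤ D := (norm_nonneg η).trans hη
  have e0 : ‖tpow s E η‖ ≤ ‖tpow s E‖ * D :=
    ((tpow s E).le_opNorm η).trans (by gcongr)
  have e1 : ‖E (tpow s E η)‖ ≤ ‖E‖ * (‖tpow s E‖ * D) := (E.le_opNorm _).trans (by gcongr)
  have e2 : ‖E (E (tpow s E η))‖ ≤ ‖E‖ * (‖E‖ * (‖tpow s E‖ * D)) :=
    (E.le_opNorm _).trans (by gcongr)
  have i1 : |inner ℝ x (E (tpow s E η))| ≤ ‖x‖ * (‖E‖ * (‖tpow s E‖ * D)) :=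
    (abs_real_inner_le_norm _ _).trans (by gcongr)
  have i2 : |inner ℝ x (E (E (tpow s E η)))| ≤ ‖x‖ * (‖E‖ * (‖E‖ * (‖tpow s E‖ * D))) :=
    (abs_real_inner_le_norm _ _).trans (by gcongr)
  have i3 : |inner ℝ x (E (tpow s E η))| + |inner ℝ x (E (E (tpow s E η)))| ≤ n * s / 4 := by
    refine (add_le_add i1 i2).trans (le_trans (le_of_eq ?_) h)
    ring
  constructor
  · rw [abs_mul, abs_of_pos (inv_pos.2 hs), inv_mul_le_iff₀ hs]
    linarith [abs_nonneg (inner ℝ x (E (E (tpow s E η))))]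
  · calc _ ≤ (s ^ 2)⁻¹ * (|inner ℝ x (E (tpow s E η))| + |inner ℝ x (E (E (tpow s E η)))|) := by
          rw [← mul_assoc, ← mul_inv, ← sq, neg_mul]
          refine (abs_add_le _ _).trans ?_
          rw [abs_neg, abs_mul, abs_mul, abs_of_pos (inv_pos.2 (pow_pos hs 2)), mul_add]
      _ ≤ (s ^ 2)⁻¹ * (n * s / 4) := by gcongr
      _ = _ := by field_simp

/-- Oscillation along the orbits of `t^E` makes integrals over annuli small. -/
theorem exists_annulus_bound (hQ : Continuous Q) (hN : IsPositiveHomogeneous fun ξ => |Q ξ|)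
    (hE : E ∈ exponentSet fun ξ => |Q ξ|) (hc : IsContracting E) (hμ : tr E < 1) :
    ∃ C : ℝ, 0 < C ∧ ∀ (a b n D : ℝ) (x : Space d) (f g : Space d → ℝ) (f1 f2 g1 : Space d → ℝ → ℝ)
      (F : Space d → ℂ), 0 < a → a ≤ b → 0 < n → Measurable F →
      (∀ η, 1 ≤ |Q η| → |Q η| < 2 → ‖η‖ ≤ D) →
      (∀ s ∈ Set.Icc (a / 2) b, ‖x‖ * (‖E‖ + ‖E‖ ^ 2) * D * ‖tpow s E‖ ≤ n * s / 4) →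
      (∀ η, 1 ≤ |Q η| → |Q η| < 2 → ∀ s ∈ Set.Icc (a / 2) b,
        HasDerivAt (fun s => f (tpow s E η)) (f1 η s) s ∧ HasDerivAt (f1 η) (f2 η s) s ∧
        HasDerivAt (fun s => g (tpow s E η)) (g1 η s) s ∧ |f1 η s| ≤ 1 / 4 ∧ |f2 η s| ≤ 1 / s ∧
        0 ≤ g1 η s ∧ 0 ≤ g (tpow s E η)) →
      (∀ ξ, a ≤ |Q ξ| → |Q ξ| ≤ b → F ξ = Complex.exp (-Complex.I *
        ((n * (Q ξ + f ξ) + inner ℝ x ξ : ℝ) : ℂ)) * (Real.exp (-(n * g ξ)) : ℂ)) →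
      ‖∫ ξ in {ξ | a ≤ |Q ξ| ∧ |Q ξ| < b}, F ξ‖ ≤ C * a ^ (tr E - 1) / n := by
  have hEQ := mem_exponentSet_of_abs hQ hN hE
  have hl : 0 < Real.log 2 := Real.log_pos one_lt_two
  have hμ' : 0 < 1 - tr E := by linarith
  -- The constant depends on `Q` and `E` only. The first factor is the van der Corput constant for
  -- `κ = 3`, the factor `2` comes from `L = n / 2`, the power of `2` from the lower limit `a / |Q
  -- η| ≥ a / 2`, and the `+ 1` only ensures positivity.
  refine ⟨(2 + 3 / (1 - tr E)) * 2 * 2 ^ (1 - tr E) *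
    (volume.real {ξ | 1 ≤ |Q ξ| ∧ |Q ξ| < 2} + 1) / Real.log 2, by positivity, ?_⟩
  intro a b n D x f g f1 f2 g1 F ha hab hn hF hD hx hfg hFe
  have hFe' : ∀ η, 1 ≤ |Q η| → |Q η| < 2 → ∀ s ∈ Set.Icc (a / |Q η|) (b / |Q η|),
      s ∈ Set.Icc (a / 2) b ∧ 0 < s ∧ a ≤ |Q (tpow s E η)| ∧ |Q (tpow s E η)| ≤ b := by
    intro η h1 h2 s hs
    have h0 : 0 < |Q η| := one_pos.trans_le h1
    have hs0 : 0 < s := (div_pos ha h0).trans_le hs.1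
    have e1 := (div_le_iff₀ h0).1 hs.1
    have e2 := (le_div_iff₀ h0).1 hs.2
    have e3 : |Q (tpow s E η)| = s * |Q η| := hE s hs0 η
    refine ⟨⟨by nlinarith, by nlinarith⟩, hs0, by rwa [e3], by rwa [e3]⟩
  -- The sign of `g` is known along orbits only; each `ξ` of the annulus is reached from `{|Q| = 1}`
  -- at time `|Q ξ|`.
  have hgn : ∀ ξ, a ≤ |Q ξ| → |Q ξ| < b → 0 ≤ g ξ := by
    intro ξ h1 h2
    have h0 : 0 < |Q ξ| := ha.trans_le h1
    obtain ⟨η, hη, e⟩ := exists_eq_tpow hE h0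
    have hη' : |Q η| = 1 := hη
    have := (hfg η hη'.ge (by rw [hη']; exact one_lt_two) (|Q ξ|) ⟨by linarith, h2.le⟩).2.2.2.2.2.2
    rwa [← e] at this
  have hexp : ∀ x : ℝ, ‖Complex.exp (-Complex.I * x)‖ = 1 := fun x => by
    rw [show -Complex.I * (x : ℂ) = ((-x : ℝ) : ℂ) * Complex.I by push_cast; ring]
    exact Complex.norm_exp_ofReal_mul_I _
  have hF1 : ∀ ξ, a ≤ |Q ξ| → |Q ξ| < b → ‖F ξ‖ ≤ 1 := by
    intro ξ h1 h2
    rw [hFe ξ h1 h2.le, norm_mul, hexp, one_mul, Complex.norm_real,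
      Real.norm_of_nonneg (Real.exp_pos _).le]
    exact Real.exp_le_one_iff.2 (by have := mul_nonneg hn.le (hgn ξ h1 h2); linarith)
  have hbound := norm_integral_annulus_le hN hE hc ha hab (F := F)
    (M := (2 + 3 / (1 - tr E)) * (2 ^ (1 - tr E) * a ^ (tr E - 1)) / (n / 2)) hF hF1 ?_
  · refine hbound.trans ?_
    have hv : volume.real {ξ | 1 ≤ |Q ξ| ∧ |Q ξ| < 2} ≤ volume.real {ξ | 1 ≤ |Q ξ| ∧ |Q ξ| < 2} + 1 := by
      linarith
    have hap : 0 ≤ a ^ (tr E - 1) := Real.rpow_nonneg ha.le _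
    calc _ ≤ (2 + 3 / (1 - tr E)) * (2 ^ (1 - tr E) * a ^ (tr E - 1)) / (n / 2) *
          (volume.real {ξ | 1 ≤ |Q ξ| ∧ |Q ξ| < 2} + 1) / Real.log 2 := by gcongr
      _ = _ := by field_simp
  intro η h1 h2
  have h0 : 0 < |Q η| := one_pos.trans_le h1
  have hmem := hFe' η h1 h2
  set θ : ℝ → ℝ := fun s => n * (Q η * s + f (tpow s E η)) + inner ℝ x (tpow s E η)
  set w : ℝ → ℝ := fun s => Real.exp (-(n * g (tpow s E η))) * s ^ (tr E - 1)
  have hint : ∫ s in (a / |Q η|)..(b / |Q η|), F (tpow s E η) * ((s ^ (tr E - 1) : ℝ) : ℂ)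
      = ∫ s in (a / |Q η|)..(b / |Q η|), Complex.exp (-Complex.I * θ s) * (w s : ℂ) := by
    refine intervalIntegral.integral_congr fun s hs => ?_
    rw [Set.uIcc_of_le (by gcongr)] at hs
    obtain ⟨-, m2, m3, m4⟩ := hmem s hs
    simp only [θ, w]
    rw [hFe _ m3 m4, hEQ s m2, mul_comm s]
    push_cast
    ring
  rw [hint]
  have hlow : (a / |Q η|) ^ (tr E - 1) ≤ 2 ^ (1 - tr E) * a ^ (tr E - 1) := by
    have : a / 2 ≤ a / |Q η| := div_le_div_of_nonneg_left ha.le h0 h2.le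
    calc (a / |Q η|) ^ (tr E - 1) ≤ (a / 2) ^ (tr E - 1) :=
          Real.rpow_le_rpow_of_nonpos (by positivity) this (by linarith)
      _ = _ := by
        rw [Real.div_rpow ha.le two_pos.le, show tr E - 1 = -(1 - tr E) by ring,
          Real.rpow_neg two_pos.le, div_inv_eq_mul, mul_comm]
  refine (norm_integral_exp_mul_le (L := n / 2) (κ := 3) (μ := tr E)
    (θ' := fun s => n * (Q η * 1 + f1 η s) + s⁻¹ * inner ℝ x (E (tpow s E η)))
    (θ'' := fun s => n * f2 η s + (-(s ^ 2)⁻¹ * inner ℝ x (E (tpow s E η))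
      + s⁻¹ * (s⁻¹ * inner ℝ x (E (E (tpow s E η))))))
    (w' := fun s => Real.exp (-(n * g (tpow s E η))) * (-(n * g1 η s)) * s ^ (tr E - 1)
      + Real.exp (-(n * g (tpow s E η))) * ((tr E - 1) * s ^ (tr E - 1 - 1)))
    (div_pos ha h0) (by gcongr) hμ (by positivity) (by norm_num) ?_ ?_ ?_ ?_ ?_ ?_ ?_ ?_).trans ?_
  · intro s hs
    obtain ⟨m1, m2, -, -⟩ := hmem s hs
    obtain ⟨d1, -⟩ := hfg η h1 h2 s m1
    exact ((((hasDerivAt_id s).const_mul (Q η)).add d1).const_mul n).add (hasDerivAt_inner_tpow x η m2)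
  · intro s hs
    obtain ⟨m1, m2, -, -⟩ := hmem s hs
    obtain ⟨-, d2, -⟩ := hfg η h1 h2 s m1
    exact ((d2.const_add (Q η * 1)).const_mul n).add (hasDerivAt_inner_tpow_deriv x η m2)
  · intro s hs
    obtain ⟨m1, m2, -, -⟩ := hmem s hs
    obtain ⟨-, -, d3, -⟩ := hfg η h1 h2 s m1
    exact ((d3.const_mul n).neg.exp).mul (Real.hasDerivAt_rpow_const (Or.inl m2.ne'))
  · intro s hs
    obtain ⟨m1, m2, -, -⟩ := hmem s hs
    obtain ⟨-, -, -, d4, -⟩ := hfg η h1 h2 s m1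
    obtain ⟨b1, -⟩ := abs_inner_tpow_deriv_le (x := x) (η := η) (E := E) m2 (hD η h1 h2) (hx s m1)
    set v := s⁻¹ * inner ℝ x (E (tpow s E η))
    -- Of the slope `n |Q η| ≥ n`, the remainder and the linear phase each take away at most `n /
    -- 4`, which leaves `L = n / 2`.
    have e1 : |n * Q η| ≤ |n * (Q η * 1 + f1 η s) + v| + (|n * f1 η s| + |v|) := by
      calc |n * Q η| = |(n * (Q η * 1 + f1 η s) + v) - (n * f1 η s + v)| := by congr 1; ring
        _ ≤ |n * (Q η * 1 + f1 η s) + v| + |n * f1 η s + v| := abs_sub _ _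
        _ ≤ _ := by gcongr; exact abs_add_le _ _
    rw [abs_mul, abs_mul, abs_of_pos hn] at e1
    have e2 : n * 1 ≤ n * |Q η| := by gcongr
    have e3 : n * |f1 η s| ≤ n * (1 / 4) := by gcongr
    linarith
  · intro s hs
    obtain ⟨m1, m2, -, -⟩ := hmem s hs
    obtain ⟨-, -, -, -, d5, -⟩ := hfg η h1 h2 s m1
    obtain ⟨-, b2⟩ := abs_inner_tpow_deriv_le (x := x) (η := η) (E := E) m2 (hD η h1 h2) (hx s m1)
    refine (abs_add_le _ _).trans ((add_le_add (b := n * (1 / s)) ?_ b2).trans ?_)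
    · rw [abs_mul, abs_of_pos hn]; gcongr
    · rw [show n * (1 / s) + n / 4 / s = (5 / 4 * n) / s by ring]
      exact div_le_div_of_nonneg_right (by linarith) m2.le
  · intro s hs
    obtain ⟨m1, m2, -, -⟩ := hmem s hs
    positivity
  · intro s hs
    obtain ⟨m1, m2, -, -⟩ := hmem s hs
    obtain ⟨-, -, -, -, -, -, d7⟩ := hfg η h1 h2 s m1
    have : Real.exp (-(n * g (tpow s E η))) ≤ 1 :=
      Real.exp_le_one_iff.2 (by have := mul_nonneg hn.le d7; linarith)
    calc w s ≤ 1 * s ^ (tr E - 1) := by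
          exact mul_le_mul_of_nonneg_right this (Real.rpow_nonneg m2.le _)
      _ = _ := one_mul _
  · intro s hs
    obtain ⟨m1, m2, -, -⟩ := hmem s hs
    obtain ⟨-, -, -, -, -, d6, -⟩ := hfg η h1 h2 s m1
    -- Both terms of `w'` are nonpositive, one because the damping `g` does not decrease along the
    -- orbit, the other because `tr E < 1`.
    have p1 : 0 ≤ Real.exp (-(n * g (tpow s E η))) * (n * g1 η s) * s ^ (tr E - 1) := by positivity
    have p2 : 0 ≤ Real.exp (-(n * g (tpow s E η))) * ((1 - tr E) * s ^ (tr E - 1 - 1)) := by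
      positivity
    linarith
  · gcongr
end
end LLT

/-! ### Existence and truncation of the imaginary attractor -/

namespace LLT
noncomputable section
variable {d : ℕ} {Q : Space d → ℝ} {E : Space d →L[ℝ] Space d}

/-- The bound `C s^{tr E}` is sublinear for `tr E < 1`. Hence the linear phase `x·s^E η` loses
eventually against `Q(s^E η) = s Q(η)`. -/
theorem exists_tpow_le_mul (hc : IsContracting E) (hμ : tr E < 1) {κ : ℝ} (hκ : 0 < κ) :
    ∃ s₀ : ℝ, 0 < s₀ ∧ ∀ s, s₀ ≤ s → ‖tpow s E‖ ≤ κ * s := by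
  obtain ⟨C, hC, h1⟩ := exists_bound_tpow_ge_one hc
  have h2 : Tendsto (fun s : ℝ => C * s ^ (-(1 - tr E))) atTop (𝓝 (C * 0)) :=
    (tendsto_rpow_neg_atTop (by linarith)).const_mul C
  rw [mul_zero] at h2
  obtain ⟨s₀, h3⟩ := eventually_atTop.1 (h2.eventually_lt_const hκ)
  refine ⟨max s₀ 1, by positivity, fun s hs => ?_⟩
  have hs1 : 1 ≤ s := (le_max_right _ _).trans hs
  have hs0 : 0 < s := one_pos.trans_le hs1
  refine (h1 s hs1).trans ?_
  have h4 := (h3 s ((le_max_left _ _).trans hs)).le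
  rw [show -(1 - tr E) = tr E - 1 by ring, Real.rpow_sub_one hs0.ne', ← mul_div_assoc,
    div_le_iff₀ hs0] at h4
  exact h4

theorem exists_tpow_le_one_add (hc : IsContracting E) (hμ : tr E < 1) :
    ∃ C : ℝ, 0 < C ∧ ∀ s, 0 < s → ‖tpow s E‖ ≤ C * (1 + s) := by
  obtain ⟨s₀, hs₀, h1⟩ := exists_tpow_le_mul hc hμ one_pos
  obtain ⟨C, hC, h2⟩ := exists_bound_tpow hc s₀
  refine ⟨C + 1, by positivity, fun s hs => ?_⟩
  rcases le_total s s₀ with h | h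
  · have := h2 s hs h
    nlinarith
  · have := h1 s h
    nlinarith

/-- The linear phase `x·ξ` is dominated by `n Q` outside of `{|Q| < A / n}`. -/
theorem exists_linear_phase_bound (hc : IsContracting E) (hμ : tr E < 1) (r D : ℝ) :
    ∃ c : ℝ, 0 < c ∧ ∀ (n A s : ℝ) (x : Space d), ‖x‖ ≤ r → c ≤ n → c ≤ A → A / n / 2 ≤ s →
      ‖x‖ * (‖E‖ + ‖E‖ ^ 2) * D * ‖tpow s E‖ ≤ n * s / 4 := by
  obtain ⟨C, hC, h1⟩ := exists_tpow_le_one_add hc hμ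
  set B := |r| * (‖E‖ + ‖E‖ ^ 2) * |D| * C
  have hB : 0 ≤ B := by positivity
  -- The aim is `B + B s ≤ n s / 4`. From `A ≥ 16 B` comes `n s ≥ A / 2 ≥ 8 B`, so `B ≤ n s / 8`;
  -- from `n ≥ 16 B` comes `B s ≤ n s / 16`.
  refine ⟨16 * B + 1, by positivity, fun n A s x hx hn hA hs => ?_⟩
  have hn0 : 0 < n := by linarith
  have hA0 : 0 < A := by linarith
  have hs0 : 0 < s := (by positivity : 0 < A / n / 2).trans_le hs
  have hns : A ≤ 2 * (n * s) := by
    rw [div_div, div_le_iff₀ (by positivity)] at hs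
    linarith
  calc ‖x‖ * (‖E‖ + ‖E‖ ^ 2) * D * ‖tpow s E‖
      ≤ ‖x‖ * (‖E‖ + ‖E‖ ^ 2) * |D| * ‖tpow s E‖ := by
        gcongr
        exact le_abs_self D
    _ ≤ |r| * (‖E‖ + ‖E‖ ^ 2) * |D| * (C * (1 + s)) := by
        gcongr
        · exact hx.trans (le_abs_self r)
        · exact h1 s hs0
    _ = B + B * s := by simp only [B]; ring
    _ ≤ n * s / 4 := by nlinarith

/-- The common integrand of `truncatedIntegral`. -/
def oscIntegrand (Q : Space d → ℝ) (t : ℝ) (x ξ : Space d) : ℂ :=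
  Complex.exp (-Complex.I * (t : ℂ) * (Q ξ : ℂ) - Complex.I * ((inner ℝ x ξ : ℝ) : ℂ))

theorem continuous_oscIntegrand (hQ : Continuous Q) (t : ℝ) (x : Space d) :
    Continuous (oscIntegrand Q t x) := by
  unfold oscIntegrand
  fun_prop

theorem oscIntegrand_eq (Q : Space d → ℝ) (t : ℝ) (x ξ : Space d) :
    oscIntegrand Q t x ξ = Complex.exp (-Complex.I * ((t * Q ξ + inner ℝ x ξ : ℝ) : ℂ)) := by
  unfold oscIntegrand
  congr 1
  push_cast
  ring

theorem norm_exp_neg_I_mul (x : ℝ) : ‖Complex.exp (-Complex.I * x)‖ = 1 := by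
  rw [show -Complex.I * (x : ℂ) = ((-x : ℝ) : ℂ) * Complex.I by push_cast; ring]
  exact Complex.norm_exp_ofReal_mul_I _

theorem norm_oscIntegrand (Q : Space d → ℝ) (t : ℝ) (x ξ : Space d) :
    ‖oscIntegrand Q t x ξ‖ = 1 := by
  rw [oscIntegrand_eq, norm_exp_neg_I_mul]

theorem integrableOn_of_norm_le_one {F : Space d → ℂ} (hF : Measurable F) {A : Set (Space d)}
    (hA : MeasurableSet A) (hfin : volume A < ⊤) (h : ∀ ξ ∈ A, ‖F ξ‖ ≤ 1) :
    IntegrableOn F A :=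
  IntegrableOn.of_bound hfin hF.aestronglyMeasurable 1 ((ae_restrict_iff' hA).2 (Eventually.of_forall h))

theorem setIntegral_lt_eq_add {N : Space d → ℝ} (hN : Continuous N) {F : Space d → ℂ} {a b : ℝ}
    (hab : a ≤ b) (hF : IntegrableOn F {ξ | N ξ < b}) :
    ∫ ξ in {ξ | N ξ < b}, F ξ = (∫ ξ in {ξ | N ξ < a}, F ξ) + ∫ ξ in {ξ | a ≤ N ξ ∧ N ξ < b}, F ξ := by
  have hu : {ξ | N ξ < b} = {ξ | N ξ < a} ∪ {ξ | a ≤ N ξ ∧ N ξ < b} := by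
    ext ξ
    constructor
    · intro (h : N ξ < b)
      rcases lt_or_ge (N ξ) a with h' | h'
      · exact Or.inl h'
      · exact Or.inr ⟨h', h⟩
    · rintro (h | h)
      · exact (h : N ξ < a).trans_le hab
      · exact h.2
  have hm : MeasurableSet {ξ | a ≤ N ξ ∧ N ξ < b} :=
    (measurableSet_le measurable_const hN.measurable).inter
      (measurableSet_lt hN.measurable measurable_const)
  rw [hu] at hF ⊢
  refine setIntegral_union ?_ hm (hF.mono_set Set.subset_union_left) (hF.mono_set Set.subset_union_right)
  exact Set.disjoint_left.2 fun ξ (h1 : N ξ < a) h2 => absurd h1 (not_lt.2 h2.1)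

/-- The annulus estimate for the pure model, with neither remainder nor damping: `f = g = 0`. -/
theorem exists_norm_truncatedIntegral_sub_le (hQ : Continuous Q)
    (hN : IsPositiveHomogeneous fun ξ => |Q ξ|)
    (hE : E ∈ exponentSet fun ξ => |Q ξ|) (hc : IsContracting E) (hμ : tr E < 1) :
    ∃ C : ℝ, 0 < C ∧ ∀ (a b n D : ℝ) (x : Space d), 0 < a → a ≤ b → 0 < n →
      (∀ η, 1 ≤ |Q η| → |Q η| < 2 → ‖η‖ ≤ D) →
      (∀ s ∈ Set.Icc (a / 2) b, ‖x‖ * (‖E‖ + ‖E‖ ^ 2) * D * ‖tpow s E‖ ≤ n * s / 4) →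
      ‖truncatedIntegral Q n x b - truncatedIntegral Q n x a‖ ≤ C * a ^ (tr E - 1) / n := by
  obtain ⟨C, hC, h⟩ := exists_annulus_bound hQ hN hE hc hμ
  refine ⟨C, hC, fun a b n D x ha hab hn hD hx => ?_⟩
  have h1 := h a b n D x 0 0 0 0 0 (oscIntegrand Q n x) ha hab hn
    (continuous_oscIntegrand hQ n x).measurable hD hx (fun η _ _ s hs => by
      have : 0 < s := (half_pos ha).trans_le hs.1
      refine ⟨hasDerivAt_const _ _, hasDerivAt_const _ _, hasDerivAt_const _ _, ?_, ?_, le_rfl, le_rfl⟩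
      · simp
      · simp only [Pi.zero_apply, abs_zero]; positivity) (fun ξ _ _ => by
      rw [oscIntegrand_eq]; simp)
  have hi : IntegrableOn (oscIntegrand Q n x) {ξ | |Q ξ| < b} :=
    integrableOn_of_norm_le_one (continuous_oscIntegrand hQ n x).measurable
      (hN.isOpen_lt b).measurableSet (hN.volume_lt_lt_top hE hc b)
      fun ξ _ => (norm_oscIntegrand _ _ _ _).le
  have h2 := setIntegral_lt_eq_add hN.continuous hab hi
  have h3 : truncatedIntegral Q n x b - truncatedIntegral Q n x a
      = ∫ ξ in {ξ | a ≤ |Q ξ| ∧ |Q ξ| < b}, oscIntegrand Q n x ξ := by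
    change (∫ ξ in {ξ | |Q ξ| < b}, oscIntegrand Q n x ξ) - (∫ ξ in {ξ | |Q ξ| < a}, oscIntegrand Q n x ξ) = _
    rw [h2, add_sub_cancel_left]
  rw [h3]
  exact h1

theorem exists_shell_bound (hN : IsPositiveHomogeneous fun ξ => |Q ξ|)
    (hE : E ∈ exponentSet fun ξ => |Q ξ|) (hc : IsContracting E) :
    ∃ D : ℝ, 0 < D ∧ ∀ η, 1 ≤ |Q η| → |Q η| < 2 → ‖η‖ ≤ D := by
  obtain ⟨D, hD⟩ := (hN.isCompact_le hE hc 2).isBounded.exists_norm_le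
  exact ⟨max D 1, by positivity, fun η _ h => (hD η (le_of_lt h)).trans (le_max_left _ _)⟩

/-- For fixed `x` and `t` the linear phase is dominated beyond some radius; from there on the
truncated integrals differ by `O(a^{tr E - 1})`, which is a Cauchy condition because `tr E < 1`. -/
theorem renormConverges (hQ : Continuous Q)
    (hN : IsPositiveHomogeneous fun ξ => |Q ξ|)
    (hE : E ∈ exponentSet fun ξ => |Q ξ|) (hc : IsContracting E) (hμ : tr E < 1)
    {t : ℝ} (ht : 0 < t) (x : Space d) : RenormConverges Q t x := by
  obtain ⟨C, hC, h⟩ := exists_norm_truncatedIntegral_sub_le hQ hN hE hc hμ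
  obtain ⟨D, hD, hD'⟩ := exists_shell_bound hN hE hc
  set B := ‖x‖ * (‖E‖ + ‖E‖ ^ 2) * D
  have hB : 0 ≤ B := by positivity
  obtain ⟨s₀, hs₀, h1⟩ := exists_tpow_le_mul hc hμ (κ := t / (4 * (B + 1))) (by positivity)
  have h2 : ∀ a b, 2 * s₀ ≤ a → a ≤ b →
      ‖truncatedIntegral Q t x b - truncatedIntegral Q t x a‖ ≤ C * a ^ (tr E - 1) / t := by
    intro a b ha hab
    refine h a b t D x (by linarith) hab ht hD' fun s hs => ?_
    have hs' : s₀ ≤ s := by linarith [hs.1]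
    have hs0 : 0 < s := hs₀.trans_le hs'
    calc B * ‖tpow s E‖ ≤ (B + 1) * (t / (4 * (B + 1)) * s) := by
          gcongr
          · linarith
          · exact h1 s hs'
      _ = t * s / 4 := by field_simp
  have h3 : Tendsto (fun a : ℝ => C * a ^ (-(1 - tr E)) / t) atTop (𝓝 (C * 0 / t)) :=
    ((tendsto_rpow_neg_atTop (by linarith)).const_mul C).div_const t
  rw [mul_zero, zero_div] at h3
  refine cauchy_map_iff_exists_tendsto.1 ?_
  refine Metric.cauchy_iff.2 ⟨inferInstance, fun ε hε => ?_⟩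
  obtain ⟨T, hT⟩ := eventually_atTop.1 (h3.eventually_lt_const (half_pos hε))
  set a := max T (2 * s₀)
  have ha := hT a (le_max_left _ _)
  rw [show -(1 - tr E) = tr E - 1 by ring] at ha
  refine ⟨truncatedIntegral Q t x '' Set.Ici a, image_mem_map (Ici_mem_atTop a), ?_⟩
  rintro _ ⟨b, hb, rfl⟩ _ ⟨b', hb', rfl⟩
  have e1 := h2 a b (le_max_right _ _) hb
  have e2 := h2 a b' (le_max_right _ _) hb'
  rw [← dist_eq_norm] at e1 e2
  calc _ ≤ _ := dist_triangle_right _ _ (truncatedIntegral Q t x a)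
    _ < ε := by linarith

/-- Letting the outer radius tend to infinity with inner radius `A / n` gives `(A / n)^{μ-1} / n =
A^{μ-1} n^{-μ}`. The constant `C` is chosen before the ball radius `r`; only the threshold `c`
depends on `r`. -/
theorem exists_norm_limUnder_sub_le (hQ : Continuous Q)
    (hN : IsPositiveHomogeneous fun ξ => |Q ξ|)
    (hE : E ∈ exponentSet fun ξ => |Q ξ|) (hc : IsContracting E) (hμ : tr E < 1) :
    ∃ C : ℝ, 0 < C ∧ ∀ r : ℝ, ∃ c : ℝ, 0 < c ∧ ∀ (n A : ℝ) (x : Space d), ‖x‖ ≤ r → c ≤ n → c ≤ A →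
      ‖limUnder atTop (truncatedIntegral Q n x) - truncatedIntegral Q n x (A / n)‖
        ≤ C * A ^ (tr E - 1) * n ^ (-tr E) := by
  obtain ⟨C, hC, h⟩ := exists_norm_truncatedIntegral_sub_le hQ hN hE hc hμ
  obtain ⟨D, hD, hD'⟩ := exists_shell_bound hN hE hc
  refine ⟨C, hC, fun r => ?_⟩
  obtain ⟨c, hcp, h1⟩ := exists_linear_phase_bound hc hμ r D
  refine ⟨c, hcp, fun n A x hx hn hA => ?_⟩
  have hn0 : 0 < n := hcp.trans_le hn
  have hA0 : 0 < A := hcp.trans_le hA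
  have hlim := tendsto_nhds_limUnder (renormConverges hQ hN hE hc hμ hn0 x)
  refine le_of_tendsto (hlim.sub_const _).norm ?_
  filter_upwards [eventually_ge_atTop (A / n)] with b hb
  refine (h (A / n) b n D x (by positivity) hb hn0 hD'
    fun s hs => h1 n A s x hx hn hA hs.1).trans (le_of_eq ?_)
  rw [Real.div_rpow hA0.le hn0.le, Real.rpow_sub_one hn0.ne', Real.rpow_neg hn0.le]
  field_simp
end
end LLT

/-! ### Subhomogeneous remainders along orbits -/

namespace LLT
noncomputable section
variable {d : ℕ} {Q : Space d → ℝ} {E : Space d →L[ℝ] Space d}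

theorem IsStronglySubhomogeneous.isSubhomogeneous {f : Space d → ℝ} {l : ℕ}
    (h : IsStronglySubhomogeneous f E l) : IsSubhomogeneous f E := by
  obtain ⟨hc, ⟨U, hU, h0, hf⟩, h⟩ := h
  refine ⟨hc, ⟨U, hU, h0, hf.continuousOn⟩, fun ε hε K hK => ?_⟩
  obtain ⟨τ, hτ, h1⟩ := h ε hε K hK
  exact ⟨τ, hτ, fun t ht ht' ξ hξ => by simpa using h1 0 (Nat.zero_le _) t ht ht' ξ hξ⟩

/-- A subhomogeneous function is `o(N)` near `0`. -/
theorem IsSubhomogeneous.exists_le {f N : Space d → ℝ} (hf : IsSubhomogeneous f E)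
    (hN : IsPositiveHomogeneous N) (hE : E ∈ exponentSet N) {ε : ℝ} (hε : 0 < ε) :
    ∃ τ : ℝ, 0 < τ ∧ ∀ ξ, N ξ < τ → |f ξ| ≤ ε * N ξ := by
  -- The origin is added to the level set because `t^E 0 = 0` for all `t`, which forces `f 0 = 0`.
  obtain ⟨τ, hτ, h⟩ := hf.2.2 ε hε _ (hN.isCompact_level.union (isCompact_singleton (x := (0 : Space d))))
  refine ⟨τ, hτ, fun ξ hξ => ?_⟩
  by_cases h0 : ξ = 0
  · rw [h0, hN.apply_zero, mul_zero]
    have h1 : ∀ t : ℝ, 0 < t → t < τ → |f 0| ≤ ε * t := fun t ht ht' => by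
      have := h t ht ht' 0 (Or.inr rfl)
      rwa [map_zero] at this
    by_contra hcon
    have hp : 0 < |f 0| := not_le.1 hcon
    have h2 := h1 (min (τ / 2) (|f 0| / (2 * ε))) (by positivity)
      ((min_le_left _ _).trans_lt (half_lt_self hτ))
    have h3 : ε * min (τ / 2) (|f 0| / (2 * ε)) ≤ ε * (|f 0| / (2 * ε)) := by
      gcongr; exact min_le_right _ _
    have h4 : ε * (|f 0| / (2 * ε)) = |f 0| / 2 := by field_simp
    linarith
  · obtain ⟨η, hη, e⟩ := exists_eq_tpow hE (hN.pos h0)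
    have := h (N ξ) (hN.pos h0) hξ η (Or.inl hη)
    rwa [← e] at this

theorem ContDiffAt.hasDerivAt_deriv {h : ℝ → ℝ} {s : ℝ} (hh : ContDiffAt ℝ 2 h s) :
    HasDerivAt (deriv h) (iteratedDeriv 2 h s) s := by
  have h1 : ContDiffAt ℝ 1 (fderiv ℝ h) s := hh.fderiv_right (by norm_num)
  have h2 : DifferentiableAt ℝ (deriv h) s := by
    have : deriv h = fun x => fderiv ℝ h x 1 := funext fun x => fderiv_apply_one_eq_deriv.symm
    rw [this]
    exact (h1.differentiableAt one_ne_zero).clm_apply (differentiableAt_const _)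
  have h3 : iteratedDeriv 2 h = deriv (deriv h) := by
    rw [iteratedDeriv_succ, iteratedDeriv_one]
  rw [h3]
  exact h2.hasDerivAt

theorem exists_tpow_mem (hc : IsContracting E) {K U : Set (Space d)} (hK : IsCompact K)
    (hU : U ∈ 𝓝 0) : ∃ τ : ℝ, 0 < τ ∧ ∀ s, 0 < s → s < τ → ∀ η ∈ K, tpow s E η ∈ U := by
  obtain ⟨ε, hε, hU⟩ := Metric.mem_nhds_iff.1 hU
  obtain ⟨D, hD⟩ := hK.isBounded.exists_norm_le
  obtain ⟨τ, hτ, h⟩ := exists_tpow_lt hc (ε := ε / (|D| + 1)) (by positivity)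
  refine ⟨τ, hτ, fun s hs hs' η hη => hU ?_⟩
  rw [mem_ball_zero_iff]
  have h1 : ‖η‖ ≤ |D| + 1 := (hD η hη).trans ((le_abs_self D).trans (by linarith))
  calc ‖tpow s E η‖ ≤ ‖tpow s E‖ * ‖η‖ := (tpow s E).le_opNorm η
    _ ≤ ‖tpow s E‖ * (|D| + 1) := by gcongr
    _ < ε / (|D| + 1) * (|D| + 1) := by gcongr; exact h s hs hs'
    _ = ε := div_mul_cancel₀ _ (by positivity)

theorem IsStronglySubhomogeneous.exists_contDiffAt {f : Space d → ℝ} {l : ℕ}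
    (hf : IsStronglySubhomogeneous f E l) {K : Set (Space d)} (hK : IsCompact K) :
    ∃ τ : ℝ, 0 < τ ∧ ∀ s, 0 < s → s < τ → ∀ η ∈ K, ContDiffAt ℝ l (fun s => f (tpow s E η)) s := by
  obtain ⟨hc, ⟨U, hU, h0, hfU⟩, -⟩ := hf
  obtain ⟨τ, hτ, h⟩ := exists_tpow_mem hc hK (hU.mem_nhds h0)
  refine ⟨τ, hτ, fun s hs hs' η hη => ?_⟩
  exact (hfU.contDiffAt (hU.mem_nhds (h s hs hs' η hη))).comp s
    (contDiffAt_tpow_apply hs E η (n := l))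

/-- Derivative bounds along orbits for a strongly subhomogeneous remainder of order `2`. -/
theorem IsStronglySubhomogeneous.exists_deriv_bounds {f : Space d → ℝ}
    (hf : IsStronglySubhomogeneous f E 2) {K : Set (Space d)} (hK : IsCompact K) :
    ∃ τ : ℝ, 0 < τ ∧ ∀ s, 0 < s → s < τ → ∀ η ∈ K,
      HasDerivAt (fun s => f (tpow s E η)) (deriv (fun s => f (tpow s E η)) s) s ∧
      HasDerivAt (deriv fun s => f (tpow s E η)) (iteratedDeriv 2 (fun s => f (tpow s E η)) s) s ∧
      |deriv (fun s => f (tpow s E η)) s| ≤ 1 / 4 ∧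
      |iteratedDeriv 2 (fun s => f (tpow s E η)) s| ≤ 1 / s := by
  obtain ⟨τ₁, hτ₁, h1⟩ := hf.exists_contDiffAt hK
  obtain ⟨τ₂, hτ₂, h2⟩ := hf.2.2 (1 / 4) (by norm_num) K hK
  refine ⟨min τ₁ τ₂, by positivity, fun s hs hs' η hη => ?_⟩
  have c := h1 s hs (hs'.trans_le (min_le_left _ _)) η hη
  refine ⟨(c.differentiableAt two_ne_zero).hasDerivAt, ContDiffAt.hasDerivAt_deriv c, ?_, ?_⟩
  · have := h2 1 one_le_two s hs (hs'.trans_le (min_le_right _ _)) η hη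
    rw [iteratedDeriv_one, pow_one, abs_mul, abs_of_pos hs, mul_comm s] at this
    exact le_of_mul_le_mul_right this hs
  · have := h2 2 le_rfl s hs (hs'.trans_le (min_le_right _ _)) η hη
    rw [abs_mul, abs_of_pos (pow_pos hs 2)] at this
    rw [le_div_iff₀ hs]
    have h3 : s * (|iteratedDeriv 2 (fun s => f (tpow s E η)) s| * s) ≤ s * (1 / 4) := by
      calc _ = s ^ 2 * |iteratedDeriv 2 (fun s => f (tpow s E η)) s| := by ring
        _ ≤ _ := this
        _ = _ := by ring
    have := le_of_mul_le_mul_left h3 hs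
    linarith

theorem apply_tpow_of_inv_smul {R : Space d → ℝ} {k : ℝ} (hk : 1 < k)
    (hER : k⁻¹ • E ∈ exponentSet R) {s : ℝ} (hs : 0 < s) (η : Space d) :
    R (tpow s E η) = s ^ k * R η := by
  have hk0 : k ≠ 0 := by linarith
  rw [← tpow_rpow hs hk0 E]
  exact hER _ (Real.rpow_pos_of_pos hs _) η

/-- Along orbits `R` plus a strongly subhomogeneous remainder is increasing. -/
theorem exists_deriv_nonneg {R f : Space d → ℝ} {k : ℝ} (hk : 1 < k)
    (hR : IsPositiveHomogeneous R) (hER : k⁻¹ • E ∈ exponentSet R)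
    (hf : IsStronglySubhomogeneous f (k⁻¹ • E) 1) {K : Set (Space d)} (hK : IsCompact K)
    (h0 : (0 : Space d) ∉ K) :
    ∃ τ : ℝ, 0 < τ ∧ ∀ s, 0 < s → s < τ → ∀ η ∈ K, ∃ g' : ℝ, 0 ≤ g' ∧
      HasDerivAt (fun s => R (tpow s E η) + f (tpow s E η)) g' s ∧
      0 ≤ R (tpow s E η) + f (tpow s E η) := by
  have hk0 : 0 < k := by linarith
  obtain ⟨c, hcp, hc⟩ : ∃ c : ℝ, 0 < c ∧ ∀ η ∈ K, c ≤ R η := by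
    rcases K.eq_empty_or_nonempty with h | h
    · exact ⟨1, one_pos, by simp [h]⟩
    · obtain ⟨η₀, hη₀, hmin⟩ := hK.exists_isMinOn h hR.continuous.continuousOn
      exact ⟨R η₀, hR.pos fun h => h0 (h ▸ hη₀), fun η hη => hmin hη⟩
  obtain ⟨τ₁, hτ₁, h1⟩ := hf.exists_contDiffAt hK
  -- With `c` a lower bound of `R` on `K` in the role of `ε`, the derivative of `u R(η) + f(u^{E/k}
  -- η)` in `u` is at least `c - c = 0`.
  obtain ⟨τ₂, hτ₂, h2⟩ := hf.2.2 c hcp K hK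
  -- The bounds on `f` hold in the time `u = s^k` of `E / k`, hence the `k`-th root.
  refine ⟨(min τ₁ τ₂) ^ k⁻¹, by positivity, fun s hs hs' η hη => ?_⟩
  have hu0 : 0 < s ^ k := Real.rpow_pos_of_pos hs _
  have hu : s ^ k < min τ₁ τ₂ := by
    calc s ^ k < ((min τ₁ τ₂) ^ k⁻¹) ^ k := Real.rpow_lt_rpow hs.le hs' hk0
      _ = _ := Real.rpow_inv_rpow (by positivity) hk0.ne'
  have hu1 := hu.trans_le (min_le_left _ _)
  have hu2 := hu.trans_le (min_le_right _ _)
  set h : ℝ → ℝ := fun u => f (tpow u (k⁻¹ • E) η)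
  have hh : HasDerivAt h (deriv h (s ^ k)) (s ^ k) :=
    ((h1 _ hu0 hu1 η hη).differentiableAt one_ne_zero).hasDerivAt
  have hpow : HasDerivAt (fun s : ℝ => s ^ k) (k * s ^ (k - 1)) s :=
    Real.hasDerivAt_rpow_const (Or.inl hs.ne')
  have hd : |deriv h (s ^ k)| ≤ c := by
    have := h2 1 le_rfl _ hu0 hu2 η hη
    rw [iteratedDeriv_one, pow_one, abs_mul, abs_of_pos hu0, mul_comm (s ^ k)] at this
    exact le_of_mul_le_mul_right this hu0
  have hv : |f (tpow s E η)| ≤ c * s ^ k := by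
    have := h2 0 (Nat.zero_le _) _ hu0 hu2 η hη
    simpa [tpow_rpow hs hk0.ne'] using this
  have hRη := hc η hη
  refine ⟨(k * s ^ (k - 1)) * R η + deriv h (s ^ k) * (k * s ^ (k - 1)), ?_, ?_, ?_⟩
  · have : 0 ≤ k * s ^ (k - 1) := by positivity
    rw [mul_comm (deriv h (s ^ k)), ← mul_add]
    exact mul_nonneg this (by linarith [(abs_le.1 hd).1])
  · have h3 := (hpow.mul_const (R η)).add (hh.comp s hpow)
    refine h3.congr_of_eventuallyEq ?_
    filter_upwards [lt_mem_nhds hs] with u hu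
    simp only [Pi.add_apply, Function.comp, h]
    rw [apply_tpow_of_inv_smul hk hER hu, tpow_rpow hu hk0.ne']
  · rw [apply_tpow_of_inv_smul hk hER hs]
    have : c * s ^ k ≤ s ^ k * R η := by rw [mul_comm]; gcongr
    linarith [(abs_le.1 hv).1]

end
end LLT

/-! ### The local limit at a point of imaginary type -/

namespace LLT
noncomputable section
variable {d : ℕ} {Q : Space d → ℝ} {E : Space d →L[ℝ] Space d}

/-- The integrand `q(ξ)^n e^{-i x·ξ}`. -/
def localIntegrand (q : Space d → ℂ) (n : ℕ) (x ξ : Space d) : ℂ :=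
  q ξ ^ n * Complex.exp (-Complex.I * ((inner ℝ x ξ : ℝ) : ℂ))

theorem continuous_localIntegrand {q : Space d → ℂ} (hq : Continuous q) (n : ℕ) (x : Space d) :
    Continuous (localIntegrand q n x) := by
  unfold localIntegrand
  fun_prop

theorem localIntegrand_eq {q : Space d → ℂ} {n : ℕ} {x ξ : Space d} {u g f : ℝ}
    (h : q ξ = Complex.exp (-(g : ℂ) - Complex.I * ((u + f : ℝ) : ℂ))) :
    localIntegrand q n x ξ = Complex.exp (-Complex.I * ((n * (u + f) + inner ℝ x ξ : ℝ) : ℂ))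
      * (Real.exp (-(n * g)) : ℂ) := by
  unfold localIntegrand
  rw [h, ← Complex.exp_nat_mul, ← Complex.exp_add, Complex.ofReal_exp, ← Complex.exp_add]
  congr 1
  push_cast
  ring

/-- The quotient `R / |Q|^k` is constant on orbits and bounded on the compact set `{|Q| = 1}`. As `k
> 1`, damping is negligible where `|Q|` is of order `1 / n`. -/
theorem exists_le_rpow {R : Space d → ℝ} (hN : IsPositiveHomogeneous fun ξ => |Q ξ|)
    (hE : E ∈ exponentSet fun ξ => |Q ξ|) (hR : IsPositiveHomogeneous R) {k : ℝ} (hk : 1 < k)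
    (hER : k⁻¹ • E ∈ exponentSet R) :
    ∃ C : ℝ, 0 < C ∧ ∀ ξ, R ξ ≤ C * |Q ξ| ^ k := by
  obtain ⟨C, hC⟩ := hN.isCompact_level.exists_bound_of_continuousOn hR.continuous.continuousOn
  refine ⟨max C 1, by positivity, fun ξ => ?_⟩
  by_cases h0 : ξ = 0
  · rw [h0, hR.apply_zero]; positivity
  · have hp := hN.pos h0
    obtain ⟨η, hη, e⟩ := exists_eq_tpow hE hp
    have h1 : R ξ = |Q ξ| ^ k * R η := by
      conv_lhs => rw [e]
      exact apply_tpow_of_inv_smul hk hER hp η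
    rw [h1, mul_comm]
    gcongr
    exact (le_abs_self _).trans ((hC η hη).trans (le_max_left _ _))

/-- Near the singularity the local integrand is close to the model `e^{-i n Q(ξ) - i x·ξ}`. -/
theorem head_estimate {R fQ fR : Space d → ℝ} {q : Space d → ℂ} {k : ℝ} (hQ : Continuous Q)
    (hN : IsPositiveHomogeneous fun ξ => |Q ξ|) (hE : E ∈ exponentSet fun ξ => |Q ξ|)
    (hc : IsContracting E) (hR : IsPositiveHomogeneous R) (hk : 1 < k)
    (hER : k⁻¹ • E ∈ exponentSet R) (hfQ : IsSubhomogeneous fQ E)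
    (hfR : IsSubhomogeneous fR (k⁻¹ • E)) (hq : Continuous q)
    (hexp : ∀ᶠ ξ in 𝓝 0, q ξ = Complex.exp (-((R ξ + fR ξ : ℝ) : ℂ)
      - Complex.I * ((Q ξ + fQ ξ : ℝ) : ℂ)))
    {A ε : ℝ} (hA : 0 < A) (hε : 0 < ε) :
    ∃ N : ℕ, ∀ n : ℕ, N ≤ n → ∀ x : Space d,
      ‖(∫ ξ in {ξ | |Q ξ| < A / n}, localIntegrand q n x ξ) - truncatedIntegral Q n x (A / n)‖
        ≤ ε * (n : ℝ) ^ (-tr E) := by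
  set V := volume.real {ξ | |Q ξ| < 1}
  have hV : 0 ≤ V := measureReal_nonneg
  -- The integrands will differ by at most `2 ρ` on a set of volume `A^μ V n^{-μ}`.
  obtain ⟨ρ, hρ, hρ1, hρε⟩ : ∃ ρ : ℝ, 0 < ρ ∧ ρ ≤ 1 ∧ 2 * ρ * (A ^ tr E * V) ≤ ε := by
    have hM : 0 ≤ A ^ tr E * V := by positivity
    refine ⟨min 1 (ε / (2 * (A ^ tr E * V + 1))), by positivity, min_le_left _ _, ?_⟩
    calc _ ≤ 2 * (ε / (2 * (A ^ tr E * V + 1))) * (A ^ tr E * V + 1) := by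
          gcongr
          · exact min_le_right _ _
          · linarith
      _ = ε := by field_simp
  obtain ⟨C, hC, hCR⟩ := exists_le_rpow hN hE hR hk hER
  -- On `{|Q| < A / n}` this yields `n |fQ| ≤ ρ / 2`. The other half of `ρ` is left for `n (R +
  -- fR)`, of order `n (A / n)^k → 0`.
  obtain ⟨τ₁, hτ₁, h1⟩ := hfQ.exists_le hN hE (ε := ρ / (2 * A)) (by positivity)
  obtain ⟨τ₂, hτ₂, h2⟩ := hfR.exists_le hR hER one_pos
  obtain ⟨δ, hδ, hδU⟩ := hN.exists_lt_subset hE hc (inter_mem hexp (hR.lt_mem_nhds hτ₂))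
  have ht1 : Tendsto (fun n : ℕ => A / (n : ℝ)) atTop (𝓝 0) := tendsto_const_div_atTop_nhds_zero_nat A
  have ht2 : Tendsto (fun n : ℕ => 2 * C * A ^ k * (n : ℝ) ^ (-(k - 1))) atTop (𝓝 (2 * C * A ^ k * 0)) :=
    ((tendsto_rpow_neg_atTop (by linarith)).comp tendsto_natCast_atTop_atTop).const_mul _
  rw [mul_zero] at ht2
  obtain ⟨N, hNN⟩ := eventually_atTop.1 ((ht1.eventually_lt_const hδ).and
    ((ht1.eventually_lt_const hτ₁).and ((ht2.eventually_lt_const (half_pos hρ)).and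
      (eventually_ge_atTop 1))))
  refine ⟨N, fun n hn x => ?_⟩
  obtain ⟨hn1, hn2, hn3, hn4⟩ := hNN n hn
  have hn0 : (0 : ℝ) < n := by exact_mod_cast hn4
  have hAn : 0 < A / n := by positivity
  have hpt : ∀ ξ ∈ {ξ | |Q ξ| < A / n}, ‖localIntegrand q n x ξ - oscIntegrand Q n x ξ‖ ≤ 2 * ρ := by
    intro ξ (hξ : |Q ξ| < A / n)
    obtain ⟨hqe, hRτ⟩ := hδU (show ξ ∈ {ξ | |Q ξ| < δ} from hξ.trans hn1)
    have hfq := h1 ξ (hξ.trans hn2)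
    have hfr := h2 ξ hRτ
    rw [one_mul] at hfr
    have hRξ : n * R ξ ≤ ρ / 4 := by
      calc n * R ξ ≤ n * (C * (A / n) ^ k) := by
            gcongr
            exact (hCR ξ).trans (by gcongr)
        _ = (2 * C * A ^ k * (n : ℝ) ^ (-(k - 1))) / 2 := by
            rw [Real.div_rpow hA.le hn0.le, show -(k - 1) = 1 - k by ring, Real.rpow_sub hn0,
              Real.rpow_one]
            field_simp
        _ ≤ ρ / 4 := by linarith
    have hg : |n * (R ξ + fR ξ)| ≤ ρ / 2 := by
      rw [abs_mul, abs_of_pos hn0]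
      calc n * |R ξ + fR ξ| ≤ n * (R ξ + R ξ) := by
            gcongr
            exact (abs_add_le _ _).trans (by rw [abs_of_nonneg (hR.nonneg ξ)]; linarith)
        _ ≤ ρ / 2 := by linarith
    have hf : |n * fQ ξ| ≤ ρ / 2 := by
      rw [abs_mul, abs_of_pos hn0]
      calc n * |fQ ξ| ≤ n * (ρ / (2 * A) * (A / n)) := by
            gcongr
            exact hfq.trans (by gcongr)
        _ = ρ / 2 := by field_simp
    -- The integrand is the model times `e^z`, and `‖e^z - 1‖ ≤ 2 ‖z‖` for `‖z‖ ≤ 1`.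
    set z : ℂ := -((n * (R ξ + fR ξ) : ℝ) : ℂ) - Complex.I * ((n * fQ ξ : ℝ) : ℂ)
    have hz : ‖z‖ ≤ ρ := by
      refine (norm_sub_le _ _).trans ?_
      rw [norm_neg, norm_mul, Complex.norm_I, one_mul, Complex.norm_real, Complex.norm_real,
        Real.norm_eq_abs, Real.norm_eq_abs]
      linarith
    have hfac : localIntegrand q n x ξ - oscIntegrand Q n x ξ
        = oscIntegrand Q n x ξ * (Complex.exp z - 1) := by
      rw [localIntegrand_eq hqe, oscIntegrand_eq, mul_sub, mul_one, ← Complex.exp_add,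
        Complex.ofReal_exp, ← Complex.exp_add]
      congr 2
      simp only [z]
      push_cast
      ring
    rw [hfac, norm_mul, norm_oscIntegrand, one_mul]
    exact (Complex.norm_exp_sub_one_le (hz.trans hρ1)).trans (by gcongr)
  have hfin := hN.volume_lt_lt_top hE hc (A / n)
  have hi1 : IntegrableOn (oscIntegrand Q n x) {ξ | |Q ξ| < A / n} :=
    integrableOn_of_norm_le_one (continuous_oscIntegrand hQ n x).measurable
      (hN.isOpen_lt _).measurableSet hfin fun ξ _ => (norm_oscIntegrand _ _ _ _).le
  have hi2 : IntegrableOn (localIntegrand q n x) {ξ | |Q ξ| < A / n} := by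
    have hK := hN.isCompact_le hE hc (A / n)
    exact ((continuous_localIntegrand hq n x).continuousOn.integrableOn_compact hK).mono_set
      fun ξ (h : |Q ξ| < A / n) => h.le
  have h3 : (∫ ξ in {ξ | |Q ξ| < A / n}, localIntegrand q n x ξ) - truncatedIntegral Q n x (A / n)
      = ∫ ξ in {ξ | |Q ξ| < A / n}, (localIntegrand q n x ξ - oscIntegrand Q n x ξ) :=
    (integral_sub hi2 hi1).symm
  rw [h3]
  refine (norm_setIntegral_le_of_norm_le_const hfin hpt).trans ?_
  rw [IsPositiveHomogeneous.measureReal_lt hE hAn, Real.div_rpow hA.le hn0.le, Real.rpow_neg hn0.le]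
  calc _ = 2 * ρ * (A ^ tr E * V) * ((n : ℝ) ^ tr E)⁻¹ := by ring
    _ ≤ _ := by gcongr

/-- The annulus estimate with phase perturbation `fQ` and damping `R + fR`. Two derivatives of `fQ`
bound the slope and curvature of the phase; one derivative of `fR` makes the damping monotone along
orbits. Neither `δ₀` nor `C` depends on `r`. -/
theorem tail_estimate {R fQ fR : Space d → ℝ} {q : Space d → ℂ} {k : ℝ} (hQ : Continuous Q)
    (hN : IsPositiveHomogeneous fun ξ => |Q ξ|) (hE : E ∈ exponentSet fun ξ => |Q ξ|)
    (hc : IsContracting E) (hμ : tr E < 1) (hR : IsPositiveHomogeneous R) (hk : 1 < k)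
    (hER : k⁻¹ • E ∈ exponentSet R) (hfQ : IsStronglySubhomogeneous fQ E 2)
    (hfR : IsStronglySubhomogeneous fR (k⁻¹ • E) 1) (hq : Continuous q)
    (hexp : ∀ᶠ ξ in 𝓝 0, q ξ = Complex.exp (-((R ξ + fR ξ : ℝ) : ℂ)
      - Complex.I * ((Q ξ + fQ ξ : ℝ) : ℂ))) :
    ∃ δ₀ C : ℝ, 0 < δ₀ ∧ 0 < C ∧ ∀ r : ℝ, ∃ c : ℝ, 0 < c ∧ ∀ (n : ℕ) (A δ : ℝ) (x : Space d),
      ‖x‖ ≤ r → c ≤ n → c ≤ A → A / n ≤ δ → δ ≤ δ₀ →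
      ‖∫ ξ in {ξ | A / n ≤ |Q ξ| ∧ |Q ξ| < δ}, localIntegrand q n x ξ‖
        ≤ C * A ^ (tr E - 1) * (n : ℝ) ^ (-tr E) := by
  obtain ⟨C, hC, h⟩ := exists_annulus_bound hQ hN hE hc hμ
  obtain ⟨D, hD, hD'⟩ := exists_shell_bound hN hE hc
  set K : Set (Space d) := {η | |Q η| ≤ 2} ∩ {η | 1 ≤ |Q η|}
  have hK : IsCompact K := (hN.isCompact_le hE hc 2).inter_right
    (isClosed_le continuous_const hN.continuous)
  have hK0 : (0 : Space d) ∉ K := fun h0 => by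
    have h1 : 1 ≤ |Q 0| := h0.2
    have h2 : |Q 0| = 0 := hN.apply_zero
    linarith
  obtain ⟨τ₁, hτ₁, h1⟩ := hfQ.exists_deriv_bounds hK
  obtain ⟨τ₂, hτ₂, h2⟩ := exists_deriv_nonneg hk hR hER hfR hK hK0
  obtain ⟨δ₁, hδ₁, hδU⟩ := hN.exists_lt_subset hE hc hexp
  refine ⟨min δ₁ (min τ₁ τ₂) / 2, C, by positivity, hC, fun r => ?_⟩
  obtain ⟨c, hcp, h3⟩ := exists_linear_phase_bound hc hμ r D
  refine ⟨c, hcp, fun n A δ x hx hn hA hAδ hδ => ?_⟩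
  have hn0 : (0 : ℝ) < n := hcp.trans_le hn
  have hA0 : 0 < A := hcp.trans_le hA
  have hδ0 : 0 < min δ₁ (min τ₁ τ₂) := by positivity
  have hlt : δ < min δ₁ (min τ₁ τ₂) := by linarith
  have hlt1 : δ < δ₁ := hlt.trans_le (min_le_left _ _)
  have hlt2 : δ < τ₁ := hlt.trans_le ((min_le_right _ _).trans (min_le_left _ _))
  have hlt3 : δ < τ₂ := hlt.trans_le ((min_le_right _ _).trans (min_le_right _ _))
  choose! g' hg0 hg1 hg2 using h2
  refine (h (A / n) δ n D x fQ (fun ξ => R ξ + fR ξ) (fun η => deriv fun s => fQ (tpow s E η))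
    (fun η => iteratedDeriv 2 fun s => fQ (tpow s E η)) (fun η s => g' s η)
    (localIntegrand q n x) (by positivity) hAδ hn0 (continuous_localIntegrand hq n x).measurable hD'
    (fun s hs => h3 n A s x hx hn hA hs.1) ?_ ?_).trans (le_of_eq ?_)
  · intro η hη1 hη2 s hs
    have hs0 : 0 < s := (by positivity : 0 < A / n / 2).trans_le hs.1
    have hηK : η ∈ K := ⟨hη2.le, hη1⟩
    obtain ⟨a1, a2, a3, a4⟩ := h1 s hs0 (hs.2.trans_lt hlt2) η hηK
    have hs3 := hs.2.trans_lt hlt3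
    exact ⟨a1, a2, hg1 s hs0 hs3 η hηK, a3, a4, hg0 s hs0 hs3 η hηK, hg2 s hs0 hs3 η hηK⟩
  · intro ξ _ hξ
    exact localIntegrand_eq (hδU (show ξ ∈ {ξ | |Q ξ| < δ₁} from hξ.trans_lt hlt1))
  · rw [Real.div_rpow hA0.le hn0.le, Real.rpow_sub_one hn0.ne', Real.rpow_neg hn0.le]
    field_simp

/-- The contribution of a point of imaginary homogeneous type. -/
theorem local_limit_imaginary {R fQ fR : Space d → ℝ} {q : Space d → ℂ} {k : ℝ} (hQ : Continuous Q)
    (hN : IsPositiveHomogeneous fun ξ => |Q ξ|) (hE : E ∈ exponentSet fun ξ => |Q ξ|)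
    (hc : IsContracting E) (hμ : tr E < 1) (hR : IsPositiveHomogeneous R) (hk : 1 < k)
    (hER : k⁻¹ • E ∈ exponentSet R) (hfQ : IsStronglySubhomogeneous fQ E 2)
    (hfR : IsStronglySubhomogeneous fR (k⁻¹ • E) 1) (hq : Continuous q)
    (hexp : ∀ᶠ ξ in 𝓝 0, q ξ = Complex.exp (-((R ξ + fR ξ : ℝ) : ℂ)
      - Complex.I * ((Q ξ + fQ ξ : ℝ) : ℂ))) :
    ∃ δ₀ : ℝ, 0 < δ₀ ∧ ∀ δ, 0 < δ → δ ≤ δ₀ → ∀ r ε : ℝ, 0 < ε → ∃ N : ℕ, ∀ n : ℕ, N ≤ n →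
      ∀ x : Space d, ‖x‖ ≤ r →
      ‖(∫ ξ in {ξ | |Q ξ| < δ}, localIntegrand q n x ξ) - limUnder atTop (truncatedIntegral Q n x)‖
        ≤ ε * (n : ℝ) ^ (-tr E) := by
  obtain ⟨δ₀, C, hδ₀, hC, h1⟩ := tail_estimate hQ hN hE hc hμ hR hk hER hfQ hfR hq hexp
  obtain ⟨C', hC', h2⟩ := exists_norm_limUnder_sub_le hQ hN hE hc hμ
  refine ⟨δ₀, hδ₀, fun δ hδ hδδ r ε hε => ?_⟩
  obtain ⟨c, hcp, h1⟩ := h1 r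
  obtain ⟨c', hcp', h2⟩ := h2 r
  have ht : Tendsto (fun a : ℝ => (C + C') * a ^ (-(1 - tr E))) atTop (𝓝 ((C + C') * 0)) :=
    (tendsto_rpow_neg_atTop (by linarith)).const_mul _
  rw [mul_zero] at ht
  -- The order of choices matters: `A` makes both tails, of the integral and of the attractor, small
  -- together; only then is `n` taken large for the inner part with this `A`.
  obtain ⟨A, hA, hAc, hAc'⟩ := ((ht.eventually_lt_const (half_pos hε)).and
    ((eventually_ge_atTop c).and (eventually_ge_atTop c'))).exists
  rw [show -(1 - tr E) = tr E - 1 by ring] at hA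
  have hA0 : 0 < A := hcp.trans_le hAc
  obtain ⟨N, h3⟩ := head_estimate hQ hN hE hc hR hk hER hfQ.isSubhomogeneous hfR.isSubhomogeneous hq
    hexp hA0 (half_pos hε)
  have hcast := tendsto_natCast_atTop_atTop (R := ℝ)
  obtain ⟨N', hN'⟩ := eventually_atTop.1 ((hcast.eventually_ge_atTop c).and
    ((hcast.eventually_ge_atTop c').and
      ((tendsto_const_div_atTop_nhds_zero_nat A).eventually_lt_const hδ)))
  refine ⟨max N N', fun n hn x hx => ?_⟩
  obtain ⟨hn1, hn2, hn3⟩ := hN' n ((le_max_right _ _).trans hn)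
  have e1 := h1 n A δ x hx hn1 hAc hn3.le hδδ
  have e2 := h2 n A x hx hn2 hAc'
  have e3 := h3 n ((le_max_left _ _).trans hn) x
  have hi : IntegrableOn (localIntegrand q n x) {ξ | |Q ξ| < δ} :=
    ((continuous_localIntegrand hq n x).continuousOn.integrableOn_compact
      (hN.isCompact_le hE hc δ)).mono_set fun ξ (h : |Q ξ| < δ) => h.le
  have e4 := setIntegral_lt_eq_add hN.continuous hn3.le hi
  rw [e4]
  set a := ∫ ξ in {ξ | |Q ξ| < A / n}, localIntegrand q n x ξ
  set b := ∫ ξ in {ξ | A / n ≤ |Q ξ| ∧ |Q ξ| < δ}, localIntegrand q n x ξ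
  set l := limUnder atTop (truncatedIntegral Q n x)
  set T := truncatedIntegral Q n x (A / n)
  have hp : 0 ≤ (n : ℝ) ^ (-tr E) := by positivity
  calc ‖a + b - l‖ = ‖(a - T) + b - (l - T)‖ := by congr 1; ring
    _ ≤ ‖a - T‖ + ‖b‖ + ‖l - T‖ := (norm_sub_le _ _).trans (by gcongr; exact norm_add_le _ _)
    _ ≤ ε / 2 * (n : ℝ) ^ (-tr E) + C * A ^ (tr E - 1) * (n : ℝ) ^ (-tr E)
        + C' * A ^ (tr E - 1) * (n : ℝ) ^ (-tr E) := by gcongr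
    _ = (ε / 2 + (C + C') * A ^ (tr E - 1)) * (n : ℝ) ^ (-tr E) := by ring
    _ ≤ ε * (n : ℝ) ^ (-tr E) := by gcongr; linarith

/-- The attractor at a point of imaginary homogeneous type is `O(n^{-μ})` on compact sets. -/
theorem exists_norm_limUnder_le (hQ : Continuous Q)
    (hN : IsPositiveHomogeneous fun ξ => |Q ξ|)
    (hE : E ∈ exponentSet fun ξ => |Q ξ|) (hc : IsContracting E) (hμ : tr E < 1) (r : ℝ) :
    ∃ (C : ℝ) (N : ℕ), 0 < C ∧ ∀ n : ℕ, N ≤ n → ∀ x : Space d, ‖x‖ ≤ r →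
      ‖limUnder atTop (truncatedIntegral Q n x)‖ ≤ C * (n : ℝ) ^ (-tr E) := by
  obtain ⟨C', hC', h2⟩ := exists_norm_limUnder_sub_le hQ hN hE hc hμ
  obtain ⟨c, hcp, h2⟩ := h2 r
  obtain ⟨N, hN'⟩ := exists_nat_ge c
  set V := volume.real {ξ | |Q ξ| < 1}
  have hV : 0 ≤ V := measureReal_nonneg
  -- Cutting at `A = c`: the first summand is the volume of `{|Q| < c / n}` without `n^{-μ}`, the
  -- second bounds the tail.
  refine ⟨c ^ tr E * V + C' * c ^ (tr E - 1), N, by positivity, fun n hn x hx => ?_⟩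
  have hn' : c ≤ n := hN'.trans (by exact_mod_cast hn)
  have hn0 : (0 : ℝ) < n := hcp.trans_le hn'
  have e1 := h2 n c x hx hn' le_rfl
  have e2 : ‖truncatedIntegral Q n x (c / n)‖ ≤ c ^ tr E * V * (n : ℝ) ^ (-tr E) := by
    refine (norm_setIntegral_le_of_norm_le_const (C := 1) (hN.volume_lt_lt_top hE hc _)
      fun ξ _ => (norm_oscIntegrand Q n x ξ).le).trans (le_of_eq ?_)
    rw [IsPositiveHomogeneous.measureReal_lt hE (by positivity), Real.div_rpow hcp.le hn0.le,
      Real.rpow_neg hn0.le]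
    ring
  calc _ = ‖(limUnder atTop (truncatedIntegral Q n x) - truncatedIntegral Q n x (c / n))
        + truncatedIntegral Q n x (c / n)‖ := by rw [sub_add_cancel]
    _ ≤ _ := norm_add_le _ _
    _ ≤ C' * c ^ (tr E - 1) * (n : ℝ) ^ (-tr E) + c ^ tr E * V * (n : ℝ) ^ (-tr E) := by gcongr
    _ = _ := by ring
end
end LLT

/-! ### The local limit at a point of positive type -/

namespace LLT
noncomputable section
variable {d : ℕ} {R Q : Space d → ℝ} {E : Space d →L[ℝ] Space d}

theorem norm_integrandP (R Q : Space d → ℝ) (t : ℝ) (x ξ : Space d) :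
    ‖integrandP R Q t x ξ‖ = Real.exp (-(t * R ξ)) := by
  unfold integrandP
  rw [norm_mul, norm_exp_neg_I_mul, mul_one, Complex.norm_exp]
  congr 1
  simp

theorem continuous_integrandP (hR : Continuous R) (hQ : Continuous Q) (t : ℝ) (x : Space d) :
    Continuous (integrandP R Q t x) := by
  unfold integrandP
  fun_prop

theorem integrable_integrandP (hQ : Continuous Q) (hR : IsPositiveHomogeneous R)
    (hE : E ∈ exponentSet R) (hc : IsContracting E) {t : ℝ} (ht : 0 < t) (x : Space d) :
    Integrable (integrandP R Q t x) :=
  (hR.integrable_exp_neg hE hc ht).mono' (continuous_integrandP hR.continuous hQ t x).aestronglyMeasurable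
    (Eventually.of_forall fun ξ => (norm_integrandP R Q t x ξ).le)

theorem norm_integral_integrandP_le (hE : E ∈ exponentSet R) {t : ℝ} (ht : 0 < t) (x : Space d) :
    ‖∫ ξ, integrandP R Q t x ξ‖ ≤ (∫ ξ, Real.exp (-(1 * R ξ))) * t ^ (-tr E) := by
  refine (norm_integral_le_integral_norm _).trans (le_of_eq ?_)
  simp_rw [norm_integrandP]
  rw [integral_eq_integral_comp_tpow E (inv_pos.2 ht), Real.inv_rpow ht.le, ← Real.rpow_neg ht.le,
    smul_eq_mul, mul_comm]
  congr 2
  funext ξ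
  rw [hE _ (inv_pos.2 ht), mul_inv_cancel_left₀ ht.ne', one_mul]

/-- The rescaled error of the Gaussian-like approximation. -/
def localError (R Q : Space d → ℝ) (q : Space d → ℂ) (δ : ℝ) (n : ℕ) (ξ : Space d) : ℂ :=
  {ξ | R ξ < δ}.indicator (fun ξ => q ξ ^ n) ξ - Complex.exp (-(n : ℂ) * ((R ξ : ℂ) + Complex.I * (Q ξ : ℂ)))

/-- Dominated convergence. Homogeneity gives `n R(n^{-E} η) = R(η)` and the same for `Q`,
subhomogeneity sends `n` times the remainders to `0`, and `|fR| ≤ R / 2` provides the majorant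
`e^{-R/2} + e^{-R}`. For fixed `η` the indicator is eventually `1`. -/
theorem tendsto_integral_localError {fQ fR : Space d → ℝ} {q : Space d → ℂ} (hQ : Continuous Q)
    (hR : IsPositiveHomogeneous R) (hE : E ∈ exponentSet R) (hEQ : E ∈ exponentSet Q)
    (hfR : IsSubhomogeneous fR E) (hfQ : IsSubhomogeneous fQ E) (hq : Continuous q) {δ : ℝ}
    (hδ : 0 < δ) (hle : ∀ ξ, R ξ < δ → |fR ξ| ≤ 1 / 2 * R ξ)
    (hexp : ∀ ξ, R ξ < δ → q ξ = Complex.exp (-((R ξ + fR ξ : ℝ) : ℂ)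
      - Complex.I * ((Q ξ + fQ ξ : ℝ) : ℂ))) :
    Tendsto (fun n : ℕ => ∫ η, ‖localError R Q q δ n (tpow (n : ℝ)⁻¹ E η)‖) atTop (𝓝 0) := by
  have hc := hfR.1
  have h0 : (0 : ℝ) = ∫ _ : Space d, (0 : ℝ) := by simp
  rw [h0]
  have hRm : MeasurableSet {ξ | R ξ < δ} := (hR.isOpen_lt δ).measurableSet
  have hRc := hR.continuous
  refine tendsto_integral_filter_of_dominated_convergence
    (fun η => Real.exp (-(1 / 2 * R η)) + Real.exp (-(1 * R η))) ?_ ?_ ?_ ?_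
  · refine Eventually.of_forall fun n => ?_
    have h1 : Measurable (localError R Q q δ n) := by
      refine Measurable.sub (Measurable.indicator (hq.pow n).measurable hRm) ?_
      exact Continuous.measurable (by fun_prop)
    exact (h1.comp (tpow (n : ℝ)⁻¹ E).continuous.measurable).norm.aestronglyMeasurable
  · filter_upwards [eventually_ge_atTop 1] with n hn
    refine Eventually.of_forall fun η => ?_
    have hn0 : (0 : ℝ) < n := by exact_mod_cast hn
    have hRη : n * R (tpow (n : ℝ)⁻¹ E η) = R η := by
      rw [hE _ (inv_pos.2 hn0), mul_inv_cancel_left₀ hn0.ne']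
    rw [norm_norm]
    refine (norm_sub_le _ _).trans (add_le_add ?_ ?_)
    · set ξ := tpow (n : ℝ)⁻¹ E η
      by_cases h : R ξ < δ
      · rw [Set.indicator_of_mem (show ξ ∈ {ξ | R ξ < δ} from h), norm_pow, hexp ξ h, Complex.norm_exp,
          ← Real.exp_nat_mul]
        refine Real.exp_le_exp.2 ?_
        have h2 := (abs_le.1 (hle ξ h)).1
        simp only [Complex.sub_re, Complex.neg_re, Complex.ofReal_re, Complex.mul_re, Complex.I_re,
          Complex.I_im, Complex.ofReal_im]
        rw [← hRη]
        nlinarith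
      · rw [Set.indicator_of_notMem (show ξ ∉ {ξ | R ξ < δ} from h), norm_zero]
        positivity
    · rw [Complex.norm_exp]
      refine Real.exp_le_exp.2 (le_of_eq ?_)
      rw [← hRη]
      simp
  · exact (hR.integrable_exp_neg hE hc (by norm_num)).add (hR.integrable_exp_neg hE hc one_pos)
  · refine Eventually.of_forall fun η => ?_
    have hinv : Tendsto (fun n : ℕ => (n : ℝ)⁻¹) atTop (𝓝 0) := tendsto_inv_atTop_nhds_zero_nat
    have hsub : ∀ f : Space d → ℝ, IsSubhomogeneous f E →
        Tendsto (fun n : ℕ => n * f (tpow (n : ℝ)⁻¹ E η)) atTop (𝓝 0) := by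
      intro f hf
      rw [Metric.tendsto_atTop]
      intro ε hε
      obtain ⟨τ, hτ, h⟩ := hf.2.2 (ε / 2) (half_pos hε) {η} isCompact_singleton
      obtain ⟨M, hM⟩ := eventually_atTop.1 ((hinv.eventually_lt_const hτ).and (eventually_ge_atTop 1))
      refine ⟨M, fun n hn => ?_⟩
      obtain ⟨h1, h2⟩ := hM n hn
      have hn0 : (0 : ℝ) < n := by exact_mod_cast h2
      have h3 := h _ (inv_pos.2 hn0) h1 η rfl
      rw [dist_zero_right, Real.norm_eq_abs, abs_mul, abs_of_pos hn0]
      calc n * |f (tpow (n : ℝ)⁻¹ E η)| ≤ n * (ε / 2 * (n : ℝ)⁻¹) := by gcongr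
        _ = ε / 2 := by field_simp
        _ < ε := half_lt_self hε
    have hlim : Tendsto (fun n : ℕ => Complex.exp (-((R η + n * fR (tpow (n : ℝ)⁻¹ E η) : ℝ) : ℂ)
        - Complex.I * ((Q η + n * fQ (tpow (n : ℝ)⁻¹ E η) : ℝ) : ℂ))
        - Complex.exp (-((R η + 0 : ℝ) : ℂ) - Complex.I * ((Q η + 0 : ℝ) : ℂ))) atTop
        (𝓝 (Complex.exp (-((R η + 0 : ℝ) : ℂ) - Complex.I * ((Q η + 0 : ℝ) : ℂ))
        - Complex.exp (-((R η + 0 : ℝ) : ℂ) - Complex.I * ((Q η + 0 : ℝ) : ℂ)))) := by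
      have t1 := (Complex.continuous_ofReal.tendsto _).comp ((hsub fR hfR).const_add (R η))
      have t2 := (Complex.continuous_ofReal.tendsto _).comp ((hsub fQ hfQ).const_add (Q η))
      exact ((Complex.continuous_exp.tendsto _).comp (t1.neg.sub (t2.const_mul Complex.I))).sub_const _
    rw [sub_self] at hlim
    have hlim' := hlim.norm
    rw [norm_zero] at hlim'
    refine hlim'.congr' ?_
    have hRlim : Tendsto (fun n : ℕ => (n : ℝ)⁻¹ * R η) atTop (𝓝 0) := by
      simpa using hinv.mul_const (R η)
    filter_upwards [hRlim.eventually_lt_const hδ, eventually_ge_atTop 1] with n h1 h2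
    have hn0 : (0 : ℝ) < n := by exact_mod_cast h2
    have hRn := hE _ (inv_pos.2 hn0) η
    have hQn := hEQ _ (inv_pos.2 hn0) η
    have hRη : n * R (tpow (n : ℝ)⁻¹ E η) = R η := by rw [hRn, mul_inv_cancel_left₀ hn0.ne']
    have hQη : n * Q (tpow (n : ℝ)⁻¹ E η) = Q η := by rw [hQn, mul_inv_cancel_left₀ hn0.ne']
    set ξ := tpow (n : ℝ)⁻¹ E η
    have hξ : R ξ < δ := by rw [hRn]; exact h1
    congr 1
    unfold localError
    rw [Set.indicator_of_mem (show ξ ∈ {ξ | R ξ < δ} from hξ), hexp ξ hξ, ← Complex.exp_nat_mul,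
      ← hRη, ← hQη]
    congr 2
    · push_cast; ring
    · push_cast; ring

/-- The contribution of a point of positive homogeneous type. -/
theorem local_limit_positive {fQ fR : Space d → ℝ} {q : Space d → ℂ} (hQ : Continuous Q)
    (hR : IsPositiveHomogeneous R) (hE : E ∈ exponentSet R) (hEQ : E ∈ exponentSet Q)
    (hfR : IsSubhomogeneous fR E) (hfQ : IsSubhomogeneous fQ E) (hq : Continuous q)
    (hexp : ∀ᶠ ξ in 𝓝 0, q ξ = Complex.exp (-((R ξ + fR ξ : ℝ) : ℂ)
      - Complex.I * ((Q ξ + fQ ξ : ℝ) : ℂ))) :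
    ∃ δ₀ : ℝ, 0 < δ₀ ∧ ∀ δ, 0 < δ → δ ≤ δ₀ → ∀ ε : ℝ, 0 < ε → ∃ N : ℕ, ∀ n : ℕ, N ≤ n →
      ∀ x : Space d, ‖(∫ ξ in {ξ | R ξ < δ}, localIntegrand q n x ξ) - ∫ ξ, integrandP R Q n x ξ‖
        ≤ ε * (n : ℝ) ^ (-tr E) := by
  have hc := hfR.1
  obtain ⟨δ₁, hδ₁, hδU⟩ := hR.exists_lt_subset hE hc hexp
  obtain ⟨τ, hτ, hle⟩ := hfR.exists_le hR hE (ε := 1 / 2) (by norm_num)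
  refine ⟨min δ₁ τ, by positivity, fun δ hδ hδ' ε hε => ?_⟩
  have ht := tendsto_integral_localError hQ hR hE hEQ hfR hfQ hq hδ
    (fun ξ h => hle ξ (h.trans_le (hδ'.trans (min_le_right _ _))))
    (fun ξ h => hδU (show ξ ∈ {ξ | R ξ < δ₁} from h.trans_le (hδ'.trans (min_le_left _ _))))
  obtain ⟨N, hN⟩ := eventually_atTop.1 ((ht.eventually_lt_const hε).and (eventually_ge_atTop 1))
  refine ⟨N, fun n hn x => ?_⟩
  obtain ⟨h1, h2⟩ := hN n hn
  have hn0 : (0 : ℝ) < n := by exact_mod_cast h2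
  have hm : MeasurableSet {ξ | R ξ < δ} := (hR.isOpen_lt δ).measurableSet
  have hi : IntegrableOn (localIntegrand q n x) {ξ | R ξ < δ} :=
    ((continuous_localIntegrand hq n x).continuousOn.integrableOn_compact
      (hR.isCompact_le hE hc δ)).mono_set fun ξ (h : R ξ < δ) => h.le
  have e1 : (∫ ξ in {ξ | R ξ < δ}, localIntegrand q n x ξ) - ∫ ξ, integrandP R Q n x ξ
      = ∫ ξ, localError R Q q δ n ξ * Complex.exp (-Complex.I * ((inner ℝ x ξ : ℝ) : ℂ)) := by
    rw [← integral_indicator hm, ← integral_sub ((integrable_indicator_iff hm).2 hi)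
      (integrable_integrandP hQ hR hE hc hn0 x)]
    congr 1
    funext ξ
    unfold localError
    rw [sub_mul]
    congr 1
    by_cases h : ξ ∈ {ξ | R ξ < δ}
    · rw [Set.indicator_of_mem h, Set.indicator_of_mem h]; rfl
    · rw [Set.indicator_of_notMem h, Set.indicator_of_notMem h, zero_mul]
  rw [e1]
  refine (norm_integral_le_integral_norm _).trans ?_
  -- The variable `x` disappears here, whence uniformity over all `x`.
  simp_rw [norm_mul, norm_exp_neg_I_mul, mul_one]
  rw [integral_eq_integral_comp_tpow E (inv_pos.2 hn0), Real.inv_rpow hn0.le, ← Real.rpow_neg hn0.le,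
    smul_eq_mul, mul_comm]
  gcongr
end
end LLT

/-! ### Fourier inversion for convolution powers -/

namespace LLT
noncomputable section
variable {d : ℕ}

theorem RapidlyDecreasing.summable_norm {φ : Lattice d → ℂ} (hφ : φ ∈ RapidlyDecreasing d) :
    Summable fun x => ‖φ x‖ := by
  simpa using hφ 0

/-- The character `x ↦ e^{i x·ξ}`. -/
def char (ξ : Space d) (x : Lattice d) : ℂ := Complex.exp (Complex.I * ((inner ℝ (toSpace x) ξ : ℝ) : ℂ))

theorem inner_toSpace (x : Lattice d) (ξ : Space d) : inner ℝ (toSpace x) ξ = ∑ i, (x i : ℝ) * ξ i := by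
  simp [toSpace, PiLp.inner_apply, mul_comm]

theorem toSpace_add (x y : Lattice d) : toSpace (x + y) = toSpace x + toSpace y := by
  ext i; simp [toSpace]

theorem norm_char (ξ : Space d) (x : Lattice d) : ‖char ξ x‖ = 1 := by
  unfold char
  rw [mul_comm]
  exact Complex.norm_exp_ofReal_mul_I _

theorem char_add (ξ : Space d) (x y : Lattice d) : char ξ (x + y) = char ξ x * char ξ y := by
  unfold char
  rw [toSpace_add, inner_add_left, ← Complex.exp_add]
  congr 1
  push_cast
  ring

theorem continuous_fourier {φ : Lattice d → ℂ} (hφ : Summable fun x => ‖φ x‖) :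
    Continuous (fourier φ) := by
  unfold fourier
  refine continuous_tsum (u := fun x => ‖φ x‖) (fun x => by fun_prop) hφ fun x ξ => ?_
  rw [norm_mul]
  exact (mul_le_of_le_one_right (norm_nonneg _) (norm_char ξ x).le)

/-- Translation of the frequency by a vector of `2πℤ^d`. -/
def shift (k : Lattice d) : Space d := (2 * Real.pi) • toSpace k

theorem exp_inner_shift (x k : Lattice d) :
    Complex.exp (Complex.I * ((inner ℝ (toSpace x) (shift k) : ℝ) : ℂ)) = 1 := by
  unfold shift
  rw [inner_smul_right, inner_toSpace]
  have : (∑ i, (x i : ℝ) * (toSpace k) i) = ((∑ i, x i * k i : ℤ) : ℝ) := by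
    push_cast; rfl
  rw [this, Complex.exp_eq_one_iff]
  refine ⟨∑ i, x i * k i, ?_⟩
  push_cast
  ring

theorem exp_neg_inner_shift (x k : Lattice d) :
    Complex.exp (-Complex.I * ((inner ℝ (toSpace x) (shift k) : ℝ) : ℂ)) = 1 := by
  rw [neg_mul, Complex.exp_neg, exp_inner_shift, inv_one]

theorem fourier_add_shift (φ : Lattice d → ℂ) (ξ : Space d) (k : Lattice d) :
    fourier φ (ξ + shift k) = fourier φ ξ := by
  unfold fourier
  congr 1
  funext x
  rw [inner_add_right, Complex.ofReal_add, mul_add, Complex.exp_add, exp_inner_shift, mul_one]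

theorem fourier_single_zero (ξ : Space d) : fourier (Pi.single 0 1 : Lattice d → ℂ) ξ = 1 := by
  unfold fourier
  rw [tsum_eq_single 0]
  · have : toSpace (0 : Lattice d) = 0 := by ext i; simp [toSpace]
    simp [this]
  · intro x hx
    rw [Pi.single_eq_of_ne hx, zero_mul]

/-- `(x, y) ↦ (x - y, y)`. -/
def subEquiv (d : ℕ) : Lattice d × Lattice d ≃ Lattice d × Lattice d where
  toFun p := (p.1 - p.2, p.2)
  invFun p := (p.1 + p.2, p.2)
  left_inv p := by simp
  right_inv p := by simp

theorem summable_convolution {ψ φ : Lattice d → ℂ} (hψ : Summable fun x => ‖ψ x‖)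
    (hφ : Summable fun x => ‖φ x‖) : Summable fun x => ‖∑' y, ψ (x - y) * φ y‖ := by
  have h1 : Summable fun p : Lattice d × Lattice d => ‖ψ p.1 * φ p.2‖ := hψ.mul_norm hφ
  have h2 : Summable fun p : Lattice d × Lattice d => ‖ψ (p.1 - p.2) * φ p.2‖ :=
    (subEquiv d).summable_iff.2 h1
  refine h2.prod.of_nonneg_of_le (fun x => norm_nonneg _) fun x => ?_
  exact norm_tsum_le_tsum_norm (h2.prod_factor x)

theorem fourier_convolution {ψ φ : Lattice d → ℂ} (hψ : Summable fun x => ‖ψ x‖)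
    (hφ : Summable fun x => ‖φ x‖) (ξ : Space d) :
    fourier (fun x => ∑' y, ψ (x - y) * φ y) ξ = fourier ψ ξ * fourier φ ξ := by
  have hψ' : Summable fun x => ‖ψ x * char ξ x‖ := by simpa [norm_char] using hψ
  have hφ' : Summable fun x => ‖φ x * char ξ x‖ := by simpa [norm_char] using hφ
  change ∑' x, (∑' y, ψ (x - y) * φ y) * char ξ x = (∑' x, ψ x * char ξ x) * ∑' x, φ x * char ξ x
  rw [tsum_mul_tsum_of_summable_norm hψ' hφ', ← (subEquiv d).tsum_eq]
  have h1 : Summable fun p : Lattice d × Lattice d =>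
      (ψ p.1 * char ξ p.1) * (φ p.2 * char ξ p.2) := (hψ'.mul_norm hφ').of_norm
  have h2 : Summable fun p : Lattice d × Lattice d =>
      (ψ (p.1 - p.2) * char ξ (p.1 - p.2)) * (φ p.2 * char ξ p.2) := (subEquiv d).summable_iff.2 h1
  rw [show (∑' c, ψ ((subEquiv d) c).1 * char ξ ((subEquiv d) c).1 *
    (φ ((subEquiv d) c).2 * char ξ ((subEquiv d) c).2)) = ∑' p : Lattice d × Lattice d,
      (ψ (p.1 - p.2) * char ξ (p.1 - p.2)) * (φ p.2 * char ξ p.2) from rfl, h2.tsum_prod]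
  congr 1
  funext x
  rw [← tsum_mul_right]
  congr 1
  funext y
  have : char ξ x = char ξ (x - y) * char ξ y := by rw [← char_add, sub_add_cancel]
  rw [this]
  ring

theorem summable_norm_convPow {φ : Lattice d → ℂ} (hφ : Summable fun x => ‖φ x‖) (n : ℕ) :
    Summable fun x => ‖convPow φ n x‖ := by
  induction n with
  | zero =>
    refine summable_of_ne_finset_zero (s := {0}) fun x hx => ?_
    rw [Finset.mem_singleton] at hx
    simp [convPow, Pi.single_eq_of_ne hx]
  | succ n ih => exact summable_convolution ih hφ

theorem fourier_convPow {φ : Lattice d → ℂ} (hφ : Summable fun x => ‖φ x‖) (n : ℕ) (ξ : Space d) :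
    fourier (convPow φ n) ξ = fourier φ ξ ^ n := by
  induction n with
  | zero => rw [pow_zero]; exact fourier_single_zero ξ
  | succ n ih =>
    rw [pow_succ, ← ih]
    exact fourier_convolution (summable_norm_convPow hφ n) hφ ξ

/-- The cube `(a, a + 2π]^d`. -/
def box (d : ℕ) (a : ℝ) : Set (Space d) := {ξ | ∀ i, ξ i ∈ Set.Ioc a (a + 2 * Real.pi)}

theorem box_eq_preimage (d : ℕ) (a : ℝ) :
    box d a = (MeasurableEquiv.toLp 2 (Fin d → ℝ)).symm ⁻¹'
      Set.pi Set.univ fun _ => Set.Ioc a (a + 2 * Real.pi) := by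
  ext ξ
  simp [box, Set.mem_pi]

theorem measurableSet_box (d : ℕ) (a : ℝ) : MeasurableSet (box d a) := by
  rw [box_eq_preimage]
  exact (MeasurableEquiv.toLp 2 (Fin d → ℝ)).symm.measurable
    (MeasurableSet.univ_pi fun _ => measurableSet_Ioc)

theorem volume_box_lt_top (d : ℕ) (a : ℝ) : volume (box d a) < ⊤ := by
  rw [box_eq_preimage, (EuclideanSpace.volume_preserving_symm_measurableEquiv_toLp (Fin d)).measure_preimage
    (MeasurableSet.univ_pi fun _ => measurableSet_Ioc).nullMeasurableSet, Real.volume_pi_Ioc]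
  exact ENNReal.prod_lt_top fun _ _ => ENNReal.ofReal_lt_top

theorem integral_exp_int (a : ℝ) (m : ℤ) :
    ∫ t in Set.Ioc a (a + 2 * Real.pi), Complex.exp (Complex.I * (m : ℂ) * (t : ℂ))
      = if m = 0 then 2 * (Real.pi : ℂ) else 0 := by
  rw [← intervalIntegral.integral_of_le (by linarith [Real.pi_pos])]
  split_ifs with h
  · simp [h]
  · have hm : Complex.I * (m : ℂ) ≠ 0 := mul_ne_zero Complex.I_ne_zero (by exact_mod_cast h)
    rw [integral_exp_mul_complex hm]
    have : Complex.exp (Complex.I * m * ((a + 2 * Real.pi : ℝ) : ℂ)) = Complex.exp (Complex.I * m * a) := by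
      rw [show Complex.I * m * ((a + 2 * Real.pi : ℝ) : ℂ) = Complex.I * m * a
        + m * (2 * Real.pi * Complex.I) by push_cast; ring, Complex.exp_add,
        Complex.exp_int_mul_two_pi_mul_I, mul_one]
    rw [this, sub_self, zero_div]

theorem integral_box_char (a : ℝ) (x : Lattice d) :
    ∫ ξ in box d a, char ξ x = if x = 0 then (2 * (Real.pi : ℂ)) ^ d else 0 := by
  have h1 : ∫ ξ in box d a, char ξ x = ∫ y in Set.pi Set.univ fun _ : Fin d => Set.Ioc a (a + 2 * Real.pi),
      ∏ i, Complex.exp (Complex.I * (x i : ℂ) * (y i : ℂ)) := by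
    rw [box_eq_preimage, ← (EuclideanSpace.volume_preserving_symm_measurableEquiv_toLp (Fin d)).setIntegral_preimage_emb
      (MeasurableEquiv.measurableEmbedding _)]
    congr 1
    funext ξ
    unfold char
    rw [inner_toSpace, ← Complex.exp_sum]
    congr 1
    push_cast
    rw [Finset.mul_sum]
    exact Finset.sum_congr rfl fun i _ => by simp; ring
  rw [h1, volume_pi, Measure.restrict_pi_pi,
    integral_fintype_prod_eq_prod (f := fun i (t : ℝ) => Complex.exp (Complex.I * (x i : ℂ) * (t : ℂ)))]
  simp_rw [integral_exp_int]
  split_ifs with h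
  · simp [h]
  · obtain ⟨i, hi⟩ := Function.ne_iff.1 h
    exact Finset.prod_eq_zero (Finset.mem_univ i) (if_neg hi)

/-- Fourier inversion on `ℤ^d`. -/
theorem integral_box_fourier {ψ : Lattice d → ℂ} (hψ : Summable fun x => ‖ψ x‖) (a : ℝ) (x : Lattice d) :
    ∫ ξ in box d a, fourier ψ ξ * Complex.exp (-Complex.I * ((inner ℝ (toSpace x) ξ : ℝ) : ℂ))
      = (2 * (Real.pi : ℂ)) ^ d * ψ x := by
  have h1 : ∀ ξ, fourier ψ ξ * Complex.exp (-Complex.I * ((inner ℝ (toSpace x) ξ : ℝ) : ℂ))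
      = ∑' y, ψ y * char ξ (y - x) := by
    intro ξ
    unfold fourier
    rw [← tsum_mul_right]
    congr 1
    funext y
    have h2 : char ξ (y - x) * char ξ x = char ξ y := by rw [← char_add, sub_add_cancel]
    have h3 : char ξ x * Complex.exp (-Complex.I * ((inner ℝ (toSpace x) ξ : ℝ) : ℂ)) = 1 := by
      unfold char
      rw [← Complex.exp_add, neg_mul, add_neg_cancel, Complex.exp_zero]
    change ψ y * char ξ y * _ = _
    rw [← h2, mul_assoc, mul_assoc, h3, mul_one]
  simp_rw [h1]
  have hcont : ∀ z : Lattice d, Continuous fun ξ => char ξ z := fun z => by unfold char; fun_prop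
  have hfin := volume_box_lt_top d a
  have : IsFiniteMeasure (volume.restrict (box d a)) := ⟨by simpa using hfin⟩
  have hint : ∀ y, Integrable (fun ξ => ψ y * char ξ (y - x)) (volume.restrict (box d a)) := fun y =>
    Integrable.of_bound (by have := hcont (y - x); fun_prop) ‖ψ y‖
      (Eventually.of_forall fun ξ => by rw [norm_mul, norm_char, mul_one])
  rw [← integral_tsum_of_summable_integral_norm hint]
  · simp_rw [integral_const_mul, integral_box_char]
    rw [tsum_eq_single x]
    · simp [mul_comm]
    · intro y hy
      rw [if_neg (sub_ne_zero.2 hy), mul_zero]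
  · simp only [norm_mul, norm_char, mul_one, integral_const, smul_eq_mul]
    exact hψ.mul_left _

/-- The corner `a` of the cube stays free because points of `Ω(φ)` may lie on the faces of `(-π,
π]^d`; another cube will contain their translates in its interior. -/
theorem convPow_eq_integral {φ : Lattice d → ℂ} (hφ : Summable fun x => ‖φ x‖) (a : ℝ) (n : ℕ)
    (x : Lattice d) :
    convPow φ n x = (1 / (2 * (Real.pi : ℂ)) ^ d) *
      ∫ ξ in box d a, localIntegrand (fourier φ) n (toSpace x) ξ := by
  have h := integral_box_fourier (summable_norm_convPow hφ n) a x
  simp_rw [fourier_convPow hφ] at h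
  have hpi : (2 * (Real.pi : ℂ)) ^ d ≠ 0 := by
    refine pow_ne_zero _ (mul_ne_zero two_ne_zero ?_)
    exact_mod_cast Real.pi_ne_zero
  unfold localIntegrand
  rw [h, ← mul_assoc, one_div_mul_cancel hpi, one_mul]
end
end LLT

/-! ### Local contributions of the points of `Ω(φ)` -/

namespace LLT
noncomputable section
variable {d : ℕ}

theorem Expansion.continuous_Q (D : Expansion d) : Continuous D.Q := by
  unfold Expansion.Q
  exact (MvPolynomial.continuous_eval D.polyQ).comp (by fun_prop)

/-- The two types are mutually exclusive. -/
theorem Expansion.not_isPositiveType_of_isImaginaryType (hd : 0 < d) {D : Expansion d}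
    {φ : Lattice d → ℂ} {ξ₀ : Space d} (hI : D.IsImaginaryType φ ξ₀) : ¬ D.IsPositiveType φ ξ₀ := by
  rintro ⟨hR, E, hER, hEQ, hs, -⟩
  obtain ⟨hN, -, E', hE', k, hk, hE'R, -⟩ := hI
  obtain ⟨C, hC⟩ := hR.isCompact_level.exists_bound_of_continuousOn D.continuous_Q.continuousOn
  -- Positive type makes `Q` and `R` scale alike, so `|Q|` is at most a multiple of `R`; imaginary
  -- type bounds `R` by a multiple of `|Q|^k`. Together `|Q| ≤ B |Q|^k`, although `|Q|` takes
  -- arbitrarily small positive values and `k > 1`.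
  have h1 : ∀ ξ, |D.Q ξ| ≤ max C 1 * D.R ξ := by
    intro ξ
    by_cases h0 : ξ = 0
    · rw [h0, hR.apply_zero, hN.apply_zero, mul_zero]
    · have hp := hR.pos h0
      obtain ⟨η, hη, e⟩ := exists_eq_tpow hER hp
      have h2 : D.Q ξ = D.R ξ * D.Q η := by
        conv_lhs => rw [e]
        exact hEQ _ hp η
      rw [h2, abs_mul, abs_of_pos hp, mul_comm]
      gcongr
      exact (hC η hη).trans (le_max_left _ _)
  obtain ⟨C', hC', h2⟩ := exists_le_rpow hN hE' hR hk hE'R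
  set B := max C 1 * C'
  have hB : 0 < B := by positivity
  obtain ⟨η, hη⟩ : ∃ η : Space d, η ≠ 0 := by
    refine ⟨EuclideanSpace.single ⟨0, hd⟩ 1, fun h => ?_⟩
    have := congrArg norm h
    simp at this
  have hq : 0 < |D.Q η| := hN.pos hη
  have h3 : ∀ u : ℝ, 0 < u → u ≤ B * u ^ k := by
    intro u hu
    have hs : 0 < u / |D.Q η| := div_pos hu hq
    have e : |D.Q (tpow (u / |D.Q η|) E' η)| = u := by
      have := hE' _ hs η
      simp only [div_mul_cancel₀ _ hq.ne'] at this
      exact this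
    have h4 := h1 (tpow (u / |D.Q η|) E' η)
    have h5 := h2 (tpow (u / |D.Q η|) E' η)
    rw [e] at h4 h5
    calc u ≤ max C 1 * D.R (tpow (u / |D.Q η|) E' η) := h4
      _ ≤ max C 1 * (C' * u ^ k) := by gcongr
      _ = B * u ^ k := by ring
  have h4 : Tendsto (fun n : ℕ => B * (n : ℝ) ^ (-(k - 1))) atTop (𝓝 (B * 0)) :=
    ((tendsto_rpow_neg_atTop (by linarith)).comp tendsto_natCast_atTop_atTop).const_mul _
  rw [mul_zero] at h4
  obtain ⟨n, hn, hn1⟩ := ((h4.eventually_lt_const one_pos).and (eventually_ge_atTop 1)).exists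
  have hn0 : (0 : ℝ) < n := by exact_mod_cast hn1
  have h5 := h3 (n : ℝ)⁻¹ (inv_pos.2 hn0)
  rw [Real.inv_rpow hn0.le, inv_le_iff_one_le_mul₀ hn0] at h5
  rw [neg_sub, Real.rpow_sub hn0, Real.rpow_one] at hn
  have : B * ((n : ℝ) ^ k)⁻¹ * n = B * (n / (n : ℝ) ^ k) := by field_simp
  linarith

theorem Expansion.order_of_isPositiveType {D : Expansion d} {φ : Lattice d → ℂ} {ξ₀ : Space d}
    (h : D.IsPositiveType φ ξ₀) : D.order φ ξ₀ = homOrder D.R := if_pos h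

theorem Expansion.order_of_isImaginaryType (hd : 0 < d) {D : Expansion d} {φ : Lattice d → ℂ}
    {ξ₀ : Space d} (h : D.IsImaginaryType φ ξ₀) : D.order φ ξ₀ = homOrder fun ξ => |D.Q ξ| :=
  if_neg (Expansion.not_isPositiveType_of_isImaginaryType hd h)

theorem norm_phase {φ : Lattice d → ℂ} {ξ₀ : Space d} (h : ‖fourier φ ξ₀‖ = 1) (n : ℕ)
    (x : Lattice d) : ‖phase φ n x ξ₀‖ = 1 := by
  unfold phase
  rw [norm_mul, norm_pow, h, one_pow, one_mul, norm_exp_neg_I_mul]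

/-- `φ̂(ξ + ξ₀) / φ̂(ξ₀)` with the drift removed. -/
def centered (φ : Lattice d → ℂ) (D : Expansion d) (ξ₀ ξ : Space d) : ℂ :=
  fourier φ (ξ + ξ₀) / fourier φ ξ₀ * Complex.exp (-Complex.I * ((inner ℝ D.drift ξ : ℝ) : ℂ))

theorem continuous_centered {φ : Lattice d → ℂ} (hφ : Summable fun x => ‖φ x‖) (D : Expansion d)
    (ξ₀ : Space d) : Continuous (centered φ D ξ₀) := by
  unfold centered
  have h1 : Continuous fun ξ => fourier φ (ξ + ξ₀) :=
    (continuous_fourier hφ).comp (continuous_id.add continuous_const)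
  exact (h1.div_const _).mul (by fun_prop)

/-- Only `exp (log z) = z` for `z ≠ 0` is used, so the branch of the logarithm plays no role here.
-/
theorem eventually_centered_eq {φ : Lattice d → ℂ} (hφ : Summable fun x => ‖φ x‖) (D : Expansion d)
    {ξ₀ : Space d} (h : ‖fourier φ ξ₀‖ = 1) :
    ∀ᶠ ξ in 𝓝 0, centered φ D ξ₀ ξ = Complex.exp (-((D.R ξ + D.remR φ ξ₀ ξ : ℝ) : ℂ)
      - Complex.I * ((D.Q ξ + D.remQ φ ξ₀ ξ : ℝ) : ℂ)) := by
  have hne : fourier φ ξ₀ ≠ 0 := fun h0 => by rw [h0, norm_zero] at h; exact zero_ne_one h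
  have h1 : Continuous fun ξ => fourier φ (ξ + ξ₀) :=
    (continuous_fourier hφ).comp (continuous_id.add continuous_const)
  have h2 : ∀ᶠ ξ in 𝓝 (0 : Space d), fourier φ (ξ + ξ₀) ≠ 0 :=
    h1.continuousAt.eventually_ne (by rwa [zero_add])
  filter_upwards [h2] with ξ hξ
  have h3 : Complex.exp (Gamma φ ξ₀ ξ) = fourier φ (ξ + ξ₀) / fourier φ ξ₀ :=
    Complex.exp_log (div_ne_zero hξ hne)
  unfold centered
  rw [← h3, D.Gamma_eq, ← Complex.exp_add]
  congr 1
  push_cast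
  ring

/-- The `n`-th power of the drift factor `e^{i α·ξ}` merges with `e^{-i x·ξ}` into `e^{-i (x - n
α)·ξ}`. -/
theorem localIntegrand_fourier {φ : Lattice d → ℂ} (D : Expansion d) {ξ₀ : Space d}
    (h : ‖fourier φ ξ₀‖ = 1) (n : ℕ) (x : Lattice d) (ξ : Space d) :
    localIntegrand (fourier φ) n (toSpace x) (ξ + ξ₀)
      = phase φ n x ξ₀ * localIntegrand (centered φ D ξ₀) n (toSpace x - (n : ℝ) • D.drift) ξ := by
  have hne : fourier φ ξ₀ ≠ 0 := fun h0 => by rw [h0, norm_zero] at h; exact zero_ne_one h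
  unfold localIntegrand phase centered
  rw [mul_pow, div_pow, ← Complex.exp_nat_mul, inner_add_right, inner_sub_left, inner_smul_left]
  have e : Complex.exp (-Complex.I * ((inner ℝ (toSpace x) ξ + inner ℝ (toSpace x) ξ₀ : ℝ) : ℂ))
      = Complex.exp (-Complex.I * ((inner ℝ (toSpace x) ξ₀ : ℝ) : ℂ))
        * (Complex.exp (n * (-Complex.I * ((inner ℝ D.drift ξ : ℝ) : ℂ)))
        * Complex.exp (-Complex.I * ((inner ℝ (toSpace x) ξ
          - (starRingEnd ℝ) (n : ℝ) * inner ℝ D.drift ξ : ℝ) : ℂ))) := by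
    rw [← Complex.exp_add, ← Complex.exp_add]
    congr 1
    simp only [conj_trivial]
    push_cast
    ring
  rw [e]
  field_simp

/-- The local contribution of `ξ₀` to `φ^{(n)}(x)` is `φ̂(ξ₀)^n e^{-i x·ξ₀} h_n(x)` up to
`o(n^{-μ})`, uniformly for `x ∈ X_n`, and `h_n = O(n^{-μ})`. -/
def LocalApprox (φ : Lattice d → ℂ) (ξ₀ : Space d) (X : ℕ → Set (Lattice d))
    (h : ℕ → Lattice d → ℂ) (μ : ℝ) : Prop :=
  (∀ U ∈ 𝓝 (0 : Space d), ∃ V ⊆ U, IsOpen V ∧ 0 ∈ V ∧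
    EqUpToLittleO (fun n x => (1 / (2 * (Real.pi : ℂ)) ^ d) *
      ∫ ξ in V, localIntegrand (fourier φ) n (toSpace x) (ξ + ξ₀))
      (fun n x => phase φ n x ξ₀ * h n x) μ X) ∧
  ∃ (C : ℝ) (N : ℕ), 0 < C ∧ ∀ n, N ≤ n → ∀ x ∈ X n, ‖h n x‖ ≤ C * (n : ℝ) ^ (-μ)

theorem norm_inv_two_pi_pow_le : ‖(1 / (2 * (Real.pi : ℂ)) ^ d)‖ ≤ 1 := by
  rw [norm_div, norm_one, norm_pow, norm_mul, Complex.norm_real, Complex.norm_ofNat,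
    Real.norm_of_nonneg Real.pi_pos.le]
  exact div_le_one_of_le₀ (one_le_pow₀ (by linarith [Real.pi_gt_three])) (by positivity)

/-- The norm of a local error, reduced to the centered integrals. -/
theorem norm_local_error_le {φ : Lattice d → ℂ} (D : Expansion d) {ξ₀ : Space d}
    (h : ‖fourier φ ξ₀‖ = 1) (n : ℕ) (x : Lattice d) (V : Set (Space d)) (z : ℂ) :
    ‖(1 / (2 * (Real.pi : ℂ)) ^ d) * (∫ ξ in V, localIntegrand (fourier φ) n (toSpace x) (ξ + ξ₀))
      - phase φ n x ξ₀ * ((1 / (2 * (Real.pi : ℂ)) ^ d) * z)‖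
      ≤ ‖(∫ ξ in V, localIntegrand (centered φ D ξ₀) n (toSpace x - (n : ℝ) • D.drift) ξ) - z‖ := by
  simp_rw [localIntegrand_fourier D h, integral_const_mul]
  set J := ∫ ξ in V, localIntegrand (centered φ D ξ₀) n (toSpace x - (n : ℝ) • D.drift) ξ
  set c : ℂ := 1 / (2 * (Real.pi : ℂ)) ^ d
  have e : c * (phase φ n x ξ₀ * J) - phase φ n x ξ₀ * (c * z) = c * (phase φ n x ξ₀ * (J - z)) := by
    ring
  rw [e, norm_mul, norm_mul, norm_phase h, one_mul]
  exact mul_le_of_le_one_left (norm_nonneg _) norm_inv_two_pi_pow_le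

theorem localApprox_positive {φ : Lattice d → ℂ} (hφ : Summable fun x => ‖φ x‖) {D : Expansion d}
    {ξ₀ : Space d} (h : ‖fourier φ ξ₀‖ = 1) (hD : D.IsPositiveType φ ξ₀) (X : ℕ → Set (Lattice d)) :
    LocalApprox φ ξ₀ X (fun n x => attractorP D.R D.Q n (toSpace x - (n : ℝ) • D.drift))
      (D.order φ ξ₀) := by
  have hord := Expansion.order_of_isPositiveType hD
  obtain ⟨hR, E, hE, hEQ, hfR, hfQ⟩ := hD
  have hc := hfR.1
  rw [hord, hR.homOrder_eq hE hc]
  constructor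
  · intro U hU
    obtain ⟨δ₀, hδ₀, hloc⟩ := local_limit_positive D.continuous_Q hR hE hEQ hfR hfQ
      (continuous_centered hφ D ξ₀) (eventually_centered_eq hφ D h)
    obtain ⟨δ₁, hδ₁, hU⟩ := hR.exists_lt_subset hE hc hU
    refine ⟨{ξ | D.R ξ < min δ₀ δ₁}, fun ξ (hξ : D.R ξ < _) =>
        hU (show D.R ξ < δ₁ from hξ.trans_le (min_le_right _ _)),
      hR.isOpen_lt _, mem_of_mem_nhds (hR.lt_mem_nhds (by positivity)), fun ε hε => ?_⟩
    obtain ⟨N, hN⟩ := hloc (min δ₀ δ₁) (by positivity) (min_le_left _ _) ε hε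
    exact ⟨N, fun n _ hn x _ => (norm_local_error_le D h n x _ _).trans (hN n hn _)⟩
  · refine ⟨(∫ ξ, Real.exp (-(1 * D.R ξ))) + 1, 1, ?_, fun n hn x _ => ?_⟩
    · have : 0 ≤ ∫ ξ, Real.exp (-(1 * D.R ξ)) := integral_nonneg fun _ => (Real.exp_pos _).le
      positivity
    · have hn0 : (0 : ℝ) < n := by exact_mod_cast hn
      unfold attractorP
      rw [norm_mul]
      refine (mul_le_of_le_one_left (norm_nonneg _) norm_inv_two_pi_pow_le).trans ?_
      refine (norm_integral_integrandP_le hE hn0 _).trans ?_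
      gcongr
      linarith

/-- In contrast to positive type, where the sets `X n` are arbitrary, `x` has to stay within a fixed
distance of `n α`, so that oscillation of `n Q` beats the linear phase. -/
theorem localApprox_imaginary (hd : 0 < d) {φ : Lattice d → ℂ} (hφ : Summable fun x => ‖φ x‖)
    {D : Expansion d} {ξ₀ : Space d} (h : ‖fourier φ ξ₀‖ = 1) (hD : D.IsImaginaryType φ ξ₀)
    (hμ : D.order φ ξ₀ < 1) (r : ℝ) :
    LocalApprox φ ξ₀ (fun n => {x | ‖toSpace x - (n : ℝ) • D.drift‖ ≤ r})
      (fun n x => attractorI D.Q n (toSpace x - (n : ℝ) • D.drift)) (D.order φ ξ₀) := by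
  have hord := Expansion.order_of_isImaginaryType hd hD
  obtain ⟨hN, hR, E, hE, k, hk, hER, hfQ, hfR⟩ := hD
  have hc := hfQ.1
  rw [hord, hN.homOrder_eq hE hc] at hμ ⊢
  have hQ := D.continuous_Q
  constructor
  · intro U hU
    obtain ⟨δ₀, hδ₀, hloc⟩ := local_limit_imaginary hQ hN hE hc hμ hR hk hER hfQ hfR
      (continuous_centered hφ D ξ₀) (eventually_centered_eq hφ D h)
    obtain ⟨δ₁, hδ₁, hU⟩ := hN.exists_lt_subset hE hc hU
    refine ⟨{ξ | |D.Q ξ| < min δ₀ δ₁}, fun ξ (hξ : |D.Q ξ| < _) =>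
        hU (show |D.Q ξ| < δ₁ from hξ.trans_le (min_le_right _ _)),
      hN.isOpen_lt _, mem_of_mem_nhds (hN.lt_mem_nhds (by positivity)), fun ε hε => ?_⟩
    obtain ⟨N, hN⟩ := hloc (min δ₀ δ₁) (by positivity) (min_le_left _ _) r ε hε
    exact ⟨N, fun n _ hn x hx => (norm_local_error_le D h n x _ _).trans (hN n hn _ hx)⟩
  · obtain ⟨C, N, hC, hCN⟩ := exists_norm_limUnder_le hQ hN hE hc hμ r
    refine ⟨C, N, hC, fun n hn x hx => ?_⟩
    unfold attractorI
    rw [norm_mul]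
    exact (mul_le_of_le_one_left (norm_nonneg _) norm_inv_two_pi_pow_le).trans (hCN n hn _ hx)

/-- Points of either type are isolated in `{|φ̂| = 1}`. -/
theorem eventually_eq_zero_of_norm_eq_one {φ : Lattice d → ℂ} (hφ : Summable fun x => ‖φ x‖)
    {D : Expansion d} {ξ₀ : Space d} (h : ‖fourier φ ξ₀‖ = 1)
    (hD : D.IsPositiveType φ ξ₀ ∨ D.IsImaginaryType φ ξ₀) :
    ∀ᶠ ξ in 𝓝 (0 : Space d), ‖fourier φ (ξ + ξ₀)‖ = 1 → ξ = 0 := by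
  obtain ⟨hR, E, hE, hf⟩ : IsPositiveHomogeneous D.R ∧ ∃ E, E ∈ exponentSet D.R ∧
      IsSubhomogeneous (D.remR φ ξ₀) E := by
    rcases hD with ⟨hR, E, hE, -, hf, -⟩ | ⟨-, hR, E, -, k, -, hE, -, hf⟩
    · exact ⟨hR, E, hE, hf⟩
    · exact ⟨hR, _, hE, hf.isSubhomogeneous⟩
  -- With `|R̃| ≤ R / 2` the modulus `e^{-(R + R̃)}` is below `1` except at `ξ = 0`.
  obtain ⟨τ, hτ, hle⟩ := hf.exists_le hR hE (ε := 1 / 2) (by norm_num)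
  filter_upwards [eventually_centered_eq hφ D h, hR.lt_mem_nhds hτ] with ξ h1 h2 h3
  by_contra h0
  have h4 : ‖centered φ D ξ₀ ξ‖ = 1 := by
    unfold centered
    rw [norm_mul, norm_div, h3, h, norm_exp_neg_I_mul, div_one, one_mul]
  rw [h1, Complex.norm_exp, Real.exp_eq_one_iff] at h4
  have h5 := (abs_le.1 (hle ξ h2)).1
  have h6 := hR.pos h0
  have h7 : D.R ξ + D.remR φ ξ₀ ξ = 0 := by
    simp only [Complex.sub_re, Complex.neg_re, Complex.ofReal_re, Complex.mul_re, Complex.I_re,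
          Complex.I_im, Complex.ofReal_im] at h4
    linarith
  linarith
end
end LLT

/-! ### Finiteness of `Ω(φ)` and calculus of uniform error terms -/

namespace LLT
noncomputable section
variable {d : ℕ}

theorem shift_apply (k : Lattice d) (i : Fin d) : shift k i = 2 * Real.pi * k i := by
  simp [shift, toSpace]

theorem exists_add_shift_mem_box (a : ℝ) (ξ : Space d) : ∃ k : Lattice d, ξ + shift k ∈ box d a := by
  have hp : 0 < 2 * Real.pi := Real.two_pi_pos
  refine ⟨fun i => -toIocDiv hp a (ξ i), fun i => ?_⟩
  have h := sub_toIocDiv_zsmul_mem_Ioc hp a (ξ i)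
  have e : (ξ + shift fun i => -toIocDiv hp a (ξ i)) i = ξ i - toIocDiv hp a (ξ i) • (2 * Real.pi) := by
    rw [PiLp.add_apply, shift_apply, zsmul_eq_mul]
    push_cast
    ring
  rw [e]
  exact h

theorem shift_eq_zero_of_mem_box {a : ℝ} {ξ : Space d} {k : Lattice d} (h1 : ξ ∈ box d a)
    (h2 : ξ + shift k ∈ box d a) : k = 0 := by
  funext i
  have e1 := h1 i
  have e2 := h2 i
  rw [PiLp.add_apply, shift_apply] at e2
  have hp := Real.pi_pos
  have l1 : (k i : ℝ) < 1 := by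
    by_contra hcon
    have : 1 ≤ (k i : ℝ) := not_lt.1 hcon
    nlinarith [e1.1, e2.2]
  have l2 : (-1 : ℝ) < k i := by
    by_contra hcon
    have : (k i : ℝ) ≤ -1 := not_lt.1 hcon
    nlinarith [e1.2, e2.1]
  have l1' : k i < 1 := by exact_mod_cast l1
  have l2' : -1 < k i := by exact_mod_cast l2
  simp only [Pi.zero_apply]
  omega

theorem shift_zero : shift (0 : Lattice d) = 0 := by
  ext i; simp [shift_apply]

theorem mem_Omega_iff {φ : Lattice d → ℂ} {ξ : Space d} :
    ξ ∈ Omega φ ↔ ξ ∈ box d (-Real.pi) ∧ ‖fourier φ ξ‖ = 1 := by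
  have : -Real.pi + 2 * Real.pi = Real.pi := by ring
  simp [Omega, box, this]

theorem isCompact_pi_Icc (d : ℕ) (a b : ℝ) : IsCompact {ξ : Space d | ∀ i, ξ i ∈ Set.Icc a b} := by
  have h1 : IsCompact (Set.pi Set.univ fun _ : Fin d => Set.Icc a b) :=
    isCompact_univ_pi fun _ => isCompact_Icc
  have h2 := h1.image (PiLp.continuous_toLp 2 fun _ : Fin d => ℝ)
  convert h2 using 1
  ext ξ
  constructor
  · intro h
    exact ⟨WithLp.ofLp ξ, fun i _ => h i, rfl⟩
  · rintro ⟨y, hy, rfl⟩ i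
    exact hy i trivial

/-- An infinite `Ω(φ)` would accumulate in the closed cube, but points with `|φ̂| = 1` are isolated.
-/
theorem finite_Omega {φ : Lattice d → ℂ} (hφ : Summable fun x => ‖φ x‖) {D : Space d → Expansion d}
    (hD : ∀ ξ ∈ Omega φ, (D ξ).IsPositiveType φ ξ ∨ (D ξ).IsImaginaryType φ ξ) :
    (Omega φ).Finite := by
  by_contra hinf
  have hK := isCompact_pi_Icc d (-Real.pi) Real.pi
  obtain ⟨z, -, hz⟩ := Set.Infinite.exists_accPt_of_subset_isCompact hinf hK
    fun ξ hξ i => Set.Ioc_subset_Icc_self (hξ.1 i)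
  have hclosed : IsClosed {ξ | ‖fourier φ ξ‖ = 1} :=
    isClosed_eq (continuous_fourier hφ).norm continuous_const
  have hz1 : ‖fourier φ z‖ = 1 := by
    have h1 : AccPt z (𝓟 {ξ | ‖fourier φ ξ‖ = 1}) := hz.mono (principal_mono.2 fun ξ hξ => hξ.2)
    exact hclosed.closure_subset h1.clusterPt.mem_closure
  -- The accumulation point may lie on a face outside `(-π, π]^d`; periodicity moves it into `Ω(φ)`,
  -- where its type is known.
  obtain ⟨k, hk⟩ := exists_add_shift_mem_box (-Real.pi) z
  have hzk : z + shift k ∈ Omega φ := mem_Omega_iff.2 ⟨hk, by rw [fourier_add_shift]; exact hz1⟩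
  have hiso := eventually_eq_zero_of_norm_eq_one hφ hzk.2 (hD _ hzk)
  have ht : Tendsto (fun ξ : Space d => ξ - z) (𝓝 z) (𝓝 0) := by
    have : Continuous fun ξ : Space d => ξ - z := by fun_prop
    simpa using this.tendsto z
  obtain ⟨ξ, ⟨h1, h2⟩, h3⟩ := (accPt_iff_nhds.1 hz _ (ht.eventually hiso))
  have h4 : ‖fourier φ (ξ - z + (z + shift k))‖ = 1 := by
    rw [← add_assoc, sub_add_cancel, fourier_add_shift]; exact h2.2
  exact h3 (sub_eq_zero.1 (h1 h4))

section LittleO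
variable {f g f' g' : ℕ → Lattice d → ℂ} {μ : ℝ} {X : ℕ → Set (Lattice d)}

theorem EqUpToLittleO.add (h : EqUpToLittleO f g μ X) (h' : EqUpToLittleO f' g' μ X) :
    EqUpToLittleO (fun n x => f n x + f' n x) (fun n x => g n x + g' n x) μ X := by
  intro ε hε
  obtain ⟨N, hN⟩ := h (ε / 2) (half_pos hε)
  obtain ⟨N', hN'⟩ := h' (ε / 2) (half_pos hε)
  refine ⟨max N N', fun n hn1 hn x hx => ?_⟩
  have e1 := hN n hn1 ((le_max_left _ _).trans hn) x hx
  have e2 := hN' n hn1 ((le_max_right _ _).trans hn) x hx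
  calc _ = ‖(f n x - g n x) + (f' n x - g' n x)‖ := by congr 1; ring
    _ ≤ _ := norm_add_le _ _
    _ ≤ ε / 2 * (n : ℝ) ^ (-μ) + ε / 2 * (n : ℝ) ^ (-μ) := add_le_add e1 e2
    _ = _ := by ring

theorem EqUpToLittleO.refl (f : ℕ → Lattice d → ℂ) (μ : ℝ) (X : ℕ → Set (Lattice d)) :
    EqUpToLittleO f f μ X := fun ε hε => ⟨0, fun n _ _ x _ => by
  rw [sub_self, norm_zero]; positivity⟩

theorem EqUpToLittleO.trans (h : EqUpToLittleO f g μ X) (h' : EqUpToLittleO g g' μ X) :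
    EqUpToLittleO f g' μ X := by
  intro ε hε
  obtain ⟨N, hN⟩ := h (ε / 2) (half_pos hε)
  obtain ⟨N', hN'⟩ := h' (ε / 2) (half_pos hε)
  refine ⟨max N N', fun n hn1 hn x hx => ?_⟩
  have e1 := hN n hn1 ((le_max_left _ _).trans hn) x hx
  have e2 := hN' n hn1 ((le_max_right _ _).trans hn) x hx
  calc _ ≤ ‖f n x - g n x‖ + ‖g n x - g' n x‖ := norm_sub_le_norm_sub_add_norm_sub _ _ _
    _ ≤ ε / 2 * (n : ℝ) ^ (-μ) + ε / 2 * (n : ℝ) ^ (-μ) := add_le_add e1 e2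
    _ = _ := by ring

theorem EqUpToLittleO.sum {ι : Type*} {f g : ι → ℕ → Lattice d → ℂ} {s : Finset ι}
    (h : ∀ i ∈ s, EqUpToLittleO (f i) (g i) μ X) :
    EqUpToLittleO (fun n x => ∑ i ∈ s, f i n x) (fun n x => ∑ i ∈ s, g i n x) μ X := by
  classical
  induction s using Finset.induction_on with
  | empty => simpa using EqUpToLittleO.refl (fun _ _ => 0) μ X
  | insert i s hi ih =>
    simp_rw [Finset.sum_insert hi]
    exact (h i (Finset.mem_insert_self i s)).add (ih fun j hj => h j (Finset.mem_insert_of_mem hj))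

theorem EqUpToLittleO.mono_order {ν : ℝ} (h : EqUpToLittleO f g ν X) (hμ : μ ≤ ν) :
    EqUpToLittleO f g μ X := by
  intro ε hε
  obtain ⟨N, hN⟩ := h ε hε
  refine ⟨N, fun n hn1 hn x hx => (hN n hn1 hn x hx).trans ?_⟩
  have : (1 : ℝ) ≤ n := by exact_mod_cast hn1
  gcongr

theorem EqUpToLittleO.congr_left (h : EqUpToLittleO f g μ X) (hf : ∀ n x, f' n x = f n x) :
    EqUpToLittleO f' g μ X := by
  have : f' = f := funext fun n => funext fun x => hf n x
  rwa [this]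

theorem eqUpToLittleO_zero_of_bound {ν C : ℝ} {N : ℕ} (hμ : μ < ν)
    (h : ∀ n, N ≤ n → ∀ x ∈ X n, ‖f n x‖ ≤ C * (n : ℝ) ^ (-ν)) :
    EqUpToLittleO f (fun _ _ => 0) μ X := by
  intro ε hε
  have ht : Tendsto (fun n : ℕ => C * (n : ℝ) ^ (-(ν - μ))) atTop (𝓝 (C * 0)) :=
    ((tendsto_rpow_neg_atTop (by linarith)).comp tendsto_natCast_atTop_atTop).const_mul _
  rw [mul_zero] at ht
  obtain ⟨N', hN'⟩ := eventually_atTop.1 (ht.eventually_lt_const hε)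
  refine ⟨max N N', fun n hn1 hn x hx => ?_⟩
  have hn0 : (0 : ℝ) < n := by exact_mod_cast hn1
  rw [sub_zero]
  refine (h n ((le_max_left _ _).trans hn) x hx).trans ?_
  calc C * (n : ℝ) ^ (-ν) = C * (n : ℝ) ^ (-(ν - μ)) * (n : ℝ) ^ (-μ) := by
        rw [mul_assoc, ← Real.rpow_add hn0]; ring_nf
    _ ≤ _ := by
        gcongr
        exact (hN' n ((le_max_right _ _).trans hn)).le

theorem eqUpToLittleO_zero_of_geometric {C ρ : ℝ} (hρ0 : 0 ≤ ρ) (hρ : ρ < 1)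
    (h : ∀ n, ∀ x ∈ X n, ‖f n x‖ ≤ C * ρ ^ n) : EqUpToLittleO f (fun _ _ => 0) μ X := by
  obtain ⟨m, hm⟩ := exists_nat_gt μ
  have ht := tendsto_pow_const_mul_const_pow_of_abs_lt_one m (r := ρ) (by rwa [abs_of_nonneg hρ0])
  obtain ⟨N, hN⟩ := eventually_atTop.1 (ht.eventually_lt_const one_pos)
  refine eqUpToLittleO_zero_of_bound (ν := m) (C := |C|) (N := max N 1) hm fun n hn x hx => ?_
  have hn0 : (0 : ℝ) < n := by exact_mod_cast (le_max_right N 1).trans hn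
  refine (h n x hx).trans ?_
  have h1 := hN n ((le_max_left _ _).trans hn)
  rw [Real.rpow_neg hn0.le, Real.rpow_natCast]
  calc C * ρ ^ n ≤ |C| * ρ ^ n := by gcongr; exact le_abs_self C
    _ ≤ |C| * ((n : ℝ) ^ m)⁻¹ := by
      gcongr
      rw [← one_div, le_div_iff₀ (by positivity), mul_comm]
      exact h1.le
end LittleO

/-- A sequence of balls growing slowly enough turns uniformity on balls of fixed radius into
uniformity on growing compact sets. -/
theorem eqOnGrowingCompacts_of_forall_radius {f g : ℕ → Lattice d → ℂ} {μ : ℝ} {α : Space d}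
    (h : ∀ r : ℝ, EqUpToLittleO f g μ fun n => {x | ‖toSpace x - (n : ℝ) • α‖ ≤ r}) :
    EqOnGrowingCompacts f g μ α := by
  intro K hK
  obtain ⟨r, hr⟩ := hK.isBounded.exists_norm_le
  have h' : ∀ m : ℕ, ∃ N : ℕ, ∀ n : ℕ, 1 ≤ n → N ≤ n → ∀ x : Lattice d,
      ‖toSpace x - (n : ℝ) • α‖ ≤ r + m → ‖f n x - g n x‖ ≤ (1 / ((m : ℝ) + 1)) * (n : ℝ) ^ (-μ) :=
    fun m => h (r + m) (1 / ((m : ℝ) + 1)) (by positivity)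
  choose N hN using h'
  -- The largest `j ≤ n` whose threshold `N j` has been passed by step `n`; it tends to infinity. If
  -- there is none, the value is the default `0`, which only affects finitely many `n`.
  let m : ℕ → ℕ := fun n => Nat.findGreatest (fun j => N j ≤ n) n
  have hmono : Monotone m := fun a b hab =>
    Nat.findGreatest_mono (fun j (hj : N j ≤ a) => hj.trans hab) hab
  have hlarge : ∀ j n, max j (N j) ≤ n → j ≤ m n ∧ N (m n) ≤ n := fun j n hn =>
    ⟨Nat.le_findGreatest ((le_max_left _ _).trans hn) ((le_max_right _ _).trans hn),
      Nat.findGreatest_spec (P := fun j => N j ≤ n) ((le_max_left j (N j)).trans hn)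
        ((le_max_right _ _).trans hn)⟩
  refine ⟨fun n => Metric.closedBall 0 (r + m n), ?_, fun n => isCompact_closedBall _ _, ?_, ?_, ?_⟩
  · intro a b hab
    refine Metric.closedBall_subset_closedBall ?_
    have : (m a : ℝ) ≤ m b := by exact_mod_cast hmono hab
    linarith
  · intro n y hy
    rw [mem_closedBall_zero_iff]
    exact (hr y hy).trans (le_add_of_nonneg_right (Nat.cast_nonneg _))
  · refine Set.eq_univ_of_forall fun y => ?_
    obtain ⟨j, hj⟩ := exists_nat_ge (‖y‖ - r)
    refine Set.mem_iUnion.2 ⟨max j (N j), ?_⟩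
    rw [mem_closedBall_zero_iff]
    have : (j : ℝ) ≤ m (max j (N j)) := by exact_mod_cast (hlarge j _ le_rfl).1
    linarith
  · intro ε hε
    obtain ⟨j, hj⟩ := exists_nat_one_div_lt hε
    refine ⟨max j (N j), fun n hn1 hn x hx => ?_⟩
    obtain ⟨h1, h2⟩ := hlarge j n hn
    obtain ⟨y, hy, hxy⟩ := hx
    have hnorm : ‖toSpace x - (n : ℝ) • α‖ ≤ r + m n := by
      rw [← hxy]
      simpa using hy
    refine (hN (m n) n hn1 h2 x hnorm).trans ?_
    gcongr
    refine le_trans ?_ hj.le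
    gcongr

theorem setIntegral_add_right_eq {F : Space d → ℂ} (V : Set (Space d)) (v : Space d) :
    ∫ z in {z | z - v ∈ V}, F z = ∫ ξ in V, F (ξ + v) := by
  have h := (measurePreserving_add_right (volume : Measure (Space d)) v).setIntegral_preimage_emb
    (measurableEmbedding_addRight v) F {z | z - v ∈ V}
  rw [← h]
  congr 2
  ext ξ
  simp

theorem localIntegrand_add_shift (φ : Lattice d → ℂ) (n : ℕ) (x : Lattice d) (ξ : Space d)
    (k : Lattice d) : localIntegrand (fourier φ) n (toSpace x) (ξ + shift k)
      = localIntegrand (fourier φ) n (toSpace x) ξ := by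
  unfold localIntegrand
  rw [fourier_add_shift, inner_add_right, Complex.ofReal_add, mul_add, Complex.exp_add,
    exp_neg_inner_shift, mul_one]
end
end LLT

/-! ### Assembling the local contributions -/

namespace LLT
noncomputable section
variable {d : ℕ}

/-- A cube whose boundary avoids all translates of the points of `Ω(φ)`. -/
theorem exists_box_avoiding {s : Set (Space d)} (hs : s.Finite) :
    ∃ a : ℝ, ∀ ξ ∈ s, ∀ (k : Lattice d) (i : Fin d), (ξ + shift k) i ≠ a ∧
      (ξ + shift k) i ≠ a + 2 * Real.pi := by
  -- Only countably many corners `a` are bad, namely the coordinates of points of `s` modulo `2π`.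
  have hcount : (⋃ ξ ∈ s, ⋃ i : Fin d, Set.range fun m : ℤ => ξ i + 2 * Real.pi * m).Countable :=
    hs.countable.biUnion fun ξ _ => Set.countable_iUnion fun i => Set.countable_range _
  obtain ⟨a, ha⟩ := (hcount.dense_compl ℝ).nonempty
  refine ⟨a, fun ξ hξ k i => ⟨fun h => ha ?_, fun h => ha ?_⟩⟩
  · refine Set.mem_biUnion hξ (Set.mem_iUnion.2 ⟨i, k i, ?_⟩)
    rw [← h, PiLp.add_apply, shift_apply]
  · refine Set.mem_biUnion hξ (Set.mem_iUnion.2 ⟨i, k i - 1, ?_⟩)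
    rw [PiLp.add_apply, shift_apply] at h
    push_cast
    linarith

theorem isOpen_pi_Ioo (d : ℕ) (a b : ℝ) : IsOpen {ξ : Space d | ∀ i, ξ i ∈ Set.Ioo a b} := by
  simp only [Set.ofPred_forall]
  exact isOpen_iInter_of_finite fun i => isOpen_Ioo.preimage (EuclideanSpace.proj (𝕜 := ℝ) i).continuous

/-- Assembling the local contributions. -/
theorem eqUpToLittleO_of_localApprox {φ : Lattice d → ℂ} (hφ : Summable fun x => ‖φ x‖)
    (hsup : ∀ ξ, ‖fourier φ ξ‖ ≤ 1) (hfin : (Omega φ).Finite) {o : Space d → ℝ}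
    {h : Space d → ℕ → Lattice d → ℂ} {X : ℕ → Set (Lattice d)} {μ : ℝ}
    (hμ : ∀ ξ ∈ Omega φ, μ ≤ o ξ) (hloc : ∀ ξ ∈ Omega φ, LocalApprox φ ξ X (h ξ) (o ξ)) :
    EqUpToLittleO (convPow φ)
      (fun n x => ∑ ξ ∈ hfin.toFinset with o ξ = μ, phase φ n x ξ * h ξ n x) μ X := by
  classical
  obtain ⟨a, ha⟩ := exists_box_avoiding hfin
  choose k hk using exists_add_shift_mem_box (d := d) a
  set rep : Space d → Space d := fun ξ => ξ + shift (k ξ)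
  have hrep : ∀ ξ ∈ Omega φ, rep ξ ∈ {ξ : Space d | ∀ i, ξ i ∈ Set.Ioo a (a + 2 * Real.pi)} :=
    fun ξ hξ i => ⟨(hk ξ i).1, lt_of_le_of_ne (hk ξ i).2 (ha ξ hξ (k ξ) i).2⟩
  have hinj : Set.InjOn rep (Omega φ) := by
    intro ξ hξ ζ hζ heq
    have e : ζ = ξ + shift (k ξ - k ζ) := by
      have h1 : ξ + shift (k ξ) = ζ + shift (k ζ) := heq
      ext i
      have h2 := congrArg (fun v : Space d => v i) h1
      simp only [PiLp.add_apply, shift_apply] at h2 ⊢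
      simp only [Pi.sub_apply, Int.cast_sub]
      linarith
    have h2 := (mem_Omega_iff.1 hζ).1
    rw [e] at h2
    have h3 := shift_eq_zero_of_mem_box (mem_Omega_iff.1 hξ).1 h2
    rw [e, h3, shift_zero, add_zero]
  -- This is needed on the closed cube, where compactness gives the maximum of `|φ̂|`. The choice of
  -- `a` rules out the faces, and inside the half-open cube representatives modulo `2πℤ^d` are
  -- unique.
  have hsurj : ∀ z : Space d, (∀ i, z i ∈ Set.Icc a (a + 2 * Real.pi)) → ‖fourier φ z‖ = 1 →
      ∃ ξ ∈ Omega φ, z = rep ξ := by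
    intro z hz hz1
    obtain ⟨j, hj⟩ := exists_add_shift_mem_box (-Real.pi) z
    have hΩ : z + shift j ∈ Omega φ := mem_Omega_iff.2 ⟨hj, by rw [fourier_add_shift]; exact hz1⟩
    have e : z = (z + shift j) + shift (-j) := by
      ext i
      simp only [PiLp.add_apply, shift_apply, Pi.neg_apply, Int.cast_neg]
      ring
    have hzb : z ∈ box d a := fun i => by
      refine ⟨lt_of_le_of_ne (hz i).1 (Ne.symm ?_), (hz i).2⟩
      rw [e]
      exact (ha _ hΩ (-j) i).1
    have e2 : rep (z + shift j) = z + shift (j + k (z + shift j)) := by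
      ext i
      simp only [rep, PiLp.add_apply, shift_apply, Pi.add_apply, Int.cast_add]
      ring
    have h3 := hk (z + shift j)
    change rep (z + shift j) ∈ box d a at h3
    rw [e2] at h3
    refine ⟨_, hΩ, ?_⟩
    rw [e2, shift_eq_zero_of_mem_box hzb h3, shift_zero, add_zero]
  obtain ⟨W, hW, hWdisj⟩ := (hfin.image rep).t2_separation
  have hU : ∀ ξ, ξ ∈ Omega φ → {u : Space d | u + rep ξ ∈ W (rep ξ) ∩
      {ξ : Space d | ∀ i, ξ i ∈ Set.Ioo a (a + 2 * Real.pi)}} ∈ 𝓝 (0 : Space d) := by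
    intro ξ hξ
    have ho : IsOpen (W (rep ξ) ∩ {ξ : Space d | ∀ i, ξ i ∈ Set.Ioo a (a + 2 * Real.pi)}) :=
      (hW _).2.inter (isOpen_pi_Ioo d _ _)
    have hc : Continuous fun u : Space d => u + rep ξ := by fun_prop
    refine (ho.preimage hc).mem_nhds ?_
    rw [Set.mem_preimage, zero_add]
    exact ⟨(hW _).1, hrep ξ hξ⟩
  choose! V hVU hVo hV0 hV using fun ξ hξ => (hloc ξ hξ).1 _ (hU ξ hξ)
  set T : Space d → Set (Space d) := fun ξ => {z | z - rep ξ ∈ V ξ}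
  have hTo : ∀ ξ ∈ Omega φ, IsOpen (T ξ) := fun ξ hξ =>
    (hVo ξ hξ).preimage (by fun_prop : Continuous fun z : Space d => z - rep ξ)
  have hTsub : ∀ ξ ∈ Omega φ, ∀ z ∈ T ξ, z ∈ W (rep ξ) ∧ ∀ i, z i ∈ Set.Ioo a (a + 2 * Real.pi) := by
    intro ξ hξ z hz
    have := hVU ξ hξ hz
    rw [Set.mem_ofPred_eq, sub_add_cancel] at this
    exact this
  set O := hfin.toFinset
  have hO : ∀ ξ, ξ ∈ O ↔ ξ ∈ Omega φ := fun ξ => hfin.mem_toFinset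
  set TT : Set (Space d) := ⋃ ξ ∈ O, T ξ
  have hTTo : IsOpen TT := isOpen_biUnion fun ξ hξ => hTo ξ ((hO ξ).1 hξ)
  have hTTbox : TT ⊆ box d a := by
    intro z hz
    obtain ⟨ξ, hξ, hz⟩ := Set.mem_iUnion₂.1 hz
    exact fun i => Set.Ioo_subset_Ioc_self ((hTsub ξ ((hO ξ).1 hξ) z hz).2 i)
  -- outside of the neighbourhoods the Fourier transform is bounded away from `1`
  obtain ⟨ρ, hρ0, hρ1, hρ⟩ : ∃ ρ : ℝ, 0 ≤ ρ ∧ ρ < 1 ∧ ∀ z ∈ box d a \ TT, ‖fourier φ z‖ ≤ ρ := by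
    have hK : IsCompact ({ξ : Space d | ∀ i, ξ i ∈ Set.Icc a (a + 2 * Real.pi)} \ TT) :=
      (isCompact_pi_Icc d a _).diff hTTo
    have hsub : box d a \ TT ⊆ {ξ : Space d | ∀ i, ξ i ∈ Set.Icc a (a + 2 * Real.pi)} \ TT :=
      fun z hz => ⟨fun i => Set.Ioc_subset_Icc_self (hz.1 i), hz.2⟩
    rcases Set.eq_empty_or_nonempty ({ξ : Space d | ∀ i, ξ i ∈ Set.Icc a (a + 2 * Real.pi)} \ TT)
      with he | hne
    · exact ⟨0, le_rfl, one_pos, fun z hz => by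
        have := hsub hz
        rw [he] at this
        exact this.elim⟩
    · obtain ⟨z₀, hz₀, hmax⟩ := hK.exists_isMaxOn hne (continuous_fourier hφ).norm.continuousOn
      refine ⟨‖fourier φ z₀‖, norm_nonneg _, lt_of_le_of_ne (hsup z₀) fun h1 => ?_, fun z hz => hmax (hsub hz)⟩
      obtain ⟨ξ, hξ, e⟩ := hsurj z₀ hz₀.1 h1
      refine hz₀.2 (Set.mem_biUnion ((hO ξ).2 hξ) ?_)
      change z₀ - rep ξ ∈ V ξ
      rw [e, sub_self]
      exact hV0 ξ hξ
  set c : ℂ := 1 / (2 * (Real.pi : ℂ)) ^ d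
  have hint : ∀ n x, IntegrableOn (localIntegrand (fourier φ) n (toSpace x)) (box d a) := fun n x =>
    ((continuous_localIntegrand (continuous_fourier hφ) n _).continuousOn.integrableOn_compact
      (isCompact_pi_Icc d a (a + 2 * Real.pi))).mono_set
      fun z hz i => Set.Ioc_subset_Icc_self (hz i)
  have hsplit : ∀ n x, convPow φ n x = (∑ ξ ∈ O, c * ∫ u in V ξ, localIntegrand (fourier φ) n (toSpace x) (u + ξ))
      + c * ∫ z in box d a \ TT, localIntegrand (fourier φ) n (toSpace x) z := by
    intro n x
    rw [convPow_eq_integral hφ a n x, ← Finset.mul_sum, ← mul_add]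
    congr 1
    have e1 : ∫ z in TT, localIntegrand (fourier φ) n (toSpace x) z
        = ∑ ξ ∈ O, ∫ z in T ξ, localIntegrand (fourier φ) n (toSpace x) z := by
      refine integral_biUnion_finset O (fun ξ hξ => (hTo ξ ((hO ξ).1 hξ)).measurableSet) ?_ ?_
      · intro ξ hξ ζ hζ hne
        have hξ' := (hO ξ).1 hξ
        have hζ' := (hO ζ).1 hζ
        have := hWdisj (Set.mem_image_of_mem rep hξ') (Set.mem_image_of_mem rep hζ')
          fun h => hne (hinj hξ' hζ' h)
        exact this.mono (fun z hz => (hTsub ξ hξ' z hz).1) fun z hz => (hTsub ζ hζ' z hz).1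
      · intro ξ hξ
        exact (hint n x).mono_set ((Set.subset_biUnion_of_mem (u := T) hξ).trans hTTbox)
    -- The integral lives around the representative of `ξ` in the new cube; periodicity in `ξ` for
    -- integer `x` carries it back to `ξ`.
    have e2 : ∀ ξ, ∫ z in T ξ, localIntegrand (fourier φ) n (toSpace x) z
        = ∫ u in V ξ, localIntegrand (fourier φ) n (toSpace x) (u + ξ) := by
      intro ξ
      rw [setIntegral_add_right_eq]
      congr 1
      funext u
      simp only [rep]
      rw [← add_assoc, localIntegrand_add_shift]
    have e3 : box d a = TT ∪ (box d a \ TT) := (Set.union_sdiff_cancel hTTbox).symm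
    conv_lhs => rw [e3]
    rw [setIntegral_union Set.disjoint_sdiff_right ((measurableSet_box d a).diff hTTo.measurableSet)
      ((hint n x).mono_set hTTbox) ((hint n x).mono_set Set.sdiff_subset), e1,
      Finset.sum_congr rfl fun ξ _ => e2 ξ]
  have hrest : EqUpToLittleO (fun n x => c * ∫ z in box d a \ TT, localIntegrand (fourier φ) n (toSpace x) z)
      (fun _ _ => 0) μ X := by
    refine eqUpToLittleO_zero_of_geometric (C := volume.real (box d a \ TT)) hρ0 hρ1 fun n x _ => ?_
    rw [norm_mul]
    refine (mul_le_of_le_one_left (norm_nonneg _) norm_inv_two_pi_pow_le).trans ?_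
    rw [mul_comm]
    refine norm_setIntegral_le_of_norm_le_const
      ((measure_mono Set.sdiff_subset).trans_lt (volume_box_lt_top d a)) fun z hz => ?_
    unfold localIntegrand
    rw [norm_mul, norm_exp_neg_I_mul, mul_one, norm_pow]
    exact pow_le_pow_left₀ (norm_nonneg _) (hρ z hz) n
  have hterm : ∀ ξ ∈ O, EqUpToLittleO
      (fun n x => c * ∫ u in V ξ, localIntegrand (fourier φ) n (toSpace x) (u + ξ))
      (fun n x => if o ξ = μ then phase φ n x ξ * h ξ n x else 0) μ X := by
    intro ξ hξ
    have hξ' := (hO ξ).1 hξ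
    have h1 := (hV ξ hξ').mono_order (hμ ξ hξ')
    by_cases he : o ξ = μ
    -- Away from minimal order the term itself is `O(n^{-o ξ})` with `o ξ > μ`, hence replaceable by
    -- `0`.
    · simpa [he] using h1
    · simp only [he, if_false]
      refine h1.trans ?_
      obtain ⟨C, N, hC, hCN⟩ := (hloc ξ hξ').2
      refine eqUpToLittleO_zero_of_bound (C := C) (N := N) (ν := o ξ)
        (lt_of_le_of_ne (hμ ξ hξ') (Ne.symm he)) fun n hn x hx => ?_
      rw [norm_mul, norm_phase hξ'.2, one_mul]
      exact hCN n hn x hx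
  have := ((EqUpToLittleO.sum hterm).add hrest).congr_left hsplit
  simpa [Finset.sum_filter] using this
end
end LLT

/-! ### The local limit theorem -/

theorem theorem3p7 (d : ℕ) (hd : 0 < d) (φ : Lattice d → ℂ) (hφ : φ ∈ RapidlyDecreasing d)
    (hsup : IsLUB (Set.range fun ξ : Space d => ‖fourier φ ξ‖) 1)
    (D : Space d → Expansion d)
    (hD : ∀ ξ ∈ Omega φ, (D ξ).IsPositiveType φ ξ ∨ (D ξ).IsImaginaryType φ ξ)
    (α : Space d)
    (hI : (OmegaI φ D).Nonempty →
      (∀ ξ ∈ OmegaI φ D, (D ξ).order φ ξ < 1) ∧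
      (∃ ξ ∈ OmegaI φ D, (D ξ).order φ ξ = orderPhi φ D) ∧
      (∀ ξ ∈ OmegaI φ D, (D ξ).drift = α)) :
    -- the sums below are finite and the integrals defining the attractors converge
    (Omega φ).Finite ∧
    (∀ ξ ∈ OmegaP φ D, ∀ t : ℝ, 0 < t → ∀ x : Space d,
      MeasureTheory.Integrable (integrandP (D ξ).R (D ξ).Q t x)) ∧
    (∀ ξ ∈ OmegaI φ D, ∀ t : ℝ, 0 < t → ∀ x : Space d, RenormConverges (D ξ).Q t x) ∧
    -- Case 1
    (Omega φ = OmegaP φ D →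
      EqUpToLittleO (convPow φ) (sumP φ D (minimalPoints φ D (Omega φ))) (orderPhi φ D)
        (fun _ => Set.univ)) ∧
    -- Case 2
    ((OmegaI φ D).Nonempty →
      -- Case 2a
      ((Omega φ = OmegaI φ D ∨ ∀ ξ ∈ OmegaP φ D, orderPhi φ D < (D ξ).order φ ξ) →
        minimalPoints φ D (Omega φ) ⊆ OmegaI φ D ∧
        EqOnGrowingCompacts (convPow φ) (sumI φ D α (minimalPoints φ D (Omega φ)))
          (orderPhi φ D) α) ∧
      -- Case 2b
      ((∃ ξ ∈ OmegaI φ D, (D ξ).order φ ξ = orderPhi φ D) →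
        (∃ ξ ∈ OmegaP φ D, (D ξ).order φ ξ = orderPhi φ D) →
        EqOnGrowingCompacts (convPow φ)
          (fun n x => sumI φ D α (minimalPoints φ D (OmegaI φ D)) n x +
            sumP φ D (minimalPoints φ D (OmegaP φ D)) n x)
          (orderPhi φ D) α)) := by
  classical
  have hφs := RapidlyDecreasing.summable_norm hφ
  have hle : ∀ ξ, ‖fourier φ ξ‖ ≤ 1 := fun ξ => hsup.1 ⟨ξ, rfl⟩
  have hfin := finite_Omega hφs hD
  have hmin : ∀ ξ ∈ Omega φ, orderPhi φ D ≤ (D ξ).order φ ξ := fun ξ hξ =>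
    csInf_le (hfin.image _).bddBelow ⟨ξ, hξ, rfl⟩
  have hPI : ∀ ξ ∈ OmegaI φ D, ξ ∉ OmegaP φ D := fun ξ hξ hP =>
    Expansion.not_isPositiveType_of_isImaginaryType hd hξ.2 hP.2
  -- One family of attractors for all points of `Ω(φ)`; since the types exclude each other, the
  -- second branch is taken exactly at the points of imaginary type there.
  let h : Space d → ℕ → Lattice d → ℂ := fun ξ n x =>
    if ξ ∈ OmegaP φ D then attractorP (D ξ).R (D ξ).Q n (toSpace x - (n : ℝ) • (D ξ).drift)
    else attractorI (D ξ).Q n (toSpace x - (n : ℝ) • α)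
  have hcoe : minimalPoints φ D (Omega φ)
      = ((hfin.toFinset.filter fun ξ => (D ξ).order φ ξ = orderPhi φ D : Finset (Space d)) : Set (Space d)) := by
    ext ξ
    simp [minimalPoints]
  have hsum : ∀ F : Space d → ℂ, ∑ ξ ∈ hfin.toFinset with (D ξ).order φ ξ = orderPhi φ D, F ξ
      = ∑ᶠ ξ ∈ minimalPoints φ D (Omega φ), F ξ := by
    intro F
    rw [hcoe, finsum_mem_coe_finset]
  have hlocP : ∀ X : ℕ → Set (Lattice d), ∀ ξ ∈ OmegaP φ D,
      LocalApprox φ ξ X (h ξ) ((D ξ).order φ ξ) := by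
    intro X ξ hξ
    have := localApprox_positive hφs hξ.1.2 hξ.2 X
    simpa only [h, if_pos hξ] using this
  -- Both subcases of Case 2 follow from this single expansion; they differ only in how the sum over
  -- minimal points is sorted by type. The common drift `α` lets one family of balls around `n α`
  -- serve all points of imaginary type.
  have hgrow : (OmegaI φ D).Nonempty → EqOnGrowingCompacts (convPow φ)
      (fun n x => ∑ᶠ ξ ∈ minimalPoints φ D (Omega φ), phase φ n x ξ * h ξ n x) (orderPhi φ D) α := by
    intro hne
    obtain ⟨hlt, -, hdrift⟩ := hI hne
    refine eqOnGrowingCompacts_of_forall_radius fun r => ?_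
    simp_rw [← hsum]
    refine eqUpToLittleO_of_localApprox hφs hle hfin hmin fun ξ hξ => ?_
    rcases hD ξ hξ with hP | hIm
    · exact hlocP _ ξ ⟨hξ, hP⟩
    · have hξI : ξ ∈ OmegaI φ D := ⟨hξ, hIm⟩
      have := localApprox_imaginary hd hφs hξ.2 hIm (hlt ξ hξI) r
      rw [hdrift ξ hξI] at this
      simpa only [h, if_neg (hPI ξ hξI)] using this
  refine ⟨hfin, ?_, ?_, ?_, ?_⟩
  · intro ξ hξ t ht x
    obtain ⟨hR, E, hE, -, hf, -⟩ := hξ.2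
    exact integrable_integrandP (D ξ).continuous_Q hR hE hf.1 ht x
  · intro ξ hξ t ht x
    have hlt := (hI ⟨ξ, hξ⟩).1 ξ hξ
    rw [Expansion.order_of_isImaginaryType hd hξ.2] at hlt
    obtain ⟨hN, -, E, hE, -, -, -, hf, -⟩ := hξ.2
    rw [hN.homOrder_eq hE hf.1] at hlt
    exact renormConverges (D ξ).continuous_Q hN hE hf.1 hlt ht x
  · intro hΩ
    have hall : ∀ ξ ∈ Omega φ, ξ ∈ OmegaP φ D := fun ξ hξ => hΩ ▸ hξ
    have hmain := eqUpToLittleO_of_localApprox hφs hle hfin hmin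
      fun ξ hξ => hlocP (fun _ => Set.univ) ξ (hall ξ hξ)
    convert hmain using 1
    funext n x
    rw [hsum]
    refine finsum_mem_congr rfl fun ξ hξ => ?_
    simp only [h, if_pos (hall ξ hξ.1)]
  · intro hne
    refine ⟨fun hcase => ?_, fun _ _ => ?_⟩
    · have hsub : minimalPoints φ D (Omega φ) ⊆ OmegaI φ D := by
        intro ξ hξ
        rcases hcase with hΩ | hlt
        · exact hΩ ▸ hξ.1
        · rcases hD ξ hξ.1 with hP | hIm
          · exact absurd hξ.2 (hlt ξ ⟨hξ.1, hP⟩).ne'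
          · exact ⟨hξ.1, hIm⟩
      refine ⟨hsub, ?_⟩
      convert hgrow hne using 1
      funext n x
      refine finsum_mem_congr rfl fun ξ hξ => ?_
      simp only [h, if_neg (hPI ξ (hsub hξ))]
    · convert hgrow hne using 1
      funext n x
      have hunion : minimalPoints φ D (Omega φ)
          = minimalPoints φ D (OmegaI φ D) ∪ minimalPoints φ D (OmegaP φ D) := by
        ext ξ
        constructor
        · intro hξ
          rcases hD ξ hξ.1 with hP | hIm
          · exact Or.inr ⟨⟨hξ.1, hP⟩, hξ.2⟩
          · exact Or.inl ⟨⟨hξ.1, hIm⟩, hξ.2⟩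
        · rintro (hξ | hξ)
          · exact ⟨hξ.1.1, hξ.2⟩
          · exact ⟨hξ.1.1, hξ.2⟩
      have hdisj : Disjoint (minimalPoints φ D (OmegaI φ D)) (minimalPoints φ D (OmegaP φ D)) :=
        Set.disjoint_left.2 fun ξ h1 h2 => hPI ξ h1.1 h2.1
      rw [hunion, finsum_mem_union hdisj (hfin.subset fun ξ hξ => hξ.1.1)
        (hfin.subset fun ξ hξ => hξ.1.1)]
      congr 1
      · refine finsum_mem_congr rfl fun ξ hξ => ?_
        simp only [h, if_neg (hPI ξ hξ.1)]
      · refine finsum_mem_congr rfl fun ξ hξ => ?_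
        simp only [h, if_pos hξ.1]
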